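/- **Setting.** Let $G=(V,E,\ell)$ be a finite undirected graph with lengths $\ell:E\to(0,\infty)$, $n=|V|$, $m=|E|$, and let $v_0:V\to\mathbb R\cup\{*\}$ be a voltage assignment with terminal set $T(v_0)=\{x: v_0(x)\ne *\}$. The instance $(G,v_0)$ is *well-posed* if every connected component of $G$ contains a terminal. A path is a sequence $P=(x_0,\dots,x_k)$ of successively adjacent, not necessarily distinct vertices, of length $\ell(P)=\sum_{i=1}^k\ell(x_{i-1},x_i)$. A *free terminal path* is a path with $k\ge 1$ edges whose endpoints are terminals and none of whose edges joins two terminals; its gradient is $\nabla P(v_0)=(v_0(x_0)-v_0(x_k))/\ell(P)$. A *steepest fixable path* is a free terminal path whose gradient is the largest among all free terminal paths. Let $\mathrm{dist}$ be the shortest-path distance for $\ell$. **Algorithm.** $\textsc{SteepestPath}(G,v_0)$ does the following. 1. Draw an edge $\{x_1,x_2\}\in E$ and a vertex $x_3\in V$ independently and uniformly at random. 2. For $i=1,2,3$ run $\textsc{VertexSteepestPath}(G,v_0,x_i)$, which returns a path $P_i$, and let $P$ be one of the $P_i$ with the largest gradient, and $\alpha=\nabla P(v_0)$. 3. Compute,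 by two runs of Dijkstra's algorithm with a Fibonacci heap, $\mathsf{vLow}[\alpha](x)=\min_{t\in T(v_0)}(v_0(t)+\alpha\,\mathrm{dist}(x,t))$ and $\mathsf{vHigh}[\alpha](x)=\max_{t\in T(v_0)}(v_0(t)-\alpha\,\mathrm{dist}(t,x))$, where the starting key of a terminal $t$ is $v_0(t)$, respectively $-v_0(t)$, and edge lengths are multiplied by $\alpha$. Let $G'$ be the subgraph induced on $\{x:\mathsf{vHigh}[\alpha](x)>\mathsf{vLow}[\alpha](x)\}$. 4. If $G'$ has no edge, return $P$; otherwise return $\textsc{SteepestPath}(G',v_0|_{V_{G'}})$. $\textsc{VertexSteepestPath}(G,v_0,x)$ computes $d(t)=\mathrm{dist}(x,t)$ for all $t$ by Dijkstra's algorithm with a Fibonacci heap and considers only the terminals at finite distance. If $x$ is a terminal, it picks a terminal $y\ne x$ maximising $|v_0(x)-v_0(y)|/d(y)$ and returns a shortest path between $x$ and $y$, directed from the higher to the lower voltage; if there is no such $y$, it returns nothing, and $x$ is not taken into account in step 2. If $x$ is not a terminal, it obtains $(t_1,t_2)$ from $\textsc{StarSteepestPath}(T,v_0,d)$ and returns a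 shortest path from $t_1$ to $x$ followed by a shortest path from $x$ to $t_2$. $\textsc{StarSteepestPath}(T,v,d)$ draws $t_1\in T$ uniformly, picks $t_2\in T$ maximising $|v(t_1)-v(t)|/(d(t_1)+d(t))$, with maximum value $\alpha$, and computes $v_{\mathsf{low}}=\min_{t\in T}(v(t)+\alpha d(t))$ and $v_{\mathsf{high}}=\max_{t\in T}(v(t)-\alpha d(t))$. Let $T'$ be the set of $t\in T$ with $v(t)-\alpha d(t)>v_{\mathsf{low}}$ or $v(t)+\alpha d(t)<v_{\mathsf{high}}$. If $T'=\emptyset$, it returns $t_1,t_2$ in the order of decreasing voltage; otherwise it returns $\textsc{StarSteepestPath}(T',v|_{T'},d|_{T'})$. **Cost.** The algorithm is run on a random access machine with exact real arithmetic: one step for each access to an array cell, each arithmetic operation or comparison, each list cell created or visited, and each uniform random draw from an array; the operations of the Fibonacci heap are charged step by step in the same way. The input is given by an array of the vertices, an array of the edges, the adjacency lists with the edge lengths, and the array of the voltages. **Theorem.** There is an absolute constant $C>0$ such that the following holds for every well-posed instance $(G,v_0)$ with $T(v_0)\ne V$ and without edges between terminals, and for every such encoding of it. $\textsc{SteepestPath}(G,v_0)$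 always (for every outcome of its random choices) returns a steepest fixable path in $(G,v_0)$, and its expected number of steps is at most $C\,(m+n\log n)$. -/

import Mathlib

namespace LexLearn

/-! ## Partially labelled graphs, terminal paths, steepest fixable paths

The graph `G : SimpleGraph V` is undirected with lengths `len : Sym2 V → ℝ`.  A voltage assignment
is `v₀ : V → Option ℝ`; the value `none` means that the vertex carries no voltage. -/

/-- `x` is a terminal of `v₀`, i.e. `x ∈ T(v₀)`. -/
def IsTerminal {V : Type} (v₀ : V → Option ℝ) (x : V) : Prop := v₀ x ≠ none

/-- Every connected component of `G` contains a terminal. -/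
def WellPosed {V : Type} (G : SimpleGraph V) (v₀ : V → Option ℝ) : Prop :=
  ∀ c : G.ConnectedComponent, ∃ t : V, G.connectedComponentMk t = c ∧ IsTerminal v₀ t

/-- The length of a path, a path being a sequence of successively adjacent, not necessarily
distinct vertices. -/
def pathLength {V : Type} {G : SimpleGraph V} (len : Sym2 V → ℝ) {s t : V} (w : G.Walk s t) : ℝ :=
  (w.edges.map len).sum

/-- The gradient `∇P(v₀) = (v₀(s) - v₀(t)) / ℓ(P)` of a path from `s` to `t` (used for terminals
`s`, `t` and paths with at least one edge only). -/
noncomputable def pathGradient {V : Type} {G : SimpleGraph V} (len : Sym2 V → ℝ)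
    (v₀ : V → Option ℝ) {s t : V} (w : G.Walk s t) : ℝ :=
  ((v₀ s).getD 0 - (v₀ t).getD 0) / pathLength len w

/-- A path between two terminals that has at least one edge and no terminal-terminal edge. -/
structure IsFreeTerminalPath {V : Type} {G : SimpleGraph V} (v₀ : V → Option ℝ) {s t : V}
    (w : G.Walk s t) : Prop where
  source : IsTerminal v₀ s
  target : IsTerminal v₀ t
  nontrivial : ¬ w.Nil
  free : ∀ d ∈ w.darts, ¬ (IsTerminal v₀ d.fst ∧ IsTerminal v₀ d.snd)

/-- A free terminal path whose gradient is the largest among all free terminal paths. -/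
def IsSteepestFixablePath {V : Type} {G : SimpleGraph V} (len : Sym2 V → ℝ) (v₀ : V → Option ℝ)
    {s t : V} (w : G.Walk s t) : Prop :=
  IsFreeTerminalPath v₀ w ∧
    ∀ (s' t' : V) (w' : G.Walk s' t'), IsFreeTerminalPath v₀ w' →
      pathGradient len v₀ w' ≤ pathGradient len v₀ w

/-! ## Step counting

Algorithms are written for a random access machine with exact real arithmetic.  One step is charged
for each access to an array cell, each arithmetic operation or comparison, each cell of a linked
list that is created or visited, and each uniformly random draw from an array.  Arrays are functions
on their index set and are only ever used destructively: the old version of an array is not read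
after a write.  Arrays are allocated uninitialised; each cell is written before it is read. -/

/-- A deterministic computation: its result and the number of steps it takes. -/
structure Timed (α : Type) where
  val : α
  cost : ℕ

instance : Monad Timed where
  pure a := ⟨a, 0⟩
  bind t f := ⟨(f t.val).val, t.cost + (f t.val).cost⟩

/-- One elementary operation with result `a`. -/
def op {α : Type} (a : α) : Timed α := ⟨a, 1⟩

/-- Read a cell of an array. -/
def rd {ι α : Type} (A : ι → α) (i : ι) : Timed α := ⟨A i, 1⟩

/-- Write a cell of an array. -/
def wr {ι α : Type} [DecidableEq ι] (A : ι → α) (i : ι) (a : α) : Timed (ι → α) :=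
  ⟨Function.update A i a, 1⟩

/-- Run `body` on the elements of a list in order, threading a state. -/
def forEach {α σ : Type} (body : σ → α → Timed σ) : σ → List α → Timed σ
  | s, [] => pure s
  | s, a :: l => do
    let _ ← op ()
    let s' ← body s a
    forEach body s' l

/-- The sublist of the elements that pass a test. -/
def filterT {α : Type} (test : α → Timed Bool) : List α → Timed (List α)
  | [] => pure []
  | a :: l => do
    let b ← test a
    let l' ← filterT test l
    if b then op (a :: l') else op l'

/-- An element of a list with the best score, together with that score. -/
def argBest {α : Type} (better : ℝ → ℝ → Bool) (score : α → Timed ℝ) (l : List α) :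
    Timed (Option (α × ℝ)) :=
  forEach (fun best a => do
    let s ← score a
    match best with
    | none => op (some (a, s))
    | some (a', s') => do
      let b ← op (better s s')
      if b then op (some (a, s)) else op (some (a', s'))) none l

/-- Comparison for maximising a score. -/
noncomputable def larger (a b : ℝ) : Bool := decide (b < a)

/-- Comparison for minimising a score. -/
noncomputable def smaller (a b : ℝ) : Bool := decide (a < b)

/-- A randomised computation: the joint law of its result and the number of steps it takes. -/
def Rand (α : Type) : Type := PMF (α × ℕ)

noncomputable instance : Monad Rand where
  pure a := PMF.pure (a, 0)
  bind μ f := PMF.bind μ fun p => PMF.map (fun q => (q.1, p.2 + q.2)) (f p.1)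

/-- A deterministic computation as a randomised one. -/
noncomputable def det {α : Type} (t : Timed α) : Rand α := PMF.pure (t.val, t.cost)

/-- Draw the element at a uniformly random position of an array; `none` if there is no position. -/
noncomputable def pick {α : Type} : List α → Rand (Option α)
  | [] => PMF.pure (none, 1)
  | a :: l => PMF.map (fun i : Fin (l.length + 1) => (some ((a :: l).get i), 1))
      (PMF.uniformOfFintype (Fin (l.length + 1)))

/-- `o` is a possible result of the randomised computation (it has positive probability). -/
def Rand.CanReturn {α : Type} (μ : Rand α) (o : α) : Prop :=
  ∃ k : ℕ, (o, k) ∈ PMF.support (α := α × ℕ) μ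

/-- The expected number of steps. -/
noncomputable def Rand.expectedCost {α : Type} (μ : Rand α) : ENNReal :=
  ∑' p : α × ℕ, (show PMF (α × ℕ) from μ) p * (p.2 : ENNReal)

/-! ## Fibonacci heaps -/

/-- A Fibonacci heap whose elements are vertices.  `up` holds the parent in the heap forest, `kids`
the child lists, `rank` the numbers of children and `mark` the marks for cascading cuts.  `roots`
is the list of the roots and `top` a root with the least key.  The cells `slot r`, `r < height`,
are the bins by rank used while trees are merged; `cap` is the number of elements ever inserted.
A child that is cut is not unlinked from the list of its former parent at once: an entry `c` of
`kids x` with `up c ≠ some x` is obsolete, and it is skipped when `x` is removed. -/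
structure FibHeap (V : Type) where
  key : V → WithTop ℝ
  up : V → Option V
  kids : V → List V
  rank : V → ℕ
  mark : V → Bool
  roots : List V
  top : Option V
  slot : ℕ → Option V
  height : ℕ
  cap : ℕ

namespace FibHeap

variable {V : Type} [DecidableEq V]

/-- The heap without elements. -/
def empty : FibHeap V where
  key := fun _ => ⊤
  up := fun _ => none
  kids := fun _ => []
  rank := fun _ => 0
  mark := fun _ => false
  roots := []
  top := none
  slot := fun _ => none
  height := 0
  cap := 0

/-- The root with the least key after a look at the vertex `x` of key `k`. -/
noncomputable def newTop (h : FibHeap V) (x : V) (k : WithTop ℝ) : Timed (Option V) :=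
  match h.top with
  | none => op (some x)
  | some z => do
    let kz ← rd h.key z
    let b ← op (decide (k < kz))
    if b then op (some x) else op (some z)

/-- Insert the new element `x` with key `k`, as a tree of its own. -/
noncomputable def insert (h : FibHeap V) (x : V) (k : WithTop ℝ) : Timed (FibHeap V) := do
  let key ← wr h.key x k
  let up ← wr h.up x none
  let kids ← wr h.kids x []
  let rank ← wr h.rank x 0
  let mark ← wr h.mark x false
  let roots ← op (x :: h.roots)
  let slot ← wr h.slot h.cap none
  let cap ← op (h.cap + 1)
  let top ← newTop { h with key := key } x k
  pure { key := key, up := up, kids := kids, rank := rank, mark := mark, roots := roots,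
         top := top, slot := slot, height := h.height, cap := cap }

/-- Cut the tree of `x` off its parent `p` and make it a tree of its own. -/
def cut (h : FibHeap V) (x p : V) : Timed (FibHeap V) := do
  let up ← wr h.up x none
  let mark ← wr h.mark x false
  let r ← rd h.rank p
  let r' ← op (r - 1)
  let rank ← wr h.rank p r'
  let roots ← op (x :: h.roots)
  pure { h with up := up, mark := mark, rank := rank, roots := roots }

/-- After `y` has lost a child: mark `y` if it was unmarked; otherwise cut it off as well and go on
with its parent.  Roots are left alone.  The first argument bounds the number of rounds. -/
def cascade : ℕ → FibHeap V → V → Timed (FibHeap V)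
  | 0, h, _ => pure h
  | n + 1, h, y => do
    let q ← rd h.up y
    match q with
    | none => pure h
    | some p => do
      let b ← rd h.mark y
      if b then do
        let h' ← cut h y p
        cascade n h' p
      else do
        let mark ← wr h.mark y true
        pure { h with mark := mark }

/-- Decrease the key of `x` to `k`. -/
noncomputable def decreaseKey (h₀ : FibHeap V) (x : V) (k : WithTop ℝ) : Timed (FibHeap V) := do
  let key ← wr h₀.key x k
  let h₁ : FibHeap V := { h₀ with key := key }
  let q ← rd h₁.up x
  let h₂ ← match q with
    | none => pure h₁
    | some p => do
      let kp ← rd h₁.key p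
      let b ← op (decide (k < kp))
      if b then do
        let h' ← cut h₁ x p
        cascade h'.cap h' p
      else pure h₁
  let top ← newTop h₂ x k
  pure { h₂ with top := top }

/-- Make the root `y` a child of the root `x`. -/
def link (h : FibHeap V) (y x : V) : Timed (FibHeap V) := do
  let up ← wr h.up y (some x)
  let mark ← wr h.mark y false
  let c ← rd h.kids x
  let c' ← op (y :: c)
  let kids ← wr h.kids x c'
  let r ← rd h.rank x
  let r' ← op (r + 1)
  let rank ← wr h.rank x r'
  pure { h with up := up, mark := mark, kids := kids, rank := rank }

/-- Put the tree with root `x` into the bin of its rank; as long as that bin is occupied, merge the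
two trees and go on with the result.  The first argument bounds the number of rounds. -/
noncomputable def place : ℕ → FibHeap V → V → Timed (FibHeap V)
  | 0, h, _ => pure h
  | n + 1, h, x => do
    let r ← rd h.rank x
    let q ← rd h.slot r
    match q with
    | none => do
      let slot ← wr h.slot r (some x)
      let height ← op (max h.height (r + 1))
      pure { h with slot := slot, height := height }
    | some y => do
      let slot ← wr h.slot r none
      let h₁ : FibHeap V := { h with slot := slot }
      let kx ← rd h₁.key x
      let ky ← rd h₁.key y
      let b ← op (decide (ky < kx))
      if b then do
        let h₂ ← link h₁ x y
        place n h₂ y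
      else do
        let h₂ ← link h₁ y x
        place n h₂ x

/-- Make the entry `c` of the child list of the removed vertex `z` a root, unless it is obsolete. -/
def release (z : V) (h : FibHeap V) (c : V) : Timed (FibHeap V) := do
  let q ← rd h.up c
  let b ← op (decide (q = some z))
  if b then do
    let up ← wr h.up c none
    let roots ← op (c :: h.roots)
    pure { h with up := up, roots := roots }
  else pure h

/-- Empty the bin of rank `r` into the list of roots. -/
noncomputable def collect (h : FibHeap V) (r : ℕ) : Timed (FibHeap V) := do
  let q ← rd h.slot r
  match q with
  | none => pure h
  | some x => do
    let slot ← wr h.slot r none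
    let kx ← rd h.key x
    let top ← newTop h x kx
    let roots ← op (x :: h.roots)
    pure { h with slot := slot, top := top, roots := roots }

/-- Remove an element with the least key and return it; `none` if the heap is empty. -/
noncomputable def popMin (h₀ : FibHeap V) : Timed (Option V × FibHeap V) :=
  match h₀.top with
  | none => op (none, h₀)
  | some z => do
    let others ← filterT (fun x => op (decide (x ≠ z))) h₀.roots
    let c ← rd h₀.kids z
    let h₁ ← forEach (release z) { h₀ with roots := others } c
    let h₂ ← op { h₁ with roots := [], top := none, height := 0 }
    let h₃ ← forEach (fun h x => place h.cap h x) h₂ h₁.roots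
    let h₄ ← forEach collect h₃ (List.range h₃.height)
    pure (some z, h₄)

end FibHeap

/-! ## Graphs as inputs -/

/-- A partially labelled graph in memory: an array of the vertices, an array of the edges (each in
one of its two orientations), for each vertex the list of its neighbours with the lengths of the
edges to them, and the array of the voltages. -/
structure GraphData (V : Type) where
  verts : List V
  edges : List (V × V)
  adj : V → List (V × ℝ)
  volt : V → Option ℝ

/-- `g` is a correct encoding of the partially labelled graph `(G, len, v₀)`. -/
structure GraphData.Represents {V : Type} (g : GraphData V) (G : SimpleGraph V) (len : Sym2 V → ℝ)
    (v₀ : V → Option ℝ) : Prop where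
  verts_nodup : g.verts.Nodup
  mem_verts : ∀ x : V, x ∈ g.verts
  edges_nodup : (g.edges.map fun e => s(e.1, e.2)).Nodup
  mem_edges : ∀ x y : V, G.Adj x y ↔ (x, y) ∈ g.edges ∨ (y, x) ∈ g.edges
  adj_nodup : ∀ x : V, (g.adj x).Nodup
  mem_adj : ∀ (x y : V) (a : ℝ), (y, a) ∈ g.adj x ↔ G.Adj x y ∧ a = len s(x, y)
  volt_eq : g.volt = v₀

section Algorithms

variable {V : Type} [DecidableEq V]

/-! ## ModDijkstra -/

/-- The state of a run of ModDijkstra. -/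
structure Search (V : Type) where
  heap : FibHeap V
  finished : V → Bool
  value : V → WithTop ℝ
  parent : V → Option V

/-- Add `x` to the heap with key `+∞`. -/
noncomputable def Search.addVertex (s : Search V) (x : V) : Timed (Search V) := do
  let heap ← s.heap.insert x ⊤
  let finished ← wr s.finished x false
  let parent ← wr s.parent x none
  pure { s with heap := heap, finished := finished, parent := parent }

/-- If `x` is a terminal, decrease its key to its voltage. -/
noncomputable def Search.seed (v₀ : V → Option ℝ) (s : Search V) (x : V) :
    Timed (Search V) := do
  let q ← rd v₀ x
  match q with
  | none => pure s
  | some a => do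
    let heap ← s.heap.decreaseKey x (a : WithTop ℝ)
    pure { s with heap := heap }

/-- Look at the edge of length `e.2` from the finished vertex `x`, of value `vx`, to `e.1`. -/
noncomputable def Search.relax (α : ℝ) (x : V) (vx : WithTop ℝ) (s : Search V) (e : V × ℝ) :
    Timed (Search V) := do
  let f ← rd s.finished e.1
  if f then pure s
  else do
    let ky ← rd s.heap.key e.1
    let c ← op (α * e.2)
    let k ← op (vx + (c : WithTop ℝ))
    let b ← op (decide (k < ky))
    if b then do
      let heap ← s.heap.decreaseKey e.1 k
      let parent ← wr s.parent e.1 (some x)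
      pure { s with heap := heap, parent := parent }
    else pure s

/-- Pop a vertex with the least key, finish it, and look at its edges. -/
noncomputable def Search.visit (g : GraphData V) (α : ℝ) (s₀ : Search V) : Timed (Search V) := do
  let p ← s₀.heap.popMin
  match p.1 with
  | none => pure { s₀ with heap := p.2 }
  | some x => do
    let vx ← rd p.2.key x
    let value ← wr s₀.value x vx
    let finished ← wr s₀.finished x true
    let nbrs ← rd g.adj x
    forEach (Search.relax α x vx)
      { s₀ with heap := p.2, finished := finished, value := value } nbrs

/-- ModDijkstra: computes `min {v₀(t) + α dist(x,t) | t ∈ T(v₀)}` for all vertices `x`, and the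
array of parents.  The loop that empties the heap runs once for each vertex. -/
noncomputable def modDijkstra (g : GraphData V) (v₀ : V → Option ℝ) (α : ℝ) :
    Timed ((V → WithTop ℝ) × (V → Option V)) := do
  let s₀ : Search V := { heap := FibHeap.empty, finished := fun _ => false, value := fun _ => ⊤,
                         parent := fun _ => none }
  let s₁ ← forEach Search.addVertex s₀ g.verts
  let s₂ ← forEach (Search.seed v₀) s₁ g.verts
  let s₃ ← forEach (fun s _ => Search.visit g α s) s₂ g.verts
  pure (s₃.value, s₃.parent)

/-! ## StarSteepestPath -/

/-- A terminal of a star graph: its name, its voltage and its distance from the centre. -/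
structure StarTerminal (V : Type) where
  name : V
  volt : ℝ
  dist : ℝ

/-- `|v(s) - v(t)| / (d(s) + d(t))`. -/
noncomputable def starGradient {V : Type} (s t : StarTerminal V) : Timed ℝ := do
  let a ← op (s.volt - t.volt)
  let b ← op |a|
  let c ← op (s.dist + t.dist)
  op (b / c)

/-- `v(t) + α d(t)`. -/
noncomputable def starLow {V : Type} (α : ℝ) (t : StarTerminal V) : Timed ℝ := do
  let a ← op (α * t.dist)
  op (t.volt + a)

/-- `v(t) - α d(t)`. -/
noncomputable def starHigh {V : Type} (α : ℝ) (t : StarTerminal V) : Timed ℝ := do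
  let a ← op (α * t.dist)
  op (t.volt - a)

/-- The test for membership in `T_low ∪ T_high`. -/
noncomputable def starTest {V : Type} (α low high : ℝ) (t : StarTerminal V) : Timed Bool := do
  let a ← starHigh α t
  let b ← op (decide (low < a))
  if b then pure true
  else do
    let c ← starLow α t
    op (decide (c < high))

/-- StarSteepestPath: a pair `(t₁, t₂)` of terminals of the star with the largest gradient, and
that gradient.  The first argument bounds the depth of the recursion; `none` is returned if it is
exceeded or if there is no terminal. -/
noncomputable def starSteepestPath {V : Type} :
    ℕ → List (StarTerminal V) → Rand (Option (StarTerminal V × StarTerminal V × ℝ))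
  | 0, _ => pure none
  | n + 1, T => do
    let q₁ ← pick T
    match q₁ with
    | none => pure none
    | some t₁ => do
      let q₂ ← det (argBest larger (starGradient t₁) T)
      match q₂ with
      | none => pure none
      | some (t₂, α) => do
        let qlow ← det (argBest smaller (starLow α) T)
        let qhigh ← det (argBest larger (starHigh α) T)
        match qlow, qhigh with
        | some (_, low), some (_, high) => do
          let T' ← det (filterT (starTest α low high) T)
          match T' with
          | [] => do
            let b ← det (op (decide (t₂.volt ≤ t₁.volt)))
            if b then pure (some (t₁, t₂, α)) else pure (some (t₂, t₁, α))
          | _ :: _ => starSteepestPath n T'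
        | _, _ => pure none

/-! ## VertexSteepestPath -/

/-- Follow the parent pointers from `y`, putting the vertices in front of a list: from `y` and the
empty list this gives the path from the root to `y`.  The first argument bounds the number of
rounds. -/
def climb (parent : V → Option V) : ℕ → V → List V → Timed (List V)
  | 0, _, acc => pure acc
  | n + 1, y, acc => do
    let acc' ← op (y :: acc)
    let q ← rd parent y
    match q with
    | none => pure acc'
    | some z => climb parent n z acc'

/-- Put the elements of a list in front of another one, in reverse order. -/
def pushAll {V : Type} (acc l : List V) : Timed (List V) :=
  forEach (fun a z => op (z :: a)) acc l

/-- The list of the terminals at finite distance from the source. -/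
def reachedTerminals (g : GraphData V) (dist : V → WithTop ℝ) : Timed (List (StarTerminal V)) :=
  forEach (fun acc t => do
    let a ← rd g.volt t
    let d ← rd dist t
    match a, d with
    | some a, some d => op ({ name := t, volt := a, dist := d } :: acc)
    | _, _ => pure acc) [] g.verts

/-- `|a - v(t)| / dist(x,t)`, for a terminal `x` of voltage `a`. -/
noncomputable def terminalGradient {V : Type} (a : ℝ) (t : StarTerminal V) : Timed ℝ := do
  let b ← op (a - t.volt)
  let c ← op |b|
  op (c / t.dist)

/-- VertexSteepestPath: a steepest terminal path through `x`, as the list of its vertices, and its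
gradient.  The answer is `none` if `x` is a terminal that no other terminal can be reached from. -/
noncomputable def vertexSteepestPath (g : GraphData V) (x : V) : Rand (Option (List V × ℝ)) := do
  let src₀ ← det (forEach (fun A y => wr A y (none : Option ℝ)) (fun _ => none) g.verts)
  let src ← det (wr src₀ x (some 0))
  let dp ← det (modDijkstra g src 1)
  let T ← det (reachedTerminals g dp.1)
  let vx ← det (rd g.volt x)
  match vx with
  | some a => do
    let T' ← det (filterT (fun t => op (decide (t.name ≠ x))) T)
    let q ← det (argBest larger (terminalGradient a) T')
    match q with
    | none => pure none
    | some (y, α) => do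
      let P ← det (climb dp.2 g.verts.length y.name [])
      let b ← det (op (decide (y.volt ≤ a)))
      if b then pure (some (P, α))
      else do
        let P' ← det (pushAll [] P)
        pure (some (P', α))
  | none => do
    let q ← starSteepestPath T.length T
    match q with
    | none => pure none
    | some (t₁, t₂, α) => do
      let P₁ ← det (climb dp.2 g.verts.length t₁.name [])
      let P₂ ← det (climb dp.2 g.verts.length t₂.name [])
      let P ← det (pushAll P₂ P₁.tail)
      pure (some (P, α))

/-! ## CompHighPressGraph -/

/-- CompVLow. -/
noncomputable def compVLow (g : GraphData V) (α : ℝ) : Timed (V → WithTop ℝ) := do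
  let r ← modDijkstra g g.volt α
  pure r.1

/-- CompVHigh, up to the sign: the result is `-vHigh[α]`. -/
noncomputable def compNegVHigh (g : GraphData V) (α : ℝ) : Timed (V → WithTop ℝ) := do
  let v₁ ← forEach (fun A x => do
    let q ← rd g.volt x
    match q with
    | none => wr A x (none : Option ℝ)
    | some a => do
      let b ← op (-a)
      wr A x (some b)) (fun _ => none) g.verts
  let r ← modDijkstra g v₁ α
  pure r.1

/-- CompHighPressGraph: the subgraph induced on the vertices `x` with `vHigh[α](x) > vLow[α](x)`. -/
noncomputable def compHighPressGraph (g : GraphData V) (α : ℝ) : Timed (GraphData V) := do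
  let low ← compVLow g α
  let negHigh ← compNegVHigh g α
  let inside ← forEach (fun (A : V → Bool) x => do
    let a ← rd low x
    let b ← rd negHigh x
    let c ← op (a + b)
    let d ← op (decide (c < 0))
    wr A x d) (fun _ => false) g.verts
  let verts ← filterT (fun x => rd inside x) g.verts
  let edges ← filterT (fun e => do
    let a ← rd inside e.1
    let b ← rd inside e.2
    op (a && b)) g.edges
  let adj ← forEach (fun (A : V → List (V × ℝ)) x => do
    let l ← rd g.adj x
    let l' ← filterT (fun e => rd inside e.1) l
    wr A x l') (fun _ => []) verts
  pure { verts := verts, edges := edges, adj := adj, volt := g.volt }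

/-! ## SteepestPath -/

/-- The candidate with the larger gradient. -/
noncomputable def steeper {V : Type} (p q : Option (List V × ℝ)) :
    Timed (Option (List V × ℝ)) :=
  match p, q with
  | none, q => op q
  | p, none => op p
  | some p, some q => do
    let b ← op (decide (p.2 < q.2))
    if b then op (some q) else op (some p)

/-- SteepestPath, with a bound on the depth of the recursion as the first argument; `none` is
returned if it is exceeded. -/
noncomputable def steepestPathAux : ℕ → GraphData V → Rand (Option (List V))
  | 0, _ => pure none
  | n + 1, g => do
    let qe ← pick g.edges
    let qx ← pick g.verts
    match qe, qx with
    | some e, some x₃ => do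
      let P₁ ← vertexSteepestPath g e.1
      let P₂ ← vertexSteepestPath g e.2
      let P₃ ← vertexSteepestPath g x₃
      let P₁₂ ← det (steeper P₁ P₂)
      let best ← det (steeper P₁₂ P₃)
      match best with
      | none => pure none
      | some (P, α) => do
        let g' ← det (compHighPressGraph g α)
        match g'.edges with
        | [] => pure (some P)
        | _ :: _ => steepestPathAux n g'
    | _, _ => pure none

/-- SteepestPath; the result is the list of the vertices of a path. -/
noncomputable def steepestPath (g : GraphData V) : Rand (Option (List V)) :=
  steepestPathAux g.verts.length g

end Algorithms

end LexLearn

/-! Measure a vertex `x` by its steepness: the least `α ≥ 0` that bounds the gradients of all walks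
from a terminal through `x` to a terminal. Edges between terminals are excluded, so every nontrivial
walk between terminals is free, and the task is to find a walk that attains the largest steepness.

Correctness. A run of Dijkstra's algorithm from `x` reduces the steepness of `x` to a star:
replacing both halves of a walk through `x` by shortest ones loses nothing, and if `x` is itself a
terminal the walk splits at `x`. Let `α` be the gradient of the best path of a round. Then `vHigh[α]
x > vLow[α] x` holds exactly when some terminal walk through `x` has gradient above `α`
(`low_add_negHigh_lt_iff`). Every vertex of such a walk passes this test (`high_of_steep`), so the
walk survives whole in `G'`. Hence `G'` is again well-posed, it contains every path better than the
current one, and its paths are paths of `G`. If `G'` has no edge, nothing better exists. The drawn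
vertex never survives, so for every outcome the recursion is no deeper than the number of vertices.

Expected cost. A surviving vertex is strictly steeper than the drawn vertex, and a surviving edge
has a larger maximal steepness at its ends than the drawn edge. Both relations are asymmetric, so on
average at most half of the vertices and at most half of the edges are related to the drawn one
(`two_mul_sum_countP_le`, `mean_countP_le`). With `L = log₂ N + 1` fixed by the original number `N`
of vertices, the size `m + n L` therefore at least halves in expectation. A round costs at most a
constant times this size, so twice the bound for one round bounds the total: half of it pays for the
round, the other half for the recursive call. The same argument on the terminals of a star makes
`starSteepestPath` linear in expectation.

Cost of a round. This rests on the amortised analysis of the Fibonacci heap. Ranks are logarithmic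
because a child loses at most one child of its own before it is cut (`Forest.fib_rank_le`). The
potential charges 26 to a root, 34 to a mark and 5 to an entry of a child list, obsolete or not.
Then insertion and key decrease have constant amortised cost and removing the minimum has
logarithmic cost, which gives a bound of order `m + n L` for `modDijkstra`. -/

namespace LexLearn

/-! ### Values and costs of deterministic programs -/

section TimedCalculus

variable {α β σ ι : Type}

@[simp] theorem Timed.bind_val (t : Timed α) (f : α → Timed β) :
    (t >>= f).val = (f t.val).val := rfl

@[simp] theorem Timed.bind_cost (t : Timed α) (f : α → Timed β) :
    (t >>= f).cost = t.cost + (f t.val).cost := rfl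

@[simp] theorem Timed.pure_val (a : α) : (pure a : Timed α).val = a := rfl

@[simp] theorem Timed.pure_cost (a : α) : (pure a : Timed α).cost = 0 := rfl

theorem Timed.eq_of {t t' : Timed α} (hv : t.val = t'.val) (hc : t.cost = t'.cost) : t = t' := by
  cases t; cases t'; cases hv; cases hc; rfl

@[simp] theorem op_val (a : α) : (op a).val = a := rfl

@[simp] theorem op_cost (a : α) : (op a).cost = 1 := rfl

@[simp] theorem rd_val (A : ι → α) (i : ι) : (rd A i).val = A i := rfl

@[simp] theorem rd_cost (A : ι → α) (i : ι) : (rd A i).cost = 1 := rfl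

@[simp] theorem wr_val [DecidableEq ι] (A : ι → α) (i : ι) (a : α) :
    (wr A i a).val = Function.update A i a := rfl

@[simp] theorem wr_cost [DecidableEq ι] (A : ι → α) (i : ι) (a : α) : (wr A i a).cost = 1 := rfl

@[simp] theorem forEach_nil (body : σ → α → Timed σ) (s : σ) : forEach body s [] = pure s := rfl

theorem forEach_cons_val (body : σ → α → Timed σ) (s : σ) (a : α) (l : List α) :
    (forEach body s (a :: l)).val = (forEach body (body s a).val l).val := rfl

theorem forEach_cons_cost (body : σ → α → Timed σ) (s : σ) (a : α) (l : List α) :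
    (forEach body s (a :: l)).cost
      = 1 + ((body s a).cost + (forEach body (body s a).val l).cost) := rfl

/-- Loop rule: `P rest s k` is an invariant on the remaining list, the state and the steps taken. -/
theorem forEach_induct {body : σ → α → Timed σ} {P : List α → σ → ℕ → Prop}
    (step : ∀ a l s k, P (a :: l) s k → P l (body s a).val (k + (1 + (body s a).cost))) :
    ∀ (l : List α) (s : σ) (k : ℕ), P l s k →
      P [] (forEach body s l).val (k + (forEach body s l).cost) := by
  intro l
  induction l with
  | nil => intro s k h; simpa using h
  | cons a l ih =>
    intro s k h
    have := ih _ _ (step a l s k h)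
    rw [forEach_cons_val, forEach_cons_cost]
    convert this using 1
    ring

theorem forEach_cost_le {body : σ → α → Timed σ} {c : ℕ} (l : List α) (s : σ)
    (h : ∀ s, ∀ a ∈ l, (body s a).cost ≤ c) : (forEach body s l).cost ≤ (c + 1) * l.length := by
  induction l generalizing s with
  | nil => simp
  | cons a l ih =>
    rw [forEach_cons_cost, List.length_cons]
    have h1 := h s a (by simp)
    have h2 := ih (body s a).val (fun s b hb => h s b (by simp [hb]))
    nlinarith

theorem filterT_val (test : α → Timed Bool) (l : List α) :
    (filterT test l).val = l.filter fun a => (test a).val := by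
  induction l with
  | nil => rfl
  | cons a l ih =>
    simp only [filterT, Timed.bind_val, List.filter_cons, ← ih]
    split <;> simp

theorem filterT_cost_le {test : α → Timed Bool} {c : ℕ} (l : List α)
    (h : ∀ a ∈ l, (test a).cost ≤ c) : (filterT test l).cost ≤ (c + 1) * l.length := by
  induction l with
  | nil => simp [filterT]
  | cons a l ih =>
    have h1 := h a (by simp)
    have h2 := ih (fun b hb => h b (by simp [hb]))
    have h3 : (filterT test (a :: l)).cost = (test a).cost + ((filterT test l).cost + 1) := by
      simp only [filterT, Timed.bind_cost]
      split <;> simp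
    rw [h3, List.length_cons]
    nlinarith

/-- What `argBest` returns, for a comparison that decides the strict part of a preorder `le`. -/
theorem argBest_val {better : ℝ → ℝ → Bool} {le : ℝ → ℝ → Prop} (score : α → Timed ℝ)
    (hrefl : ∀ a, le a a) (htrans : ∀ a b c, le a b → le b c → le a c)
    (ht : ∀ a b, better a b = true → le b a) (hf : ∀ a b, better a b = false → le a b)
    (l : List α) :
    (l = [] ∧ (argBest better score l).val = none) ∨
      ∃ a ∈ l, (argBest better score l).val = some (a, (score a).val) ∧
        ∀ b ∈ l, le (score b).val (score a).val := by
  have key := forEach_induct (body := fun (best : Option (α × ℝ)) a => do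
      let s ← score a
      match best with
      | none => op (some (a, s))
      | some (a', s') => do
        let b ← op (better s s')
        if b then op (some (a, s)) else op (some (a', s')))
    (P := fun rest s _ => ∃ front, l = front ++ rest ∧ ((front = [] ∧ s = none) ∨
      ∃ a ∈ front, s = some (a, (score a).val) ∧ ∀ b ∈ front, le (score b).val (score a).val))
    (by
      rintro a rest s k ⟨front, hl, h⟩
      refine ⟨front ++ [a], by simp [hl], Or.inr ?_⟩
      rcases h with ⟨rfl, rfl⟩ | ⟨a', ha', rfl, hb⟩
      · exact ⟨a, by simp, by simp, by simp [hrefl]⟩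
      · by_cases hc : better (score a).val (score a').val = true
        · refine ⟨a, by simp, by simp [hc], ?_⟩
          intro b hb'
          rcases List.mem_append.1 hb' with h1 | h1
          · exact htrans _ _ _ (hb b h1) (ht _ _ hc)
          · rw [List.mem_singleton.1 h1]; exact hrefl _
        · refine ⟨a', by simp [ha'], by simp [hc], ?_⟩
          intro b hb'
          rcases List.mem_append.1 hb' with h1 | h1
          · exact hb b h1
          · rw [List.mem_singleton.1 h1]; exact hf _ _ (by simpa using hc))
    l none 0 ⟨[], rfl, Or.inl ⟨rfl, rfl⟩⟩
  obtain ⟨front, hl, h⟩ := key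
  rw [List.append_nil] at hl
  subst hl
  exact h

theorem argBest_larger (score : α → Timed ℝ) (l : List α) :
    (l = [] ∧ (argBest larger score l).val = none) ∨
      ∃ a ∈ l, (argBest larger score l).val = some (a, (score a).val) ∧
        ∀ b ∈ l, (score b).val ≤ (score a).val :=
  argBest_val score (fun _ => le_rfl) (fun _ _ _ => le_trans)
    (fun a b h => by simp only [larger, decide_eq_true_eq] at h; exact h.le)
    (fun a b h => by simp only [larger, decide_eq_false_iff_not, not_lt] at h; exact h) l

theorem argBest_smaller (score : α → Timed ℝ) (l : List α) :
    (l = [] ∧ (argBest smaller score l).val = none) ∨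
      ∃ a ∈ l, (argBest smaller score l).val = some (a, (score a).val) ∧
        ∀ b ∈ l, (score a).val ≤ (score b).val :=
  argBest_val (le := fun a b => b ≤ a) score (fun _ => le_rfl) (fun _ _ _ h h' => le_trans h' h)
    (fun a b h => by simp only [smaller, decide_eq_true_eq] at h; exact h.le)
    (fun a b h => by simp only [smaller, decide_eq_false_iff_not, not_lt] at h; exact h) l

theorem argBest_cost_le (better : ℝ → ℝ → Bool) {score : α → Timed ℝ} {c : ℕ} (l : List α)
    (h : ∀ a ∈ l, (score a).cost ≤ c) : (argBest better score l).cost ≤ (c + 3) * l.length := by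
  refine forEach_cost_le (c := c + 2) l none ?_
  intro s a ha
  have := h a ha
  rcases s with _ | ⟨a', s'⟩
  · simp; omega
  · simp only [Timed.bind_cost, op_cost, op_val]
    cases better (score a).val s' <;> simp <;> omega

theorem pushAll_val (acc l : List α) : (pushAll acc l).val = l.reverse ++ acc := by
  induction l generalizing acc with
  | nil => rfl
  | cons a l ih =>
    rw [pushAll, forEach_cons_val]
    refine (ih _).trans ?_
    simp

theorem pushAll_cost_le (acc l : List α) : (pushAll acc l).cost ≤ 2 * l.length :=
  forEach_cost_le (c := 1) l acc (fun _ _ _ => le_rfl)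

end TimedCalculus

/-! ### Expected cost and possible results of randomised programs -/

section RandCalculus

variable {α β : Type}

/-- The expectation of `F` under `μ`. -/
noncomputable def expect {γ : Type} (μ : PMF γ) (F : γ → ENNReal) : ENNReal := ∑' p, μ p * F p

theorem expect_pure {γ : Type} (a : γ) (F : γ → ENNReal) : expect (PMF.pure a) F = F a := by
  rw [expect, tsum_eq_single a]
  · simp
  · intro b hb; simp [PMF.pure_apply, hb]

theorem expect_bind {γ δ : Type} (μ : PMF γ) (f : γ → PMF δ) (F : δ → ENNReal) :
    expect (μ.bind f) F = expect μ fun p => expect (f p) F := by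
  simp only [expect, PMF.bind_apply, ← ENNReal.tsum_mul_right, ← ENNReal.tsum_mul_left]
  rw [ENNReal.tsum_comm]
  simp only [mul_assoc]

theorem expect_map {γ δ : Type} (μ : PMF γ) (f : γ → δ) (F : δ → ENNReal) :
    expect (μ.map f) F = expect μ fun p => F (f p) := by
  rw [PMF.map, expect_bind]
  simp [expect_pure]

theorem expect_add {γ : Type} (μ : PMF γ) (F F' : γ → ENNReal) :
    (expect μ fun p => F p + F' p) = expect μ F + expect μ F' := by
  simp only [expect, mul_add, ENNReal.tsum_add]

theorem expect_const {γ : Type} (μ : PMF γ) (c : ENNReal) : (expect μ fun _ => c) = c := by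
  simp [expect, ENNReal.tsum_mul_right, PMF.tsum_coe]

theorem expect_mono {γ : Type} (μ : PMF γ) {F F' : γ → ENNReal}
    (h : ∀ p ∈ μ.support, F p ≤ F' p) : expect μ F ≤ expect μ F' := by
  refine ENNReal.tsum_le_tsum fun p => ?_
  by_cases hp : μ p = 0
  · simp [hp]
  · gcongr
    exact h p ((PMF.mem_support_iff _ _).2 hp)

theorem expect_uniform {n : ℕ} (F : Fin (n + 1) → ENNReal) :
    expect (PMF.uniformOfFintype (Fin (n + 1))) F = (∑ i, F i) / (n + 1 : ℕ) := by
  simp only [expect, PMF.uniformOfFintype_apply, Fintype.card_fin, tsum_fintype, ← Finset.mul_sum]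
  rw [mul_comm, ENNReal.div_eq_inv_mul, mul_comm]

/-- The expectation of the number of steps plus a function of the result. -/
noncomputable def Rand.wp (μ : Rand α) (φ : α → ENNReal) : ENNReal :=
  expect (γ := α × ℕ) μ fun p => (p.2 : ENNReal) + φ p.1

/-- All possible results satisfy `P`. -/
def Rand.Always (μ : Rand α) (P : α → Prop) : Prop := ∀ a, μ.CanReturn a → P a

theorem Rand.expectedCost_eq_wp (μ : Rand α) : μ.expectedCost = μ.wp fun _ => 0 := by
  simp [Rand.expectedCost, Rand.wp, expect]

theorem Rand.wp_pure (a : α) (φ : α → ENNReal) : (pure a : Rand α).wp φ = φ a := by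
  refine (expect_pure _ _).trans ?_
  simp

theorem Rand.wp_det (t : Timed α) (φ : α → ENNReal) : (det t).wp φ = t.cost + φ t.val :=
  expect_pure _ _

/-- The steps already taken are a constant for the continuation, and the expectation of a constant
under a probability measure is that constant. -/
theorem Rand.wp_bind (μ : Rand α) (f : α → Rand β) (φ : β → ENNReal) :
    (μ >>= f).wp φ = μ.wp fun a => (f a).wp φ := by
  refine (expect_bind (γ := α × ℕ) (δ := β × ℕ) μ _ _).trans ?_
  refine congrArg (expect (γ := α × ℕ) μ) (funext fun p => ?_)
  refine (expect_map (γ := β × ℕ) (f p.1) _ _).trans ?_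
  simp only [Nat.cast_add, add_assoc]
  exact (expect_add (γ := β × ℕ) (f p.1) _ _).trans
    (congrArg₂ (· + ·) (expect_const (γ := β × ℕ) (f p.1) _) rfl)

theorem Rand.wp_mono (μ : Rand α) {φ ψ : α → ENNReal} (h : μ.Always fun a => φ a ≤ ψ a) :
    μ.wp φ ≤ μ.wp ψ :=
  expect_mono (γ := α × ℕ) μ fun p hp => by
    gcongr
    exact h p.1 ⟨p.2, hp⟩

theorem Rand.wp_const (μ : Rand α) (c : ENNReal) : (μ.wp fun _ => c) = μ.expectedCost + c := by
  rw [Rand.expectedCost_eq_wp]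
  refine (expect_add (γ := α × ℕ) μ _ _).trans ?_
  refine congrArg₂ (· + ·) ?_ (expect_const (γ := α × ℕ) μ c)
  simp [Rand.wp]

/-- The rule for sequencing: the continuation has to be bounded only on results that satisfy an
invariant, so correctness facts can be used inside cost estimates. -/
theorem Rand.wp_le {μ : Rand α} {P : α → Prop} {φ : α → ENNReal} {K B : ENNReal}
    (hP : μ.Always P) (hK : μ.expectedCost ≤ K) (h : ∀ a, P a → φ a ≤ B) : μ.wp φ ≤ K + B :=
  (μ.wp_mono (ψ := fun _ => B) fun a ha => h a (hP a ha)).trans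
    ((μ.wp_const B).le.trans (by gcongr))

theorem Rand.wp_pick_cons (a : α) (l : List α) (φ : Option α → ENNReal) :
    (pick (a :: l)).wp φ
      = 1 + ((a :: l).map fun b => φ (some b)).sum / ((a :: l).length : ℕ) := by
  refine (expect_map _ _ _).trans ?_
  refine (expect_add _ (fun _ => ((1 : ℕ) : ENNReal)) _).trans ?_
  rw [expect_const, Nat.cast_one]
  refine congrArg (1 + ·) ((expect_uniform _).trans ?_)
  congr 1
  rw [← List.sum_ofFn]
  congr 1
  conv_rhs => rw [← List.ofFn_get (a :: l)]
  rw [List.map_ofFn]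
  rfl

theorem Rand.wp_pick {l : List α} (hl : l ≠ []) (φ : Option α → ENNReal) :
    (pick l).wp φ = 1 + (l.map fun b => φ (some b)).sum / (l.length : ℕ) := by
  cases l with
  | nil => exact absurd rfl hl
  | cons a l => exact Rand.wp_pick_cons a l φ

theorem Rand.always_pure {a : α} {P : α → Prop} (h : P a) : (pure a : Rand α).Always P := by
  rintro b ⟨k, hk⟩
  have := (PMF.mem_support_pure_iff _ _).1 hk
  cases this
  exact h

theorem Rand.always_det {t : Timed α} {P : α → Prop} (h : P t.val) : (det t).Always P := by
  rintro b ⟨k, hk⟩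
  have := (PMF.mem_support_pure_iff _ _).1 hk
  cases this
  exact h

theorem Rand.always_bind {μ : Rand α} {f : α → Rand β} {P : β → Prop}
    (h : μ.Always fun a => (f a).Always P) : (μ >>= f).Always P := by
  rintro b ⟨k, hk⟩
  obtain ⟨p, hp, hb⟩ := (PMF.mem_support_bind_iff (α := α × ℕ) (β := β × ℕ) _ _ _).1 hk
  obtain ⟨q, hq, hqb⟩ := (PMF.mem_support_map_iff _ _ _).1 hb
  cases hqb
  exact h p.1 ⟨p.2, hp⟩ q.1 ⟨q.2, hq⟩

theorem Rand.Always.mono {μ : Rand α} {P Q : α → Prop} (h : μ.Always P) (hPQ : ∀ a, P a → Q a) :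
    μ.Always Q := fun a ha => hPQ a (h a ha)

theorem Rand.always_pick {l : List α} (hl : l ≠ []) :
    (pick l).Always fun o => ∃ a ∈ l, o = some a := by
  cases l with
  | nil => exact absurd rfl hl
  | cons a l =>
    rintro b ⟨k, hk⟩
    obtain ⟨q, -, hqb⟩ := (PMF.mem_support_map_iff _ _ _).1 hk
    cases hqb
    exact ⟨_, List.get_mem _ _, rfl⟩

theorem sum_countP_cons (R : α → α → Bool) (x : α) (l l' : List α) :
    (l'.map fun a => (x :: l).countP (R a)).sum
      = (l'.map fun a => l.countP (R a)).sum + l'.countP fun a => R a x := by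
  induction l' with
  | nil => simp
  | cons y l' ih =>
    rw [List.map_cons, List.sum_cons, ih, List.map_cons, List.sum_cons, List.countP_cons,
      List.countP_cons]
    ring

/-- If `R` is an asymmetric relation then, for a random element of a list, the expected number of
elements related to it is at most half of the length. -/
theorem two_mul_sum_countP_le (R : α → α → Bool) (hR : ∀ a b, R a b = true → R b a = false)
    (l : List α) : 2 * (l.map fun a => l.countP (R a)).sum ≤ l.length ^ 2 := by
  induction l with
  | nil => simp
  | cons x l ih =>
    have hx : R x x = false := by
      by_contra h
      have h1 : R x x = true := by simpa using h
      rw [hR _ _ h1] at h1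
      cases h1
    have h1 := sum_countP_cons R x l l
    -- By asymmetry each `y` in `l` is counted on at most one side of `x`. The new element thus adds
    -- at most `l.length` to the sum, and twice this is less than the growth of the square.
    have h2 : l.countP (R x) + l.countP (fun a => R a x) ≤ l.length := by
      clear ih h1
      induction l with
      | nil => simp
      | cons y l ih' =>
        simp only [List.countP_cons, List.length_cons]
        have := hR x y
        cases h3 : R x y <;> cases h4 : R y x <;> simp_all <;> omega
    rw [List.map_cons, List.sum_cons, h1, List.countP_cons, hx, List.length_cons]
    simp only [Bool.false_eq_true, if_false]
    nlinarith

end RandCalculus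

/-! ### Amortised analysis of the Fibonacci heap -/

namespace FibHeap

variable {V : Type} [DecidableEq V]

/-- The children of `x` among `S`. -/
def children (h : FibHeap V) (S : Finset V) (x : V) : Finset V := S.filter fun c => h.up c = some x

/-- The shape of a forest on `S`.  The number `g c` is the rank that `c` and its parent had when
they were linked; `e` is the number of lost children that the mark of a vertex does not record. -/
structure Forest (h : FibHeap V) (S : Finset V) (e : V → ℕ) : Prop where
  up_mem : ∀ c p, h.up c = some p → c ∈ S ∧ p ∈ S
  kids_mem : ∀ c p, h.up c = some p → c ∈ h.kids p
  rank_eq : ∀ x ∈ S, h.rank x = (h.children S x).card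
  acyclic : ∃ ht : V → ℕ, ∀ c p, h.up c = some p → ht c < ht p
  degree : ∃ g : V → ℕ, (∀ c p, h.up c = some p → g c ≤ h.rank c + (h.mark c).toNat + e c) ∧
    ∀ p j, ((h.children S p).filter fun c => g c < j).card ≤ j

/-- The keys increase from a parent to its children. -/
def Ordered (h : FibHeap V) : Prop := ∀ c p, h.up c = some p → h.key p ≤ h.key c

/-- The roots in `S`. -/
def rootSet (h : FibHeap V) (S : Finset V) : Finset V := S.filter fun x => h.up x = none

/-- The marked vertices in `S`. -/
def markSet (h : FibHeap V) (S : Finset V) : Finset V := S.filter fun x => h.mark x = true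

/-- The potential with weight `a` for the roots. -/
def pot (a : ℕ) (h : FibHeap V) (S : Finset V) : ℕ :=
  a * (h.rootSet S).card + 34 * (h.markSet S).card + 5 * ∑ x ∈ S, (h.kids x).length

/-- The hypothesis says that the `i`-th smallest value of `d`, counted from `0`, is at least `i`.
Not all of `n + 1` elements can have `d < n`, so one with `d ≥ n` can be split off and matched with
the last term. -/
theorem sum_range_le_sum_of_card_filter_lt_le {f : ℕ → ℕ} (hf : Monotone f) (d : V → ℕ) :
    ∀ (n : ℕ) (s : Finset V), s.card = n → (∀ j, (s.filter fun c => d c < j).card ≤ j) →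
      ∑ i ∈ Finset.range n, f i ≤ ∑ c ∈ s, f (d c) := by
  intro n
  induction n with
  | zero => simp
  | succ n ih =>
    intro s hs hd
    obtain ⟨c, hc, hcn⟩ : ∃ c ∈ s, n ≤ d c := by
      by_contra! h
      have h1 := hd n
      rw [Finset.filter_true_of_mem h, hs] at h1
      omega
    rw [Finset.sum_range_succ, ← Finset.sum_erase_add s _ hc]
    refine add_le_add (ih _ (by rw [Finset.card_erase_of_mem hc, hs]; rfl) fun j => ?_) (hf hcn)
    exact (Finset.card_le_card (Finset.filter_subset_filter _ (Finset.erase_subset _ _))).trans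
      (hd j)

theorem fib_eq_one_add_sum (r : ℕ) :
    Nat.fib (r + 2) = 1 + ∑ i ∈ Finset.range r, Nat.fib (i + 1) := by
  rw [Nat.fib_succ_eq_succ_sum, Finset.sum_range_succ', Nat.fib_zero]
  ring

/-- Every element is either a root or a child of exactly one parent. -/
theorem sum_children (h : FibHeap V) {S : Finset V} (hS : ∀ c p, h.up c = some p → p ∈ S)
    (f : V → ℕ) :
    ∑ x ∈ S, ∑ c ∈ h.children S x, f c + ∑ c ∈ h.rootSet S, f c = ∑ c ∈ S, f c := by
  simp only [children, rootSet, Finset.sum_filter]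
  rw [Finset.sum_comm, ← Finset.sum_add_distrib]
  refine Finset.sum_congr rfl fun c _ => ?_
  rcases hc : h.up c with _ | p
  · simp
  · simp [hS c p hc]

/-- Trees of large rank are large. -/
theorem Forest.fib_rank_le {h : FibHeap V} {S : Finset V} (hF : Forest h S fun _ => 0) {x : V}
    (hx : x ∈ S) (hr : h.up x = none) : Nat.fib (h.rank x + 2) ≤ S.card := by
  obtain ⟨g, hg, hc⟩ := hF.degree
  have h1 : ∀ y ∈ S, Nat.fib (h.rank y + 2)
      ≤ 1 + ∑ c ∈ h.children S y, Nat.fib (h.rank c + 2) := by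
    intro y hy
    rw [fib_eq_one_add_sum]
    gcongr
    refine (sum_range_le_sum_of_card_filter_lt_le (f := fun i => Nat.fib (i + 1))
      (fun a b hab => Nat.fib_mono (by omega)) g _ _ (hF.rank_eq y hy).symm (hc y)).trans ?_
    refine Finset.sum_le_sum fun c hcy => Nat.fib_mono ?_
    -- The mark counts at most one lost child, so `g c ≤ rank c + 1`; this costs one index in the
    -- Fibonacci numbers.
    have h2 := hg c y (Finset.mem_filter.1 hcy).2
    have h3 := Bool.toNat_le (h.mark c)
    omega
  -- The inequality is summed over all elements instead of along a single tree. The terms of all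
  -- non-roots cancel, and the Fibonacci numbers of the roots add up to at most `S.card`.
  have h2 := Finset.sum_le_sum h1
  rw [Finset.sum_add_distrib, Finset.sum_const, smul_eq_mul, mul_one] at h2
  have h3 := sum_children h (fun c p hcp => (hF.up_mem c p hcp).2) fun c => Nat.fib (h.rank c + 2)
  have h4 := Finset.single_le_sum (f := fun c => Nat.fib (h.rank c + 2)) (s := h.rootSet S)
    (fun _ _ => Nat.zero_le _) (Finset.mem_filter.2 ⟨hx, hr⟩)
  omega

/-- A bound for the ranks of the roots of a heap with `n` elements. -/
def rankBound (n : ℕ) : ℕ := 2 * Nat.log 2 n + 1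

theorem rankBound_mono {m n : ℕ} (h : m ≤ n) : rankBound m ≤ rankBound n := by
  have := Nat.log_mono_right (b := 2) h
  unfold rankBound
  omega

theorem two_pow_le_fib (k : ℕ) : 2 ^ k ≤ Nat.fib (2 * k + 2) := by
  induction k with
  | zero => simp
  | succ k ih =>
    have h1 := Nat.fib_add_two (n := 2 * k + 2)
    have h2 := Nat.fib_mono (show 2 * k + 2 ≤ 2 * k + 2 + 1 by omega)
    rw [pow_succ, show 2 * (k + 1) + 2 = 2 * k + 2 + 2 by ring, h1]
    omega

/-- With `k = ⌊rank / 2⌋`, `2 ^ k ≤ fib (2 k + 2) ≤ S.card`; the `+ 1` in `rankBound` makes up for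
the rounding of `rank / 2`. -/
theorem Forest.rank_le {h : FibHeap V} {S : Finset V} (hF : Forest h S fun _ => 0) {x : V}
    (hx : x ∈ S) (hr : h.up x = none) : h.rank x ≤ rankBound S.card := by
  have h1 := two_pow_le_fib (h.rank x / 2)
  have h2 := Nat.fib_mono (show 2 * (h.rank x / 2) + 2 ≤ h.rank x + 2 by omega)
  have h3 := hF.fib_rank_le hx hr
  have h4 := Nat.le_log_of_pow_le (b := 2) (by norm_num) (h1.trans (h2.trans h3))
  unfold rankBound
  omega

/-- A crude bound, needed only to show that the round counter of `place` does not run out. -/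
theorem Forest.rank_lt {h : FibHeap V} {S : Finset V} (hF : Forest h S fun _ => 0) {x : V}
    (hx : x ∈ S) (hr : h.up x = none) : h.rank x < S.card := by
  refine lt_of_lt_of_le ?_ (hF.fib_rank_le hx hr)
  generalize h.rank x = r
  induction r with
  | zero => simp
  | succ r ih =>
    have h1 := Nat.fib_add_two (n := r + 1)
    have h2 := Nat.fib_pos.2 (show 0 < r + 1 by omega)
    rw [show r + 1 + 1 = r + 2 by ring] at h1
    omega

/-- Climbing to the parent never increases the key, and acyclicity ends the climb. Hence a least
root is a least element. -/
theorem Forest.exists_root_le {h : FibHeap V} {S : Finset V} {e : V → ℕ} (hF : Forest h S e)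
    (hO : Ordered h) {x : V} (hx : x ∈ S) : ∃ r ∈ S, h.up r = none ∧ h.key r ≤ h.key x := by
  obtain ⟨ht, hht⟩ := hF.acyclic
  have key : ∀ k, ∀ x ∈ S, S.sup ht ≤ ht x + k → ∃ r ∈ S, h.up r = none ∧ h.key r ≤ h.key x := by
    intro k
    induction k with
    | zero =>
      intro x hx hk
      refine ⟨x, hx, ?_, le_rfl⟩
      rcases hu : h.up x with _ | p
      · rfl
      · have h1 := hht x p hu
        have h2 := Finset.le_sup (f := ht) (hF.up_mem x p hu).2
        omega
    | succ k ih =>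
      intro x hx hk
      rcases hu : h.up x with _ | p
      · exact ⟨x, hx, hu, le_rfl⟩
      · have h1 := hht x p hu
        obtain ⟨r, hr, hr', hrk⟩ := ih p (hF.up_mem x p hu).2 (by omega)
        exact ⟨r, hr, hr', hrk.trans (hO x p hu)⟩
  exact key (S.sup ht) x hx (by omega)

theorem Forest.ne {h : FibHeap V} {S : Finset V} {e : V → ℕ} (hF : Forest h S e) {x p : V}
    (hx : h.up x = some p) : x ≠ p := by
  rintro rfl
  obtain ⟨ht, hht⟩ := hF.acyclic
  exact lt_irrefl _ (hht x x hx)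

/-- The shape depends neither on the keys nor on the root list nor on the bins. -/
theorem Forest.congr {h h' : FibHeap V} {S : Finset V} {e : V → ℕ} (hF : Forest h S e)
    (hu : h'.up = h.up) (hk : h'.kids = h.kids) (hr : h'.rank = h.rank) (hm : h'.mark = h.mark) :
    Forest h' S e where
  up_mem := by rw [hu]; exact hF.up_mem
  kids_mem := by rw [hu, hk]; exact hF.kids_mem
  rank_eq := by unfold children; rw [hu, hr]; exact hF.rank_eq
  acyclic := by rw [hu]; exact hF.acyclic
  degree := by unfold children; rw [hu, hr, hm]; exact hF.degree

theorem pot_congr {h h' : FibHeap V} {S : Finset V} (a : ℕ)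
    (hu : h'.up = h.up) (hk : h'.kids = h.kids) (hm : h'.mark = h.mark) :
    pot a h' S = pot a h S := by
  unfold pot rootSet markSet; rw [hu, hk, hm]

/-! ### Cuts -/

theorem cut_cost (h : FibHeap V) (x p : V) : (cut h x p).cost = 6 := rfl

theorem cut_up (h : FibHeap V) (x p : V) :
    (cut h x p).val.up = Function.update h.up x none := rfl

theorem cut_mark (h : FibHeap V) (x p : V) :
    (cut h x p).val.mark = Function.update h.mark x false := rfl

theorem cut_rank (h : FibHeap V) (x p : V) :
    (cut h x p).val.rank = Function.update h.rank p (h.rank p - 1) := rfl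

theorem cut_roots (h : FibHeap V) (x p : V) : (cut h x p).val.roots = x :: h.roots := rfl

theorem cut_up_eq_some {h : FibHeap V} {x p c q : V} :
    (cut h x p).val.up c = some q ↔ c ≠ x ∧ h.up c = some q := by
  rw [cut_up, Function.update_apply]
  by_cases hc : c = x <;> simp [hc]

theorem cut_children (h : FibHeap V) (S : Finset V) (x p q : V) :
    (cut h x p).val.children S q = (h.children S q).erase x := by
  ext c
  simp only [children, Finset.mem_filter, Finset.mem_erase, cut_up_eq_some]
  tauto

/-- Only `p` loses rank, and the unit added to `e' p` compensates for it in the degree condition.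
Clearing the mark of `x` is harmless, because that condition concerns only vertices with a parent.
-/
theorem Forest.cut {h : FibHeap V} {S : Finset V} {e e' : V → ℕ} (hF : Forest h S e) {x p : V}
    (hx : h.up x = some p) (he : ∀ c, c ≠ x → e c ≤ e' c) (hp : e p + 1 ≤ e' p) :
    Forest (FibHeap.cut h x p).val S e' where
  up_mem c q hc := hF.up_mem c q (cut_up_eq_some.1 hc).2
  kids_mem c q hc := hF.kids_mem c q (cut_up_eq_some.1 hc).2
  rank_eq y hy := by
    rw [cut_children, cut_rank, Function.update_apply]
    split_ifs with hyp
    · subst hyp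
      rw [Finset.card_erase_of_mem (show x ∈ h.children S y from
          Finset.mem_filter.2 ⟨(hF.up_mem _ _ hx).1, hx⟩),
        hF.rank_eq _ hy]
    · rw [Finset.erase_eq_of_notMem, hF.rank_eq y hy]
      intro hm
      have := (Finset.mem_filter.1 hm).2
      rw [hx] at this
      exact hyp (Option.some.inj this).symm
  acyclic := by
    obtain ⟨ht, hht⟩ := hF.acyclic
    exact ⟨ht, fun c q hc => hht c q (cut_up_eq_some.1 hc).2⟩
  degree := by
    obtain ⟨g, hg, hc⟩ := hF.degree
    refine ⟨g, fun c q hcq => ?_, fun q j => ?_⟩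
    · obtain ⟨hcx, hcu⟩ := cut_up_eq_some.1 hcq
      have h1 := hg c q hcu
      have h2 := he c hcx
      rw [cut_rank, cut_mark, Function.update_of_ne hcx, Function.update_apply]
      split_ifs with hcp
      · subst hcp
        omega
      · omega
    · rw [cut_children]
      exact (Finset.card_le_card (Finset.filter_subset_filter _ (Finset.erase_subset _ _))).trans
        (hc q j)

theorem cut_rootSet (h : FibHeap V) {S : Finset V} {x p : V} (hx : x ∈ S) :
    (cut h x p).val.rootSet S = Insert.insert x (h.rootSet S) := by
  ext c
  simp only [rootSet, cut_up, Finset.mem_filter, Finset.mem_insert, Function.update_apply]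
  by_cases hc : c = x <;> simp [hc, hx]

theorem cut_markSet (h : FibHeap V) (S : Finset V) (x p : V) :
    (cut h x p).val.markSet S = (h.markSet S).erase x := by
  ext c
  simp only [markSet, cut_mark, Finset.mem_filter, Finset.mem_erase, Function.update_apply]
  by_cases hc : c = x <;> simp [hc]

theorem cut_pot_le (a : ℕ) (h : FibHeap V) {S : Finset V} {x p : V} (hx : x ∈ S) :
    pot a (cut h x p).val S ≤ pot a h S + a := by
  have h1 := Finset.card_insert_le x (h.rootSet S)
  have h2 := Finset.card_le_card (Finset.erase_subset x (h.markSet S))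
  have h3 : (cut h x p).val.kids = h.kids := rfl
  unfold pot
  rw [cut_rootSet h hx, cut_markSet, h3]
  nlinarith

theorem cut_pot_le_of_mark (a : ℕ) (h : FibHeap V) {S : Finset V} {x p : V} (hx : x ∈ S)
    (hm : h.mark x = true) : pot a (cut h x p).val S + 34 ≤ pot a h S + a := by
  have h1 := Finset.card_insert_le x (h.rootSet S)
  have h2 := Finset.card_erase_add_one (show x ∈ h.markSet S from Finset.mem_filter.2 ⟨hx, hm⟩)
  have h3 : (cut h x p).val.kids = h.kids := rfl
  unfold pot
  rw [cut_rootSet h hx, cut_markSet, h3]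
  nlinarith

/-- The root list consists of the roots. -/
def RootsOk (h : FibHeap V) (S : Finset V) : Prop :=
  h.roots.Nodup ∧ ∀ x, x ∈ h.roots ↔ x ∈ S ∧ h.up x = none

theorem RootsOk.length_eq {h : FibHeap V} {S : Finset V} (hR : RootsOk h S) :
    h.roots.length = (h.rootSet S).card := by
  rw [← List.toFinset_card_of_nodup hR.1]
  congr 1
  ext x
  simp [rootSet, hR.2]

theorem RootsOk.cut {h : FibHeap V} {S : Finset V} (hR : RootsOk h S) {x p : V} (hx : x ∈ S)
    (hu : h.up x = some p) : RootsOk (cut h x p).val S := by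
  refine ⟨?_, fun y => ?_⟩
  · rw [cut_roots, List.nodup_cons, hR.2]
    exact ⟨by simp [hu], hR.1⟩
  · rw [cut_roots, List.mem_cons, hR.2, cut_up, Function.update_apply]
    by_cases hy : y = x <;> simp [hy, hx]

/-- `h'` arises from `h` by cuts. -/
structure CutFrom (h h' : FibHeap V) : Prop where
  key : h'.key = h.key
  slot : h'.slot = h.slot
  top : h'.top = h.top
  cap : h'.cap = h.cap
  up : ∀ c p, h'.up c = some p → h.up c = some p

theorem CutFrom.cut (h : FibHeap V) (x p : V) : CutFrom h (cut h x p).val where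
  key := rfl
  slot := rfl
  top := rfl
  cap := rfl
  up c q hc := (cut_up_eq_some.1 hc).2

theorem CutFrom.trans {h h' h'' : FibHeap V} (H : CutFrom h h') (H' : CutFrom h' h'') :
    CutFrom h h'' where
  key := H'.key.trans H.key
  slot := H'.slot.trans H.slot
  top := H'.top.trans H.top
  cap := H'.cap.trans H.cap
  up c q hc := H.up c q (H'.up c q hc)

theorem CutFrom.up_none {h h' : FibHeap V} (H : CutFrom h h') {c : V} (hc : h.up c = none) :
    h'.up c = none := by
  rcases hu : h'.up c with _ | p
  · rfl
  · rw [H.up c p hu] at hc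
    cases hc

theorem CutFrom.ordered {h h' : FibHeap V} (H : CutFrom h h') (hO : Ordered h) : Ordered h' := by
  intro c p hc
  rw [H.key]
  exact hO c p (H.up c p hc)

/-- Each further cut takes 8 steps and creates a root of weight 26, and the erased mark of weight 34
pays for both. The last round takes at most 3 steps and sets at most one mark: `3 + 34 = 37`. Since
every round that continues erases a mark, the number of marks bounds the number of rounds. -/
theorem cascade_spec {S : Finset V} : ∀ (n : ℕ) (h : FibHeap V) (y : V),
    Forest h S (fun c => if c = y then 1 else 0) → RootsOk h S → y ∈ S →
    (h.markSet S).card < n →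
    Forest (cascade n h y).val S (fun _ => 0) ∧ RootsOk (cascade n h y).val S ∧
      CutFrom h (cascade n h y).val ∧
      (cascade n h y).cost + pot 26 (cascade n h y).val S ≤ pot 26 h S + 37 := by
  intro n
  induction n with
  | zero => intro h y _ _ _ hn; omega
  | succ n ih =>
    intro h y hF hR hy hn
    rcases hu : h.up y with _ | p
    · have e : cascade (n + 1) h y = ⟨h, 1⟩ := by
        apply Timed.eq_of <;> simp [cascade, hu]
      rw [e]
      refine ⟨{ hF with degree := ?_ }, hR, ⟨rfl, rfl, rfl, rfl, fun _ _ => id⟩, by simp; omega⟩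
      -- A root is nobody's child, so the unrecorded loss at `y` does not enter the degree
      -- condition.
      obtain ⟨g, hg, hc⟩ := hF.degree
      refine ⟨g, fun c q hcq => ?_, hc⟩
      have h1 := hg c q hcq
      have h2 : c ≠ y := by rintro rfl; rw [hu] at hcq; cases hcq
      simpa [h2] using h1
    · have hp : p ∈ S := (hF.up_mem y p hu).2
      rcases hm : h.mark y with _ | _
      · have e : cascade (n + 1) h y
            = ⟨{ h with mark := Function.update h.mark y true }, 3⟩ := by
          apply Timed.eq_of <;> simp [cascade, hu, hm]
        rw [e]
        refine ⟨⟨hF.up_mem, hF.kids_mem, hF.rank_eq, hF.acyclic, ?_⟩, hR,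
          ⟨rfl, rfl, rfl, rfl, fun _ _ => id⟩, ?_⟩
        · obtain ⟨g, hg, hc⟩ := hF.degree
          refine ⟨g, fun c q hcq => ?_, hc⟩
          have h1 := hg c q hcq
          simp only [Function.update_apply]
          by_cases hcy : c = y
          · subst hcy
            simpa [hm] using h1
          · simpa [hcy] using h1
        · have h1 : (markSet { h with mark := Function.update h.mark y true } S)
              ⊆ Insert.insert y (h.markSet S) := by
            intro c
            simp only [markSet, Finset.mem_filter, Finset.mem_insert, Function.update_apply]
            by_cases hcy : c = y <;> simp [hcy]
          have h2 := (Finset.card_le_card h1).trans (Finset.card_insert_le _ _)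
          have h3 : rootSet { h with mark := Function.update h.mark y true } S = h.rootSet S := rfl
          simp only [pot, h3]
          omega
      · have e : cascade (n + 1) h y
            = ⟨(cascade n (cut h y p).val p).val, 8 + (cascade n (cut h y p).val p).cost⟩ := by
          apply Timed.eq_of <;> simp [cascade, hu, hm, cut_cost]
          omega
        rw [e]
        have hyp := hF.ne hu
        have h1 := cut_pot_le_of_mark 26 (p := p) h hy hm
        have h2 := Finset.card_erase_add_one (show y ∈ h.markSet S from Finset.mem_filter.2 ⟨hy, hm⟩)
        obtain ⟨h3, h4, h5, h6⟩ := ih (FibHeap.cut h y p).val p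
          (hF.cut hu (fun c hc => by simp [hc]) (by simp [hyp.symm])) (hR.cut hy hu) hp
          (by rw [cut_markSet]; omega)
        exact ⟨h3, h4, (CutFrom.cut h y p).trans h5, by simp only; omega⟩

/-! ### Heaps between operations -/

/-- `top` is an element with the least key. -/
def TopOk (h : FibHeap V) (S : Finset V) : Prop :=
  (h.top = none ∧ S = ∅) ∨
    ∃ z ∈ S, h.top = some z ∧ h.up z = none ∧ ∀ x ∈ S, h.key z ≤ h.key x

/-- A heap with the set of elements `S`. -/
structure Ok (h : FibHeap V) (S : Finset V) : Prop where
  forest : Forest h S fun _ => 0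
  ordered : Ordered h
  roots : RootsOk h S
  slot : ∀ i, h.slot i = none
  card_le : S.card ≤ h.cap
  top : TopOk h S

theorem ok_empty : Ok (FibHeap.empty : FibHeap V) ∅ where
  forest :=
    { up_mem := fun _ _ h => by cases h
      kids_mem := fun _ _ h => by cases h
      rank_eq := by simp
      acyclic := ⟨fun _ => 0, fun _ _ h => (by cases h)⟩
      degree := ⟨fun _ => 0, ⟨fun _ _ h => (by cases h), fun p j => by simp [children]⟩⟩ }
  ordered _ _ h := by cases h
  roots := ⟨List.nodup_nil, fun x => by simp [FibHeap.empty]⟩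
  slot _ := rfl
  card_le := by simp
  top := Or.inl ⟨rfl, rfl⟩

theorem newTop_cost_le (h : FibHeap V) (x : V) (k : WithTop ℝ) : (newTop h x k).cost ≤ 3 := by
  unfold newTop
  split
  · simp
  · rename_i z _
    by_cases hk : k < h.key z <;> simp [hk]

theorem newTop_none {h : FibHeap V} {x : V} {k : WithTop ℝ} (ht : h.top = none) :
    (newTop h x k).val = some x := by
  simp [newTop, ht]

theorem newTop_lt {h : FibHeap V} {x z : V} {k : WithTop ℝ} (ht : h.top = some z)
    (hk : k < h.key z) : (newTop h x k).val = some x := by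
  simp [newTop, ht, hk]

theorem newTop_le {h : FibHeap V} {x z : V} {k : WithTop ℝ} (ht : h.top = some z)
    (hk : h.key z ≤ k) : (newTop h x k).val = some z := by
  simp [newTop, ht, not_lt.2 hk]

/-- At most 11 steps, and one new root of weight 26. The fresh child list is empty and the vertex is
unmarked, so nothing else enters the potential. -/
theorem insert_spec {h : FibHeap V} {S : Finset V} (hO : Ok h S) {x : V} (hx : x ∉ S)
    (k : WithTop ℝ) :
    Ok (h.insert x k).val (Insert.insert x S) ∧
      (h.insert x k).val.key = Function.update h.key x k ∧
      (h.insert x k).cost + pot 26 (h.insert x k).val (Insert.insert x S) ≤ pot 26 h S + 40 := by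
  have hF := hO.forest
  have hux : h.up x = none := by
    rcases hu : h.up x with _ | p
    · rfl
    · exact absurd (hF.up_mem x p hu).1 hx
  have hup : (h.insert x k).val.up = h.up := by
    change Function.update h.up x none = h.up
    rw [← hux, Function.update_eq_self]
  have hkey : (h.insert x k).val.key = Function.update h.key x k := rfl
  have hkids : (h.insert x k).val.kids = Function.update h.kids x [] := rfl
  have hrank : (h.insert x k).val.rank = Function.update h.rank x 0 := rfl
  have hmark : (h.insert x k).val.mark = Function.update h.mark x false := rfl
  have hroots : (h.insert x k).val.roots = x :: h.roots := rfl
  have hslot : (h.insert x k).val.slot = Function.update h.slot h.cap none := rfl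
  have hcap : (h.insert x k).val.cap = h.cap + 1 := rfl
  have htop : (h.insert x k).val.top
      = (newTop { h with key := Function.update h.key x k } x k).val := rfl
  have hcost : (h.insert x k).cost ≤ 11 := by
    have := newTop_cost_le { h with key := Function.update h.key x k } x k
    simp only [FibHeap.insert, Timed.bind_cost, Timed.pure_cost, wr_cost, op_cost, wr_val]
    omega
  have hne : ∀ c p, h.up c = some p → c ≠ x ∧ p ≠ x := fun c p hc =>
    ⟨fun e => hx (e ▸ (hF.up_mem c p hc).1), fun e => hx (e ▸ (hF.up_mem c p hc).2)⟩
  have hch : ∀ p, (h.insert x k).val.children (Insert.insert x S) p = h.children S p := by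
    intro p
    rw [children, hup, Finset.filter_insert, hux]
    simp [children]
  generalize (h.insert x k).val = h' at *
  refine ⟨⟨⟨?_, ?_, ?_, ?_, ?_⟩, ?_, ⟨?_, ?_⟩, ?_, ?_, ?_⟩, hkey, ?_⟩
  · intro c p hc
    rw [hup] at hc
    simp [hF.up_mem c p hc]
  · intro c p hc
    rw [hup] at hc
    rw [hkids, Function.update_of_ne (hne c p hc).2]
    exact hF.kids_mem c p hc
  · intro y hy
    rw [hch, hrank, Function.update_apply]
    split_ifs with hyx
    · rw [eq_comm, Finset.card_eq_zero, children, Finset.filter_eq_empty_iff]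
      intro c _ hc
      exact (hne c y hc).2 hyx
    · exact hF.rank_eq y (Finset.mem_of_mem_insert_of_ne hy hyx)
  · rw [hup]; exact hF.acyclic
  · obtain ⟨g, hg, hc⟩ := hF.degree
    refine ⟨g, fun c p hcp => ?_, fun p j => by rw [hch]; exact hc p j⟩
    rw [hup] at hcp
    rw [hrank, hmark, Function.update_of_ne (hne c p hcp).1, Function.update_of_ne (hne c p hcp).1]
    exact hg c p hcp
  · intro c p hcp
    rw [hup] at hcp
    rw [hkey, Function.update_of_ne (hne c p hcp).1, Function.update_of_ne (hne c p hcp).2]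
    exact hO.ordered c p hcp
  · rw [hroots, List.nodup_cons]
    exact ⟨fun hm => hx ((hO.roots.2 x).1 hm).1, hO.roots.1⟩
  · intro y
    rw [hroots, hup, List.mem_cons, hO.roots.2, Finset.mem_insert]
    by_cases hyx : y = x
    · simp [hyx, hux]
    · simp [hyx]
  · intro i
    rw [hslot, Function.update_apply]
    split_ifs
    · rfl
    · exact hO.slot i
  · rw [Finset.card_insert_of_notMem hx, hcap]
    exact Nat.succ_le_succ hO.card_le
  · rw [TopOk, hkey, hup]
    right
    rcases hO.top with ⟨ht, rfl⟩ | ⟨z, hz, ht, hzu, hmin⟩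
    · refine ⟨x, by simp, htop.trans (newTop_none ht), hux, ?_⟩
      simp
    · have hzx : z ≠ x := fun e => hx (e ▸ hz)
      have hmin' : ∀ y ∈ S, h.key z ≤ Function.update h.key x k y := by
        intro y hy
        rw [Function.update_of_ne (ne_of_mem_of_not_mem hy hx)]
        exact hmin y hy
      have ekz : Function.update h.key x k z = h.key z := Function.update_of_ne hzx _ _
      rcases lt_or_ge k (h.key z) with hk | hk
      · refine ⟨x, by simp, htop.trans (newTop_lt ht (hk.trans_eq ekz.symm)), hux, ?_⟩
        intro y hy
        rw [Function.update_self]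
        rcases Finset.mem_insert.1 hy with rfl | hy
        · simp
        · exact hk.le.trans (hmin' y hy)
      · refine ⟨z, by simp [hz], htop.trans (newTop_le ht (ekz.le.trans hk)), hzu, ?_⟩
        intro y hy
        rw [ekz]
        rcases Finset.mem_insert.1 hy with rfl | hy
        · simpa using hk
        · exact hmin' y hy
  · have h1 : (h'.rootSet (Insert.insert x S)).card ≤ (h.rootSet S).card + 1 := by
      rw [rootSet, hup, Finset.filter_insert, if_pos hux]
      exact Finset.card_insert_le _ _
    have h2 : h'.markSet (Insert.insert x S) = h.markSet S := by
      rw [markSet, hmark, Finset.filter_insert, Function.update_self]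
      simp only [Bool.false_eq_true, if_false]
      refine Finset.filter_congr fun c hc => ?_
      rw [Function.update_of_ne (ne_of_mem_of_not_mem hc hx)]
    have h3 : ∑ y ∈ Insert.insert x S, (h'.kids y).length = ∑ y ∈ S, (h.kids y).length := by
      rw [Finset.sum_insert hx, hkids, Function.update_self, List.length_nil, zero_add]
      refine Finset.sum_congr rfl fun c hc => ?_
      rw [Function.update_of_ne (ne_of_mem_of_not_mem hc hx)]
    unfold pot
    rw [h2, h3]
    omega

end FibHeap

namespace FibHeap

variable {V : Type} [DecidableEq V]

/-! ### Decreasing a key -/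

theorem markSet_card_lt {h : FibHeap V} {S : Finset V} {x : V} (hx : x ∈ S)
    (hm : h.mark x = false) : (h.markSet S).card < S.card := by
  refine Finset.card_lt_card ⟨Finset.filter_subset _ _, fun hS => ?_⟩
  have := (Finset.mem_filter.1 (hS hx)).2
  rw [hm] at this
  cases this

/-- The worst case is a cut: 10 steps up to and including it, 26 for the new root, 37 for the
cascade and 3 for the look at `top`, which stays below 80. -/
theorem decreaseKey_spec {h : FibHeap V} {S : Finset V} (hO : Ok h S) {x : V} (hx : x ∈ S)
    {k : WithTop ℝ} (hk : k ≤ h.key x) :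
    Ok (h.decreaseKey x k).val S ∧
      (h.decreaseKey x k).val.key = Function.update h.key x k ∧
      (h.decreaseKey x k).cost + pot 26 (h.decreaseKey x k).val S ≤ pot 26 h S + 80 := by
  have hF := hO.forest
  -- the heap before the last look at the new key
  obtain ⟨t, hval, hcost, hroot, htF, htR, htC, htcost⟩ :
      ∃ t : Timed (FibHeap V), 
        (h.decreaseKey x k).val
          = { t.val with top := (newTop t.val x k).val } ∧
        (h.decreaseKey x k).cost = t.cost + (newTop t.val x k).cost ∧
        (t.val.up x = none ∨ ∃ p ∈ S, p ≠ x ∧ h.key p ≤ k ∧ t.val.up x = some p) ∧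
        Forest t.val S (fun _ => 0) ∧ RootsOk t.val S ∧
        CutFrom { h with key := Function.update h.key x k } t.val ∧
        t.cost + pot 26 t.val S ≤ pot 26 h S + 77 := by
    have hF₁ : Forest { h with key := Function.update h.key x k } S fun _ => 0 :=
      hF.congr rfl rfl rfl rfl
    have hC₁ : CutFrom { h with key := Function.update h.key x k }
        { h with key := Function.update h.key x k } := ⟨rfl, rfl, rfl, rfl, fun _ _ => id⟩
    have hp₁ : pot 26 { h with key := Function.update h.key x k } S = pot 26 h S :=
      pot_congr 26 rfl rfl rfl
    have hR₁ : RootsOk { h with key := Function.update h.key x k } S := hO.roots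
    rcases hu : h.up x with _ | p
    · refine ⟨⟨{ h with key := Function.update h.key x k }, 2⟩, ?_, ?_, Or.inl hu, hF₁,
        hR₁, hC₁, ?_⟩
      · simp [decreaseKey, hu]
      · simp [decreaseKey, hu]; omega
      · simp only; omega
    · have hpS := (hF.up_mem x p hu).2
      have hxp := hF.ne hu
      have ekp : Function.update h.key x k p = h.key p := Function.update_of_ne hxp.symm _ _
      by_cases hkp : k < h.key p
      · have hFc := hF₁.cut (x := x) (p := p) hu (e' := fun c => if c = p then 1 else 0)
          (fun c _ => by simp) (by simp)
        have hRc := hR₁.cut (p := p) hx hu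
        have hmc : (FibHeap.cut { h with key := Function.update h.key x k } x p).val.mark x
            = false := by rw [cut_mark, Function.update_self]
        -- The vertex just cut is unmarked, so there are fewer marks than elements, and `cap` rounds
        -- are enough.
        obtain ⟨h1, h2, h3, h4⟩ := cascade_spec h.cap _ p hFc hRc hpS
          ((markSet_card_lt hx hmc).trans_le hO.card_le)
        have h5 := cut_pot_le 26 { h with key := Function.update h.key x k } (p := p) hx
        refine ⟨⟨(cascade h.cap
          (FibHeap.cut { h with key := Function.update h.key x k } x p).val p).val,
          10 + (cascade h.cap
          (FibHeap.cut { h with key := Function.update h.key x k } x p).val p).cost⟩, ?_, ?_,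
          Or.inl ?_, h1, h2, (CutFrom.cut _ x p).trans h3, ?_⟩
        · simp [decreaseKey, hu, ekp, hkp, show ∀ h : FibHeap V, (FibHeap.cut h x p).val.cap = h.cap from fun _ => rfl]
        · simp [decreaseKey, hu, ekp, hkp, cut_cost, show ∀ h : FibHeap V, (FibHeap.cut h x p).val.cap = h.cap from fun _ => rfl]; omega
        · exact h3.up_none (by rw [cut_up, Function.update_self])
        · simp only; omega
      · refine ⟨⟨{ h with key := Function.update h.key x k }, 4⟩, ?_, ?_,
          Or.inr ⟨p, hpS, hxp.symm, not_lt.1 hkp, hu⟩, hF₁, hR₁, hC₁, ?_⟩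
        · simp [decreaseKey, hu, ekp, hkp]
        · simp [decreaseKey, hu, ekp, hkp]; omega
        · simp only; omega
  have hntc := newTop_cost_le t.val x k
  rw [hval]
  refine ⟨⟨htF.congr rfl rfl rfl rfl, ?_, htR, ?_, ?_, ?_⟩, htC.key, ?_⟩
  · intro c q hcq
    have hcq' : h.up c = some q := htC.up c q hcq
    have hne := hF.ne hcq'
    simp only [htC.key, Function.update_apply]
    split_ifs with h1 h2 h2
    · exact le_rfl
    · exact hk.trans (by rw [← h1]; exact hO.ordered c q hcq')
    · subst h2
      rcases hroot with h3 | ⟨p, -, -, h4, h5⟩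
      · rw [h3] at hcq; cases hcq
      · rw [h5] at hcq; cases hcq; exact h4
    · exact hO.ordered c q hcq'
  · intro i
    change t.val.slot i = none
    rw [htC.slot]
    exact hO.slot i
  · change S.card ≤ t.val.cap
    rw [htC.cap]
    exact hO.card_le
  · rcases hO.top with ⟨-, rfl⟩ | ⟨z, hz, ht, hzu, hmin⟩
    · simp at hx
    have htt : t.val.top = some z := htC.top.trans ht
    have ek : ∀ y, t.val.key y = Function.update h.key x k y := fun y => by rw [htC.key]
    right
    rcases lt_or_ge k (t.val.key z) with hlt | hge
    · have hzx : z ≠ x := by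
        rintro rfl
        rw [ek, Function.update_self] at hlt
        exact lt_irrefl _ hlt
      rw [ek, Function.update_of_ne hzx] at hlt
      refine ⟨x, hx, newTop_lt htt (by rw [ek, Function.update_of_ne hzx]; exact hlt), ?_, ?_⟩
      · rcases hroot with h3 | ⟨p, hp, -, h4, -⟩
        · exact h3
        -- If `x` had kept its parent `p`, then `key z ≤ key p ≤ k`, contrary to `k < key z`.
        · exact absurd (hlt.trans_le ((hmin p hp).trans h4)) (lt_irrefl _)
      · intro y hy
        change t.val.key x ≤ t.val.key y
        rw [ek, ek, Function.update_self, Function.update_apply]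
        split_ifs
        · exact le_rfl
        · exact hlt.le.trans (hmin y hy)
    · refine ⟨z, hz, newTop_le htt hge, htC.up_none hzu, ?_⟩
      intro y hy
      change t.val.key z ≤ t.val.key y
      by_cases hyx : y = x
      · rw [hyx, ek x, Function.update_self]; exact hge
      · rw [ek y, Function.update_of_ne hyx]
        refine le_trans ?_ (hmin y hy)
        rw [ek, Function.update_apply]
        split_ifs with hzx
        · rw [hzx]; exact hk
        · exact le_rfl
  · rw [hcost]
    refine le_trans (Nat.add_le_add_left (pot_congr (h := t.val) 26 rfl rfl rfl).le _) ?_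
    omega

/-! ### Linking trees -/

theorem link_cost (h : FibHeap V) (y x : V) : (link h y x).cost = 8 := rfl

theorem link_up (h : FibHeap V) (y x : V) :
    (link h y x).val.up = Function.update h.up y (some x) := rfl

theorem link_mark (h : FibHeap V) (y x : V) :
    (link h y x).val.mark = Function.update h.mark y false := rfl

theorem link_kids (h : FibHeap V) (y x : V) :
    (link h y x).val.kids = Function.update h.kids x (y :: h.kids x) := rfl

theorem link_rank (h : FibHeap V) (y x : V) :
    (link h y x).val.rank = Function.update h.rank x (h.rank x + 1) := rfl

theorem link_children {h : FibHeap V} {S : Finset V} {x y : V} (hy : y ∈ S)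
    (hyu : h.up y = none) (q : V) : (link h y x).val.children S q
      = if q = x then Insert.insert y (h.children S x) else h.children S q := by
  ext c
  rw [children, link_up, Finset.mem_filter, Function.update_apply]
  by_cases hc : c = y
  · subst hc
    by_cases h1 : q = x
    · simp [hy, h1]
    · simpa [children, hyu, hy, h1] using fun e => h1 e.symm
  · split_ifs with h1 <;> simp [children, hc, h1]

/-- The new child `y` gets `g y = rank y`, which equals the number of children that `x` had before.
This is exactly what the counting condition on `g` permits. -/
theorem Forest.link {h : FibHeap V} {S : Finset V} (hF : Forest h S fun _ => 0) {x y : V}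
    (hx : x ∈ S) (hy : y ∈ S) (hxy : x ≠ y) (hxu : h.up x = none) (hyu : h.up y = none)
    (hr : h.rank x = h.rank y) : Forest (FibHeap.link h y x).val S fun _ => 0 := by
  have hyc : ∀ q, y ∉ h.children S q := fun q hm => by
    have := (Finset.mem_filter.1 hm).2
    rw [hyu] at this
    cases this
  have hcx : ∀ c q, h.up c = some q → c ≠ x ∧ c ≠ y := by
    intro c q hc
    constructor <;> rintro rfl
    · rw [hxu] at hc; cases hc
    · rw [hyu] at hc; cases hc
  have hup : ∀ c q, (FibHeap.link h y x).val.up c = some q →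
      (c = y ∧ q = x) ∨ (c ≠ y ∧ h.up c = some q) := by
    intro c q hc
    rw [link_up, Function.update_apply] at hc
    split_ifs at hc with h1
    · cases hc; exact Or.inl ⟨h1, rfl⟩
    · exact Or.inr ⟨h1, hc⟩
  refine ⟨?_, ?_, ?_, ?_, ?_⟩
  · intro c q hc
    rcases hup c q hc with ⟨rfl, rfl⟩ | ⟨-, hc'⟩
    · exact ⟨hy, hx⟩
    · exact hF.up_mem c q hc'
  · intro c q hc
    rw [link_kids, Function.update_apply]
    rcases hup c q hc with ⟨rfl, rfl⟩ | ⟨-, hc'⟩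
    · simp
    · have := hF.kids_mem c q hc'
      split_ifs with h1
      · subst h1; simp [this]
      · exact this
  · intro z hz
    rw [link_children hy hyu, link_rank, Function.update_apply]
    split_ifs with h1
    · rw [Finset.card_insert_of_notMem (hyc x), hF.rank_eq x hx]
    · exact hF.rank_eq z hz
  · obtain ⟨ht, hht⟩ := hF.acyclic
    -- Only the height of `x` is raised. This breaks no inequality, since `x` is a root and nothing
    -- lies above it.
    refine ⟨Function.update ht x (max (ht x) (ht y + 1)), fun c q hc => ?_⟩
    rcases hup c q hc with ⟨rfl, rfl⟩ | ⟨-, hc'⟩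
    · rw [Function.update_self, Function.update_of_ne hxy.symm]
      omega
    · have h1 := hht c q hc'
      rw [Function.update_of_ne (hcx c q hc').1, Function.update_apply]
      split_ifs with h2
      · subst h2; omega
      · exact h1
  · obtain ⟨g, hg, hc⟩ := hF.degree
    have hgc : ∀ q j, ((h.children S q).filter fun c => Function.update g y (h.rank y) c < j)
        = (h.children S q).filter fun c => g c < j := by
      intro q j
      refine Finset.filter_congr fun c hcq => ?_
      rw [Function.update_of_ne (ne_of_mem_of_not_mem hcq (hyc q))]
    refine ⟨Function.update g y (h.rank y), fun c q hcq => ?_, fun q j => ?_⟩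
    · rcases hup c q hcq with ⟨rfl, rfl⟩ | ⟨hcy, hc'⟩
      · rw [Function.update_self, link_rank, Function.update_of_ne hxy.symm]
        omega
      · rw [Function.update_of_ne hcy, link_rank, Function.update_of_ne (hcx c q hc').1,
          link_mark, Function.update_of_ne hcy]
        exact hg c q hc'
    · rw [link_children hy hyu]
      split_ifs with h1
      · rw [Finset.filter_insert, hgc, Function.update_self]
        split_ifs with h2
        · refine (Finset.card_insert_le _ _).trans ?_
          -- When `y` is counted, `rank y < j`; even if all old children of `x` count too, there are
          -- `rank x + 1 ≤ j` of them.
          have h3 := Finset.card_filter_le (h.children S x) fun c => g c < j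
          rw [← hF.rank_eq x hx] at h3
          omega
        · exact hc x j
      · rw [hgc]
        exact hc q j

/-- One root disappears and one entry of a child list, of weight 5, appears; no mark is added. -/
theorem link_pot_le (a : ℕ) (h : FibHeap V) {S : Finset V} {x y : V} (hx : x ∈ S) (hy : y ∈ S)
    (hyu : h.up y = none) : pot a (link h y x).val S + a ≤ pot a h S + 5 := by
  have h1 : (link h y x).val.rootSet S = (h.rootSet S).erase y := by
    ext c
    rw [rootSet, link_up, Finset.mem_filter, Finset.mem_erase, rootSet, Finset.mem_filter,
      Function.update_apply]
    by_cases hc : c = y <;> simp [hc]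
  have h2 := Finset.card_erase_add_one
    (show y ∈ h.rootSet S from Finset.mem_filter.2 ⟨hy, hyu⟩)
  have h3 : (link h y x).val.markSet S ⊆ h.markSet S := by
    intro c
    rw [markSet, link_mark, Finset.mem_filter, markSet, Finset.mem_filter, Function.update_apply]
    by_cases hc : c = y <;> simp [hc]
  have h4 := Finset.card_le_card h3
  have h5 : ∑ z ∈ S, ((link h y x).val.kids z).length = ∑ z ∈ S, (h.kids z).length + 1 := by
    rw [link_kids, ← Finset.add_sum_erase _ _ hx, ← Finset.add_sum_erase S _ hx,
      Function.update_self, List.length_cons]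
    have : ∀ z ∈ S.erase x, (Function.update h.kids x (y :: h.kids x) z).length
        = (h.kids z).length := fun z hz => by rw [Function.update_of_ne (Finset.ne_of_mem_erase hz)]
    rw [Finset.sum_congr rfl this]
    ring
  unfold pot
  rw [h1, h5]
  nlinarith

/-! ### Consolidation -/

/-- The state while trees are merged: the roots in `l` are not in a bin yet. -/
structure Placing (h : FibHeap V) (S : Finset V) (l : List V) : Prop where
  forest : Forest h S fun _ => 0
  ordered : Ordered h
  slots : ∀ i z, h.slot i = some z → (z ∈ S ∧ h.up z = none) ∧ h.rank z = i ∧ z ∉ l ∧ i < h.height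
  nodup : l.Nodup
  pending : ∀ x ∈ l, x ∈ S ∧ h.up x = none
  cover : ∀ x ∈ S, h.up x = none → x ∈ l ∨ h.slot (h.rank x) = some x
  height_le : h.height ≤ rankBound S.card + 1

theorem Placing.perm {h : FibHeap V} {S : Finset V} {l l' : List V} (hP : Placing h S l)
    (hl : l.Perm l') : Placing h S l' where
  forest := hP.forest
  ordered := hP.ordered
  slots i z hz := by
    have := hP.slots i z hz
    rwa [hl.mem_iff] at this
  nodup := hl.nodup_iff.1 hP.nodup
  pending x hx := hP.pending x (hl.mem_iff.2 hx)
  cover x hx hu := by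
    have := hP.cover x hx hu
    rwa [hl.mem_iff] at this
  height_le := hP.height_le

theorem Placing.link {h : FibHeap V} {S : Finset V} {x y : V} {l : List V}
    (hP : Placing h S (y :: x :: l)) (hr : h.rank x = h.rank y) (hk : h.key x ≤ h.key y) :
    Placing (FibHeap.link h y x).val S (x :: l) := by
  obtain ⟨hy, hyu⟩ := hP.pending y (by simp)
  obtain ⟨hx, hxu⟩ := hP.pending x (by simp)
  have hnd := hP.nodup
  have hxy : x ≠ y := by rintro rfl; simp at hnd
  have hup : ∀ z, z ≠ y → (FibHeap.link h y x).val.up z = h.up z := fun z hz => by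
    rw [link_up, Function.update_of_ne hz]
  refine ⟨hP.forest.link hx hy hxy hxu hyu hr, ?_, ?_, (List.nodup_cons.1 hnd).2, ?_, ?_,
    hP.height_le⟩
  · intro c q hc
    change h.key q ≤ h.key c
    rw [link_up, Function.update_apply] at hc
    split_ifs at hc with h1
    · cases hc; rw [h1]; exact hk
    · exact hP.ordered c q hc
  · intro i z hz
    obtain ⟨⟨h1, h2⟩, h3, h4, h5⟩ := hP.slots i z hz
    rw [List.mem_cons, List.mem_cons, not_or, not_or] at h4
    refine ⟨⟨h1, by rw [hup z h4.1]; exact h2⟩, ?_, by simp [h4], h5⟩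
    rw [link_rank, Function.update_of_ne h4.2.1]
    exact h3
  · intro z hz
    have hzy : z ≠ y := by rintro rfl; exact (List.nodup_cons.1 hnd).1 hz
    rw [hup z hzy]
    exact hP.pending z (List.mem_cons_of_mem _ hz)
  · intro z hz hzu
    have hzy : z ≠ y := by
      rintro rfl
      rw [link_up, Function.update_self] at hzu
      cases hzu
    rw [hup z hzy] at hzu
    by_cases hzx : z = x
    · simp [hzx]
    · rcases hP.cover z hz hzu with h1 | h1
      · left; simpa [hzy] using h1
      · right
        rw [link_rank, Function.update_of_ne hzx]
        exact h1

/-- The parts of a heap that merging trees leaves alone. -/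
structure SameElems (h h' : FibHeap V) : Prop where
  key : h'.key = h.key
  cap : h'.cap = h.cap
  roots : h'.roots = h.roots
  top : h'.top = h.top

/-- A merge takes 14 steps and adds a list entry of weight 5, paid for by the root that disappears
as soon as `19 ≤ a`; the final placement takes 4 steps. Each merge raises the rank by one and uses
up one round, so `n + rank` never decreases, while the rank stays below `S.card`. -/
theorem place_spec {S : Finset V} {a : ℕ} (ha : 19 ≤ a) : ∀ (n : ℕ) (h : FibHeap V) (x : V)
    (l : List V), Placing h S (x :: l) → S.card < n + h.rank x →
    Placing (place n h x).val S l ∧ SameElems h (place n h x).val ∧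
      (place n h x).cost + pot a (place n h x).val S ≤ pot a h S + 4 := by
  intro n
  induction n with
  | zero =>
    intro h x l hP hn
    obtain ⟨hx, hxu⟩ := hP.pending x (by simp)
    have := hP.forest.rank_lt hx hxu
    omega
  | succ n ih =>
    intro h x l hP hn
    obtain ⟨hx, hxu⟩ := hP.pending x (by simp)
    have hnd := List.nodup_cons.1 hP.nodup
    rcases hs : h.slot (h.rank x) with _ | y
    · have e : place (n + 1) h x = ⟨{ h with
            slot := Function.update h.slot (h.rank x) (some x)
            height := max h.height (h.rank x + 1) }, 4⟩ := by
        apply Timed.eq_of <;> simp [place, hs]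
      rw [e]
      refine ⟨⟨hP.forest.congr rfl rfl rfl rfl, hP.ordered, ?_, hnd.2, ?_, ?_, ?_⟩,
        ⟨rfl, rfl, rfl, rfl⟩, ?_⟩
      · intro i z hz
        simp only [Function.update_apply] at hz
        simp only
        split_ifs at hz with h1
        · cases hz
          exact ⟨⟨hx, hxu⟩, h1.symm, hnd.1, by omega⟩
        · obtain ⟨h2, h3, h4, h5⟩ := hP.slots i z hz
          exact ⟨h2, h3, fun h6 => h4 (List.mem_cons_of_mem _ h6), by omega⟩
      · intro z hz
        exact hP.pending z (List.mem_cons_of_mem _ hz)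
      · intro z hz hzu
        simp only [Function.update_apply]
        rcases hP.cover z hz hzu with h1 | h1
        · rcases List.mem_cons.1 h1 with rfl | h1
          · right; simp
          · exact Or.inl h1
        · right
          rw [if_neg]
          · exact h1
          · intro h2
            rw [h2, hs] at h1
            cases h1
      · have h1 := hP.forest.rank_le hx hxu
        have h2 := hP.height_le
        simp only
        omega
      · exact (Nat.add_comm _ _).le
    · obtain ⟨⟨hy, hyu⟩, hyr, hyl, -⟩ := hP.slots _ _ hs
      -- Emptying the bin puts its tree `y` back among the pending ones; the merge then removes one
      -- of the two from that list.
      have hP₁ : Placing { h with slot := Function.update h.slot (h.rank x) none } S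
          (y :: x :: l) := by
        refine ⟨hP.forest.congr rfl rfl rfl rfl, hP.ordered, ?_,
          List.nodup_cons.2 ⟨hyl, hP.nodup⟩, ?_, ?_, hP.height_le⟩
        · intro i z hz
          simp only [Function.update_apply] at hz
          split_ifs at hz with h1
          obtain ⟨h2, h3, h4, h5⟩ := hP.slots i z hz
          refine ⟨h2, h3, ?_, h5⟩
          rw [List.mem_cons, not_or]
          refine ⟨?_, h4⟩
          rintro rfl
          exact h1 (h3.symm.trans hyr)
        · intro z hz
          rcases List.mem_cons.1 hz with rfl | hz
          · exact ⟨hy, hyu⟩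
          · exact hP.pending z hz
        · intro z hz hzu
          rcases hP.cover z hz hzu with h1 | h1
          · exact Or.inl (List.mem_cons_of_mem _ h1)
          · simp only [Function.update_apply]
            by_cases h2 : h.rank z = h.rank x
            · rw [h2, hs] at h1
              cases h1
              simp
            · right
              rw [if_neg h2]
              exact h1
      by_cases hk : h.key y < h.key x
      · have h1 := (hP₁.perm (List.Perm.swap x y l)).link hyr hk.le
        obtain ⟨h2, h3, h4⟩ := ih _ y l h1 (by
          rw [link_rank, Function.update_self]
          simp only
          omega)
        have h5 := link_pot_le a { h with slot := Function.update h.slot (h.rank x) none }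
          hy hx hxu
        change _ ≤ pot a h S + 5 at h5
        have e : place (n + 1) h x = ⟨(place n (FibHeap.link
            { h with slot := Function.update h.slot (h.rank x) none } x y).val y).val,
            14 + (place n (FibHeap.link
            { h with slot := Function.update h.slot (h.rank x) none } x y).val y).cost⟩ := by
          apply Timed.eq_of <;> simp [place, hs, hk, link_cost]
          omega
        rw [e]
        exact ⟨h2, ⟨h3.key, h3.cap, h3.roots, h3.top⟩, by simp only; omega⟩
      · have h1 := hP₁.link hyr.symm (not_lt.1 hk)
        obtain ⟨h2, h3, h4⟩ := ih _ x l h1 (by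
          rw [link_rank, Function.update_self]
          simp only
          omega)
        have h5 := link_pot_le a { h with slot := Function.update h.slot (h.rank x) none }
          hx hy hyu
        change _ ≤ pot a h S + 5 at h5
        have e : place (n + 1) h x = ⟨(place n (FibHeap.link
            { h with slot := Function.update h.slot (h.rank x) none } y x).val x).val,
            14 + (place n (FibHeap.link
            { h with slot := Function.update h.slot (h.rank x) none } y x).val x).cost⟩ := by
          apply Timed.eq_of <;> simp [place, hs, hk, link_cost]
          omega
        rw [e]
        exact ⟨h2, ⟨h3.key, h3.cap, h3.roots, h3.top⟩, by simp only; omega⟩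

theorem place_all_spec {S : Finset V} {a : ℕ} (ha : 19 ≤ a) : ∀ (l : List V) (h : FibHeap V),
    Placing h S l → S.card < h.cap →
    Placing (forEach (fun h x => place h.cap h x) h l).val S [] ∧
      SameElems h (forEach (fun h x => place h.cap h x) h l).val ∧
      (forEach (fun h x => place h.cap h x) h l).cost
        + pot a (forEach (fun h x => place h.cap h x) h l).val S ≤ pot a h S + 5 * l.length := by
  intro l
  induction l with
  | nil => intro h hP _; exact ⟨hP, ⟨rfl, rfl, rfl, rfl⟩, by simp⟩
  | cons x l ih =>
    intro h hP hc
    obtain ⟨h1, h2, h3⟩ := place_spec ha h.cap h x l hP (by omega)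
    obtain ⟨h4, h5, h6⟩ := ih _ h1 (by rw [h2.cap]; exact hc)
    rw [forEach_cons_val, forEach_cons_cost, List.length_cons]
    refine ⟨h4, ⟨h5.key.trans h2.key, h5.cap.trans h2.cap, h5.roots.trans h2.roots,
      h5.top.trans h2.top⟩, ?_⟩
    omega

end FibHeap

namespace FibHeap

variable {V : Type} [DecidableEq V]

/-! ### Removing an element with the least key -/

/-- `h'` arises from `h` when the children of `z` in the list `l` become roots. -/
structure Released (z : V) (l : List V) (h h' : FibHeap V) : Prop where
  key : h'.key = h.key
  kids : h'.kids = h.kids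
  rank : h'.rank = h.rank
  mark : h'.mark = h.mark
  slot : h'.slot = h.slot
  cap : h'.cap = h.cap
  up : ∀ c, h'.up c = if c ∈ l ∧ h.up c = some z then none else h.up c
  mem_roots : ∀ c, c ∈ h'.roots ↔ c ∈ h.roots ∨ (c ∈ l ∧ h.up c = some z)
  nodup : h.roots.Nodup → (∀ c ∈ h.roots, h.up c ≠ some z) → h'.roots.Nodup

theorem release_spec (z : V) (h : FibHeap V) (c : V) :
    Released z [c] h (release z h c).val ∧ (release z h c).cost ≤ 4 := by
  by_cases hc : h.up c = some z
  · have e : release z h c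
        = ⟨{ h with up := Function.update h.up c none, roots := c :: h.roots }, 4⟩ := by
      apply Timed.eq_of <;> simp [release, hc]
    rw [e]
    refine ⟨⟨rfl, rfl, rfl, rfl, rfl, rfl, fun d => ?_, fun d => ?_, fun h1 h2 => ?_⟩, le_rfl⟩
    · simp only [Function.update_apply, List.mem_singleton]
      by_cases hd : d = c <;> simp [hd, hc]
    · simp only [List.mem_cons, List.not_mem_nil, or_false]
      by_cases hd : d = c <;> simp [hd, hc]
    · exact List.nodup_cons.2 ⟨fun h3 => h2 c h3 hc, h1⟩
  · have e : release z h c = ⟨h, 2⟩ := by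
      apply Timed.eq_of <;> simp [release, hc]
    rw [e]
    refine ⟨⟨rfl, rfl, rfl, rfl, rfl, rfl, fun d => ?_, fun d => ?_, fun h1 _ => h1⟩, by simp⟩
    · rw [if_neg]
      rintro ⟨h0, h1⟩
      rw [List.mem_singleton.1 h0] at h1
      exact hc h1
    · simp only [List.mem_singleton]
      refine ⟨Or.inl, ?_⟩
      rintro (h1 | ⟨rfl, h1⟩)
      · exact h1
      · exact absurd h1 hc

theorem release_all_spec (z : V) : ∀ (l : List V) (h : FibHeap V),
    Released z l h (forEach (release z) h l).val ∧
      (forEach (release z) h l).cost ≤ 5 * l.length := by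
  intro l
  induction l with
  | nil =>
    intro h
    exact ⟨⟨rfl, rfl, rfl, rfl, rfl, rfl, by simp, by simp, fun h1 _ => h1⟩, le_rfl⟩
  | cons c l ih =>
    intro h
    obtain ⟨h1, h2⟩ := release_spec z h c
    obtain ⟨h3, h4⟩ := ih (release z h c).val
    rw [forEach_cons_val, forEach_cons_cost, List.length_cons]
    generalize (release z h c).val = h' at *
    have hu : ∀ d, h'.up d = some z ↔ d ≠ c ∧ h.up d = some z := by
      intro d
      rw [h1.up d]
      by_cases hd : d = c <;> by_cases hz : h.up d = some z <;> simp_all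
    refine ⟨⟨h3.key.trans h1.key, h3.kids.trans h1.kids, h3.rank.trans h1.rank,
      h3.mark.trans h1.mark, h3.slot.trans h1.slot, h3.cap.trans h1.cap, fun d => ?_, fun d => ?_,
      fun h5 h6 => h3.nodup (h1.nodup h5 h6) ?_⟩, by omega⟩
    · rw [h3.up d]
      simp only [hu d]
      rw [h1.up d]
      by_cases hd : d = c <;> by_cases hz : h.up d = some z <;> by_cases hl : d ∈ l <;> simp_all
    · rw [h3.mem_roots, h1.mem_roots, hu, List.mem_singleton, List.mem_cons]
      by_cases hd : d = c <;> by_cases hz : h.up d = some z <;> by_cases hl : d ∈ l <;> simp_all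
    · intro d hd
      rw [Ne, hu, not_and]
      intro hdc
      rcases (h1.mem_roots d).1 hd with h7 | ⟨h7, -⟩
      · exact h6 d h7
      · exact absurd (List.mem_singleton.1 h7) hdc

/-- As `z` is a root, it is no one's child. Its own children become roots, and the child sets of all
other vertices are unchanged. -/
theorem Forest.remove {h h' : FibHeap V} {S : Finset V} (hF : Forest h S fun _ => 0) {z : V}
    (hzu : h.up z = none) (hu : ∀ c, h'.up c = if h.up c = some z then none else h.up c)
    (hk : h'.kids = h.kids) (hr : h'.rank = h.rank) (hm : h'.mark = h.mark) :
    Forest h' (S.erase z) fun _ => 0 := by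
  have hup : ∀ c q, h'.up c = some q ↔ q ≠ z ∧ h.up c = some q := by
    intro c q
    rw [hu]
    split_ifs with h1
    · rw [h1]
      simp only [reduceCtorEq, Option.some.injEq, false_iff, not_and]
      exact fun h2 h3 => h2 h3.symm
    · refine ⟨fun h2 => ⟨?_, h2⟩, fun h2 => h2.2⟩
      rintro rfl
      exact h1 h2
  have hcz : ∀ c q, h.up c = some q → c ≠ z := by
    rintro c q hc rfl
    rw [hzu] at hc
    cases hc
  have hch : ∀ q, h'.children (S.erase z) q ⊆ h.children S q := by
    intro q c hc
    obtain ⟨h1, h2⟩ := Finset.mem_filter.1 hc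
    exact Finset.mem_filter.2 ⟨Finset.mem_of_mem_erase h1, ((hup c q).1 h2).2⟩
  refine ⟨?_, ?_, ?_, ?_, ?_⟩
  · intro c q hc
    obtain ⟨h1, h2⟩ := (hup c q).1 hc
    exact ⟨Finset.mem_erase.2 ⟨hcz c q h2, (hF.up_mem c q h2).1⟩,
      Finset.mem_erase.2 ⟨h1, (hF.up_mem c q h2).2⟩⟩
  · intro c q hc
    rw [hk]
    exact hF.kids_mem c q ((hup c q).1 hc).2
  · intro x hx
    obtain ⟨h1, h2⟩ := Finset.mem_erase.1 hx
    rw [hr, hF.rank_eq x h2]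
    refine congrArg _ (Finset.Subset.antisymm (fun c hc => ?_) (hch x))
    obtain ⟨h3, h4⟩ := Finset.mem_filter.1 hc
    exact Finset.mem_filter.2 ⟨Finset.mem_erase.2 ⟨hcz c x h4, h3⟩, (hup c x).2 ⟨h1, h4⟩⟩
  · obtain ⟨ht, hht⟩ := hF.acyclic
    exact ⟨ht, fun c q hc => hht c q ((hup c q).1 hc).2⟩
  · obtain ⟨g, hg, hc⟩ := hF.degree
    refine ⟨g, fun c q hcq => ?_, fun q j => ?_⟩
    · rw [hr, hm]
      exact hg c q ((hup c q).1 hcq).2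
    · exact (Finset.card_le_card (Finset.filter_subset_filter _ (hch q))).trans (hc q j)

/-- `top` is a root in the list with the least key, if there is one. -/
def TopOfRoots (h : FibHeap V) : Prop :=
  (h.top = none ∧ h.roots = []) ∨
    ∃ z ∈ h.roots, h.top = some z ∧ ∀ x ∈ h.roots, h.key z ≤ h.key x

/-- The state while the bins from `r` to `r + m` are still to be emptied. -/
structure Collecting (h : FibHeap V) (S : Finset V) (r m : ℕ) : Prop where
  slots : ∀ i z, h.slot i = some z → (z ∈ S ∧ h.up z = none) ∧ h.rank z = i ∧ r ≤ i ∧ i < r + m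
  roots : ∀ x ∈ h.roots, (x ∈ S ∧ h.up x = none) ∧ h.rank x < r
  nodup : h.roots.Nodup
  cover : ∀ x ∈ S, h.up x = none → x ∈ h.roots ∨ h.slot (h.rank x) = some x
  top : TopOfRoots h

/-- The parts of a heap that emptying the bins leaves alone. -/
structure SameForest (h h' : FibHeap V) : Prop where
  key : h'.key = h.key
  up : h'.up = h.up
  kids : h'.kids = h.kids
  rank : h'.rank = h.rank
  mark : h'.mark = h.mark
  cap : h'.cap = h.cap

theorem SameForest.trans {h h' h'' : FibHeap V} (H : SameForest h h') (H' : SameForest h' h'') :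
    SameForest h h'' :=
  ⟨H'.key.trans H.key, H'.up.trans H.up, H'.kids.trans H.kids, H'.rank.trans H.rank,
    H'.mark.trans H.mark, H'.cap.trans H.cap⟩

/-- The bins are emptied by increasing rank, so a root from bin `r` differs from all roots collected
earlier, whose ranks are below `r`. -/
theorem collect_spec {h : FibHeap V} {S : Finset V} {r m : ℕ} (hC : Collecting h S r (m + 1)) :
    Collecting (collect h r).val S (r + 1) m ∧ SameForest h (collect h r).val ∧
      (collect h r).val.roots.length ≤ h.roots.length + 1 ∧ (collect h r).cost ≤ 7 := by
  rcases hs : h.slot r with _ | x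
  · have e : collect h r = ⟨h, 1⟩ := by
      apply Timed.eq_of <;> simp [collect, hs]
    rw [e]
    refine ⟨⟨fun i z hz => ?_, fun x hx => ?_, hC.nodup, hC.cover, hC.top⟩,
      ⟨rfl, rfl, rfl, rfl, rfl, rfl⟩, by simp, by simp⟩
    · obtain ⟨h1, h2, h3, h4⟩ := hC.slots i z hz
      refine ⟨h1, h2, ?_, by omega⟩
      rcases Nat.eq_or_lt_of_le h3 with rfl | h5
      · rw [hs] at hz; cases hz
      · exact h5
    · obtain ⟨h1, h2⟩ := hC.roots x hx
      exact ⟨h1, Nat.lt_succ_of_lt h2⟩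
  · obtain ⟨t, ht⟩ : ∃ t, t = newTop h x (h.key x) := ⟨_, rfl⟩
    have hts : t.cost ≤ 3 := by rw [ht]; exact newTop_cost_le _ _ _
    have e : collect h r = ⟨{ h with
        slot := Function.update h.slot r none
        top := t.val
        roots := x :: h.roots }, 4 + t.cost⟩ := by
      apply Timed.eq_of
      · simp [collect, hs, ht]
      · simp [collect, hs, ht]; omega
    obtain ⟨h1, h2, h3, h4⟩ := hC.slots r x hs
    rw [e]
    refine ⟨⟨fun i z hz => ?_, fun y hy => ?_, ?_, fun y hy hyu => ?_, ?_⟩,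
      ⟨rfl, rfl, rfl, rfl, rfl, rfl⟩, by simp, by simp only; omega⟩
    · simp only [Function.update_apply] at hz
      split_ifs at hz with h5
      obtain ⟨h6, h7, h8, h9⟩ := hC.slots i z hz
      exact ⟨h6, h7, by omega, by omega⟩
    · rcases List.mem_cons.1 hy with rfl | hy
      · exact ⟨h1, by simp only; omega⟩
      · obtain ⟨h6, h7⟩ := hC.roots y hy
        exact ⟨h6, by simp only; omega⟩
    · refine List.nodup_cons.2 ⟨fun h5 => ?_, hC.nodup⟩
      have := (hC.roots x h5).2
      omega
    · rcases hC.cover y hy hyu with h5 | h5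
      · exact Or.inl (List.mem_cons_of_mem _ h5)
      · simp only [Function.update_apply]
        by_cases h6 : h.rank y = r
        · rw [h6, hs] at h5
          cases h5
          simp
        · right
          rw [if_neg h6]
          exact h5
    · right
      rcases hC.top with ⟨h5, h6⟩ | ⟨z, h5, h6, h7⟩
      · refine ⟨x, by simp, ?_, by simp [h6]⟩
        simp only [ht]
        exact newTop_none h5
      · rcases lt_or_ge (h.key x) (h.key z) with h8 | h8
        · refine ⟨x, by simp, ?_, ?_⟩
          · simp only [ht]
            exact newTop_lt h6 h8
          · intro y hy
            rcases List.mem_cons.1 hy with rfl | hy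
            · exact le_rfl
            · exact h8.le.trans (h7 y hy)
        · refine ⟨z, by simp [h5], ?_, ?_⟩
          · simp only [ht]
            exact newTop_le h6 h8
          · intro y hy
            rcases List.mem_cons.1 hy with rfl | hy
            · exact h8
            · exact h7 y hy

theorem collect_all_spec {S : Finset V} : ∀ (m r : ℕ) (h : FibHeap V), Collecting h S r m →
    Collecting (forEach collect h (List.range' r m)).val S (r + m) 0 ∧
      SameForest h (forEach collect h (List.range' r m)).val ∧
      (forEach collect h (List.range' r m)).val.roots.length ≤ h.roots.length + m ∧
      (forEach collect h (List.range' r m)).cost ≤ 8 * m := by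
  intro m
  induction m with
  | zero =>
    intro r h hC
    exact ⟨hC, ⟨rfl, rfl, rfl, rfl, rfl, rfl⟩, le_rfl, le_rfl⟩
  | succ m ih =>
    intro r h hC
    obtain ⟨h1, h2, h3, h4⟩ := collect_spec hC
    obtain ⟨h5, h6, h7, h8⟩ := ih (r + 1) _ h1
    rw [List.range'_succ, forEach_cons_val, forEach_cons_cost]
    refine ⟨?_, h2.trans h6, by omega, by omega⟩
    rw [show r + (m + 1) = r + 1 + m by ring]
    exact h5

/-- The weight 26 of an old root splits into 7 for the two passes over the roots (2 in the filter, 5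
in the placing loop) and 19 for a merge. The entries of the child list of `z` pay for their release,
5 each. What remains is proportional to the rank bound: 24 for each released child, 8 for each bin
emptied and 7 to restore the weight of each final root. -/
theorem popMin_spec {h : FibHeap V} {S : Finset V} (hO : Ok h S) (hS : S.Nonempty) :
    ∃ z ∈ S, h.popMin.val.1 = some z ∧ (∀ x ∈ S, h.key z ≤ h.key x) ∧
      Ok h.popMin.val.2 (S.erase z) ∧ h.popMin.val.2.key = h.key ∧
      h.popMin.cost + pot 26 h.popMin.val.2 (S.erase z)
        ≤ pot 26 h S + 40 * (rankBound S.card + 1) := by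
  rcases hO.top with ⟨-, rfl⟩ | ⟨z, hz, ht, hzu, hmin⟩
  · simp at hS
  have hF := hO.forest
  obtain ⟨others, hoth⟩ : ∃ others, others = h.roots.filter fun x => decide (x ≠ z) := ⟨_, rfl⟩
  have hothm : ∀ x, x ∈ others ↔ (x ∈ S ∧ h.up x = none) ∧ x ≠ z := by
    intro x
    rw [hoth, List.mem_filter, hO.roots.2]
    simp
  have hfc : (filterT (fun x => op (decide (x ≠ z))) h.roots).cost ≤ 2 * h.roots.length :=
    filterT_cost_le (c := 1) _ fun _ _ => le_rfl
  obtain ⟨hrel, hrelc⟩ := release_all_spec z (h.kids z) { h with roots := others }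
  obtain ⟨t₁, ht₁⟩ : ∃ t₁, t₁ = forEach (release z) { h with roots := others } (h.kids z) :=
    ⟨_, rfl⟩
  obtain ⟨h₂, hh₂⟩ : ∃ h₂ : FibHeap V, h₂ = { t₁.val with
      roots := []
      top := none
      height := 0 } := ⟨_, rfl⟩
  obtain ⟨t₃, ht₃⟩ : ∃ t₃, t₃ = forEach (fun h x => place h.cap h x) h₂ t₁.val.roots := ⟨_, rfl⟩
  obtain ⟨t₄, ht₄⟩ : ∃ t₄, t₄ = forEach collect t₃.val (List.range' 0 t₃.val.height) := ⟨_, rfl⟩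
  have e : h.popMin = ⟨(some z, t₄.val),
      (filterT (fun x => op (decide (x ≠ z))) h.roots).cost + (1 + (t₁.cost + (1 + (t₃.cost +
        t₄.cost))))⟩ := by
    have hv : (filterT (fun x => op (decide (x ≠ z))) h.roots).val = others := by
      rw [filterT_val, hoth]
      rfl
    simp only [popMin, ht]
    apply Timed.eq_of
    · simp only [Timed.bind_val, Timed.pure_val, op_val, rd_val, hv, ht₄, ht₃, hh₂, ht₁, ht,
        List.range_eq_range']
    · simp only [Timed.bind_val, Timed.bind_cost, Timed.pure_cost, op_val, rd_val, op_cost, rd_cost,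
        hv, ht₄, ht₃, hh₂, ht₁, ht, List.range_eq_range', add_zero]
  rw [← ht₁] at hrel hrelc
  have hup₂ : ∀ c, h₂.up c = if h.up c = some z then none else h.up c := by
    intro c
    rw [hh₂]
    refine (hrel.up c).trans ?_
    -- Child lists may contain obsolete entries but contain every actual child, so all children of
    -- `z` are released.
    by_cases h1 : h.up c = some z
    · simp [h1, hF.kids_mem c z h1]
    · simp [h1]
  have hup₂n : ∀ c, h₂.up c = none ↔ h.up c = some z ∨ h.up c = none := by
    intro c
    rw [hup₂]
    split_ifs with h1 <;> simp [h1]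
  have hkey₂ : h₂.key = h.key := by rw [hh₂]; exact hrel.key
  have hkids₂ : h₂.kids = h.kids := by rw [hh₂]; exact hrel.kids
  have hmark₂ : h₂.mark = h.mark := by rw [hh₂]; exact hrel.mark
  have hcap₂ : h₂.cap = h.cap := by rw [hh₂]; exact hrel.cap
  have hF₂ : Forest h₂ (S.erase z) fun _ => 0 :=
    hF.remove hzu hup₂ hkids₂ (by rw [hh₂]; exact hrel.rank) hmark₂
  have hroots₁ : ∀ x, x ∈ t₁.val.roots ↔ x ∈ S.erase z ∧ h₂.up x = none := by
    intro x
    rw [hrel.mem_roots, hup₂n, Finset.mem_erase]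
    change x ∈ others ∨ (x ∈ h.kids z ∧ h.up x = some z) ↔ _
    rw [hothm]
    constructor
    · rintro (⟨⟨h1, h2⟩, h3⟩ | ⟨-, h2⟩)
      · exact ⟨⟨h3, h1⟩, Or.inr h2⟩
      · exact ⟨⟨hF.ne h2, (hF.up_mem x z h2).1⟩, Or.inl h2⟩
    · rintro ⟨⟨h1, h2⟩, h3 | h3⟩
      · exact Or.inr ⟨hF.kids_mem x z h3, h3⟩
      · exact Or.inl ⟨⟨h2, h3⟩, h1⟩
  have hnd₁ : t₁.val.roots.Nodup := by
    refine hrel.nodup ?_ ?_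
    · change others.Nodup
      rw [hoth]
      exact hO.roots.1.filter _
    · intro c hc h1
      have h2 := ((hothm c).1 hc).1.2
      change h.up c = some z at h1
      rw [h1] at h2
      cases h2
  have hP : Placing h₂ (S.erase z) t₁.val.roots := by
    have hsl : ∀ i, h₂.slot i = none := by
      intro i
      rw [hh₂]
      change t₁.val.slot i = none
      rw [hrel.slot]
      exact hO.slot i
    refine ⟨hF₂, fun c q hc => ?_, fun i x hx => ?_, hnd₁, fun x hx => ?_, fun x hx hxu => ?_, ?_⟩
    · rw [hkey₂]
      rw [hup₂] at hc
      split_ifs at hc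
      exact hO.ordered c q hc
    · rw [hsl] at hx
      cases hx
    · exact (hroots₁ x).1 hx
    · exact Or.inl ((hroots₁ x).2 ⟨hx, hxu⟩)
    · rw [hh₂]
      exact Nat.zero_le _
  have hcard : (S.erase z).card < h₂.cap := by
    rw [hcap₂, Finset.card_erase_of_mem hz]
    have := Finset.card_pos.2 hS
    have := hO.card_le
    omega
  obtain ⟨h1, h2, h3⟩ := place_all_spec (le_refl 19) _ _ hP hcard
  rw [← ht₃] at h1 h2 h3
  have hroots₃ : t₃.val.roots = [] := by rw [h2.roots, hh₂]
  have htop₃ : t₃.val.top = none := by rw [h2.top, hh₂]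
  obtain ⟨h4, h5, h6, h7⟩ := collect_all_spec (S := S.erase z) t₃.val.height 0 t₃.val
    { slots := fun i x hx => by
        obtain ⟨h4, h5, -, h6⟩ := h1.slots i x hx
        exact ⟨h4, h5, by omega, by omega⟩
      roots := by simp [hroots₃]
      nodup := by simp [hroots₃]
      cover := fun x hx hxu => by
        rcases h1.cover x hx hxu with h4 | h4
        · simp at h4
        · exact Or.inr h4
      top := Or.inl ⟨htop₃, hroots₃⟩ }
  rw [← ht₄] at h4 h5 h6 h7
  rw [hroots₃, List.length_nil] at h6
  rw [e]
  have hslot₄ : ∀ i, t₄.val.slot i = none := by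
    intro i
    rcases hs : t₄.val.slot i with _ | x
    · rfl
    · have := h4.slots i x hs
      omega
  have hroots₄ : RootsOk t₄.val (S.erase z) := by
    refine ⟨h4.nodup, fun x => ⟨fun hx => (h4.roots x hx).1, fun hx => ?_⟩⟩
    rcases h4.cover x hx.1 hx.2 with h8 | h8
    · exact h8
    · rw [hslot₄] at h8
      cases h8
  have hF₄ : Forest t₄.val (S.erase z) fun _ => 0 := h1.forest.congr h5.up h5.kids h5.rank h5.mark
  have hO₄ : Ordered t₄.val := by
    intro c q hc
    rw [h5.key]
    rw [h5.up] at hc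
    exact h1.ordered c q hc
  refine ⟨z, hz, rfl, hmin, ⟨hF₄, hO₄, hroots₄, hslot₄, ?_, ?_⟩,
    h5.key.trans (h2.key.trans hkey₂), ?_⟩
  · simp only
    rw [h5.cap, h2.cap]
    exact hcard.le
  · rcases h4.top with ⟨h8, h9⟩ | ⟨y, h8, h9, h10⟩
    · refine Or.inl ⟨h8, ?_⟩
      by_contra hne
      obtain ⟨x, hx⟩ := Finset.nonempty_iff_ne_empty.2 hne
      obtain ⟨r, hr, hru, -⟩ := hF₄.exists_root_le hO₄ hx
      have := (hroots₄.2 r).2 ⟨hr, hru⟩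
      rw [h9] at this
      simp at this
    · obtain ⟨hy, hyu⟩ := (hroots₄.2 y).1 h8
      refine Or.inr ⟨y, hy, h9, hyu, fun x hx => ?_⟩
      obtain ⟨r, hr, hru, hrx⟩ := hF₄.exists_root_le hO₄ hx
      exact (h10 r ((hroots₄.2 r).2 ⟨hr, hru⟩)).trans hrx
  · have hrank := hF.rank_le hz hzu
    have hmono := rankBound_mono (Finset.card_le_card (Finset.erase_subset z S))
    have hheight := h1.height_le
    have hlen₁ : t₁.val.roots.length = (h₂.rootSet (S.erase z)).card := by
      rw [← List.toFinset_card_of_nodup hnd₁]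
      congr 1
      ext x
      rw [List.mem_toFinset, hroots₁, rootSet, Finset.mem_filter]
    -- The root `z` is lost, and its children, of which there are `rank z`, are gained.
    have hlen₁' : t₁.val.roots.length + 1 ≤ h.roots.length + rankBound S.card := by
      have h8 : h₂.rootSet (S.erase z) ⊆ (h.rootSet S).erase z ∪ h.children S z := by
        intro x hx
        obtain ⟨h8, h9⟩ := Finset.mem_filter.1 hx
        obtain ⟨h10, h11⟩ := Finset.mem_erase.1 h8
        rw [Finset.mem_union]
        rcases (hup₂n x).1 h9 with h12 | h12
        · exact Or.inr (Finset.mem_filter.2 ⟨h11, h12⟩)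
        · exact Or.inl (Finset.mem_erase.2 ⟨h10, Finset.mem_filter.2 ⟨h11, h12⟩⟩)
      have h9 := (Finset.card_le_card h8).trans (Finset.card_union_le _ _)
      have h10 := Finset.card_erase_add_one
        (show z ∈ h.rootSet S from Finset.mem_filter.2 ⟨hz, hzu⟩)
      rw [← hF.rank_eq z hz] at h9
      rw [hlen₁, hO.roots.length_eq]
      omega
    have hp₂ : pot 19 h₂ (S.erase z) + 5 * (h.kids z).length
        ≤ 19 * t₁.val.roots.length + 34 * (h.markSet S).card + 5 * ∑ x ∈ S, (h.kids x).length := by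
      have h8 : (h₂.markSet (S.erase z)).card ≤ (h.markSet S).card := by
        refine Finset.card_le_card ?_
        rw [markSet, hmark₂]
        exact Finset.filter_subset_filter _ (Finset.erase_subset _ _)
      have h9 := Finset.sum_erase_add S (fun x => (h.kids x).length) hz
      rw [pot, hkids₂, hlen₁]
      omega
    -- Merging is accounted with weight 19 per root; the missing 7 are paid afterwards, when at most
    -- one root per bin is left.
    have hp₄ : pot 26 t₄.val (S.erase z)
        = pot 19 t₃.val (S.erase z) + 7 * t₄.val.roots.length := by
      rw [pot_congr (h := t₃.val) 26 h5.up h5.kids h5.mark, hroots₄.length_eq, pot, pot, rootSet,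
        rootSet, h5.up]
      ring
    have hp : pot 26 h S = 26 * h.roots.length + 34 * (h.markSet S).card
        + 5 * ∑ x ∈ S, (h.kids x).length := by
      rw [pot, hO.roots.length_eq]
    simp only
    rw [hp₄, hp]
    omega

end FibHeap

/-! ### Dijkstra's algorithm: the main loop -/

section Dijkstra

variable {V : Type} [DecidableEq V]

/-- `g` encodes the graph `H`, all of whose edges are between vertices in the vertex array. -/
structure GraphData.Encodes (g : GraphData V) (H : SimpleGraph V) (len : Sym2 V → ℝ) : Prop where
  verts_nodup : g.verts.Nodup
  left_mem : ∀ x y, H.Adj x y → x ∈ g.verts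
  adj_nodup : ∀ x ∈ g.verts, (g.adj x).Nodup
  mem_adj : ∀ x ∈ g.verts, ∀ (y : V) (a : ℝ), (y, a) ∈ g.adj x ↔ H.Adj x y ∧ a = len s(x, y)
  mem_edges : ∀ x y, H.Adj x y ↔ (x, y) ∈ g.edges ∨ (y, x) ∈ g.edges
  len_pos : ∀ x y, H.Adj x y → 0 < len s(x, y)

variable {g : GraphData V} {H : SimpleGraph V} {len : Sym2 V → ℝ}

theorem GraphData.Encodes.right_mem (hg : g.Encodes H len) {x y : V} (h : H.Adj x y) :
    y ∈ g.verts := hg.left_mem y x h.symm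

/-- Adjacency entries inject into oriented edges, because the length in an entry is determined by
its ends; each cell of the edge array accounts for at most two orientations. -/
theorem GraphData.Encodes.sum_length_adj_le (hg : g.Encodes H len) :
    ∑ x ∈ g.verts.toFinset, (g.adj x).length ≤ 2 * g.edges.length := by
  have h1 : ∀ x ∈ g.verts.toFinset,
      (g.adj x).length = ((g.adj x).map Prod.fst).toFinset.card := by
    intro x hx
    rw [List.mem_toFinset] at hx
    rw [List.toFinset_card_of_nodup, List.length_map]
    refine (hg.adj_nodup x hx).map_on ?_
    rintro ⟨y, a⟩ hy ⟨y', a'⟩ hy' h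
    simp only at h
    subst h
    rw [((hg.mem_adj x hx _ _).1 hy).2, ((hg.mem_adj x hx _ _).1 hy').2]
  rw [Finset.sum_congr rfl h1, ← Finset.card_sigma]
  have h2 : (g.edges ++ g.edges.map Prod.swap).toFinset.card ≤ 2 * g.edges.length := by
    refine (List.toFinset_card_le _).trans ?_
    rw [List.length_append, List.length_map]
    omega
  refine le_trans (Finset.card_le_card_of_injOn (fun p => (p.1, p.2)) ?_ ?_) h2
  · rintro ⟨x, y⟩ hp
    simp only [Finset.coe_sigma, Set.mem_sigma_iff, Finset.mem_coe, List.mem_toFinset, List.mem_map,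
      Prod.exists] at hp
    obtain ⟨hx, y', a, ha, rfl⟩ := hp
    have := (hg.mem_edges x y').1 ((hg.mem_adj x hx y' a).1 ha).1
    simp only [Finset.mem_coe, List.mem_toFinset, List.mem_append, List.mem_map, Prod.exists]
    rcases this with h | h
    · exact Or.inl h
    · exact Or.inr ⟨_, _, h, rfl⟩
  · rintro ⟨x, y⟩ - ⟨x', y'⟩ - h
    simp only [Prod.mk.injEq] at h
    obtain ⟨rfl, rfl⟩ := h
    rfl

/-- The invariant of the main loop: `S` is the set of the vertices in the heap.  The edges from
`x` to `y` with `ex x y` need not have been looked at. -/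
structure Search.Inv (g : GraphData V) (H : SimpleGraph V) (len : Sym2 V → ℝ) (v : V → Option ℝ)
    (α : ℝ) (s : Search V) (S : Finset V) (ex : V → V → Prop) : Prop where
  ok : s.heap.Ok S
  sub : ∀ x ∈ S, x ∈ g.verts
  finished : ∀ x ∈ g.verts, (s.finished x = true ↔ x ∉ S)
  value : ∀ x ∈ g.verts, x ∉ S → s.value x = s.heap.key x
  mono : ∀ x ∈ g.verts, x ∉ S → ∀ y ∈ S, s.heap.key x ≤ s.heap.key y
  edge : ∀ x y, x ∉ S → H.Adj x y →
    ex x y ∨ s.heap.key y ≤ s.heap.key x + ((α * len s(x, y) : ℝ) : WithTop ℝ)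
  term : ∀ x ∈ g.verts, ∀ a, v x = some a → s.heap.key x ≤ (a : WithTop ℝ)
  walk : ∀ x ∈ g.verts, ∀ a : ℝ, s.heap.key x = (a : WithTop ℝ) →
    ∃ t ∈ g.verts, ∃ b, v t = some b ∧ ∃ w : H.Walk t x, a = b + α * pathLength len w
  parent : ∀ x ∈ g.verts, ∀ a : ℝ, s.heap.key x = (a : WithTop ℝ) →
    (s.parent x = none ∧ v x = some a) ∨
      ∃ z, s.parent x = some z ∧ z ∉ S ∧ H.Adj z x ∧
        ∃ b : ℝ, s.heap.key z = (b : WithTop ℝ) ∧ a = b + α * len s(z, x)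

theorem pathLength_concat {s t u : V} (w : H.Walk s t) (h : H.Adj t u) :
    pathLength len (w.concat h) = pathLength len w + len s(t, u) := by
  simp [pathLength, SimpleGraph.Walk.edges_concat]

/-- The bound 86 is that of a key decrease, 80, plus 6 further steps. Only finished vertices serve
as parents and their keys no longer change, so the equations between the keys of parent and child
persist. -/
theorem Search.relax_spec (hg : g.Encodes H len) {v : V → Option ℝ} {α : ℝ} (hα : 0 ≤ α)
    {s : Search V} {S : Finset V} {x : V} {rest : List (V × ℝ)} {e : V × ℝ} (hxg : x ∈ g.verts)
    (hx : x ∉ S) (he : e ∈ g.adj x)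
    (hmax : ∀ y ∈ g.verts, y ∉ S → s.heap.key y ≤ s.heap.key x)
    (hI : s.Inv g H len v α S fun x' y => x' = x ∧ (y, len s(x, y)) ∈ e :: rest) :
    (Search.relax α x (s.heap.key x) s e).val.Inv g H len v α S
        (fun x' y => x' = x ∧ (y, len s(x, y)) ∈ rest) ∧
      (∀ y, y ∉ S → (Search.relax α x (s.heap.key x) s e).val.heap.key y = s.heap.key y) ∧
      (Search.relax α x (s.heap.key x) s e).cost
          + (Search.relax α x (s.heap.key x) s e).val.heap.pot 26 S
        ≤ s.heap.pot 26 S + 86 := by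
  obtain ⟨y, a⟩ := e
  obtain ⟨hxy, rfl⟩ := (hg.mem_adj x hxg y a).1 he
  have hy := hg.right_mem hxy
  have hlen := hg.len_pos x y hxy
  have hc : (0 : WithTop ℝ) ≤ ((α * len s(x, y) : ℝ) : WithTop ℝ) := by
    exact_mod_cast mul_nonneg hα hlen.le
  have hle : s.heap.key x ≤ s.heap.key x + ((α * len s(x, y) : ℝ) : WithTop ℝ) :=
    le_add_of_nonneg_right hc
  have hdone : s.heap.key y ≤ s.heap.key x + ((α * len s(x, y) : ℝ) : WithTop ℝ) →
      s.Inv g H len v α S fun x' y => x' = x ∧ (y, len s(x, y)) ∈ rest := by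
    intro h
    refine { hI with edge := fun x' y' hx' h' => ?_ }
    rcases hI.edge x' y' hx' h' with ⟨rfl, h1⟩ | h1
    · rcases List.mem_cons.1 h1 with h2 | h2
      · simp only [Prod.mk.injEq] at h2
        obtain ⟨rfl, -⟩ := h2
        exact Or.inr h
      · exact Or.inl ⟨rfl, h2⟩
    · exact Or.inr h1
  cases hf : s.finished y with
  | true =>
    have e : Search.relax α x (s.heap.key x) s (y, len s(x, y)) = ⟨s, 1⟩ := by
      apply Timed.eq_of <;> simp [Search.relax, hf]
    rw [e]
    -- A finished `y` has a key at most that of `x`, and lengths and `α` are nonnegative, so the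
    -- edge inequality already holds.
    refine ⟨hdone ((hmax y hy ((hI.finished y hy).1 hf)).trans hle), fun _ _ => rfl, ?_⟩
    simp only
    omega
  | false =>
    have hyS : y ∈ S := by
      by_contra h
      rw [(hI.finished y hy).2 h] at hf
      cases hf
    by_cases hk : s.heap.key x + ((α * len s(x, y) : ℝ) : WithTop ℝ) < s.heap.key y
    · obtain ⟨h1, h2, h3⟩ := FibHeap.decreaseKey_spec hI.ok hyS hk.le
      obtain ⟨t, ht⟩ : ∃ t, t = s.heap.decreaseKey y
          (s.heap.key x + ((α * len s(x, y) : ℝ) : WithTop ℝ)) := ⟨_, rfl⟩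
      rw [← ht] at h1 h2 h3
      have e : Search.relax α x (s.heap.key x) s (y, len s(x, y)) = ⟨{ s with
          heap := t.val
          parent := Function.update s.parent y (some x) }, 6 + t.cost⟩ := by
        have hk' := hk
        rw [WithTop.coe_mul] at hk'
        apply Timed.eq_of
        · simp [Search.relax, hf, hk, hk', ht]
        · simp [Search.relax, hf, hk, hk', ht]; omega
      rw [e]
      have hne : ∀ z, z ∉ S → z ≠ y := fun z hz => (ne_of_mem_of_not_mem hyS hz).symm
      have hkz : ∀ z, z ∉ S → t.val.key z = s.heap.key z := by
        intro z hz
        rw [h2, Function.update_of_ne (hne z hz)]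
      have hkle : ∀ z, t.val.key z ≤ s.heap.key z := by
        intro z
        rw [h2, Function.update_apply]
        split_ifs with hz
        · rw [hz]; exact hk.le
        · exact le_rfl
      refine ⟨⟨h1, hI.sub, hI.finished, ?_, ?_, ?_, ?_, ?_, ?_⟩, hkz, ?_⟩
      · intro z hzg hz
        simp only
        rw [hkz z hz]
        exact hI.value z hzg hz
      · intro z hzg hz u hu
        simp only
        rw [hkz z hz, h2, Function.update_apply]
        split_ifs
        · exact (hmax z hzg hz).trans hle
        · exact hI.mono z hzg hz u hu
      · intro x' y' hx' h'
        simp only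
        rw [hkz x' hx']
        rcases hI.edge x' y' hx' h' with ⟨rfl, h4⟩ | h4
        · rcases List.mem_cons.1 h4 with h5 | h5
          · simp only [Prod.mk.injEq] at h5
            obtain ⟨rfl, -⟩ := h5
            right
            rw [h2, Function.update_self]
          · exact Or.inl ⟨rfl, h5⟩
        · exact Or.inr ((hkle y').trans h4)
      · intro z hz a ha
        exact (hkle z).trans (hI.term z hz a ha)
      · intro z hz a ha
        simp only at ha
        rw [h2, Function.update_apply] at ha
        split_ifs at ha with hzy
        · subst hzy
          cases hkx : s.heap.key x with
          | top => rw [hkx] at ha; simp at ha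
          | coe b =>
            rw [hkx, ← WithTop.coe_add, WithTop.coe_inj] at ha
            obtain ⟨t, htg, c, hc, w, hw⟩ := hI.walk x hxg b hkx
            refine ⟨t, htg, c, hc, w.concat hxy, ?_⟩
            rw [pathLength_concat, ← ha, hw]
            ring
        · exact hI.walk z hz a ha
      · intro z hz a ha
        simp only at ha ⊢
        rw [h2, Function.update_apply] at ha
        split_ifs at ha with hzy
        · subst hzy
          right
          refine ⟨x, by simp, hx, hxy, ?_⟩
          rw [hkz x hx]
          cases hkx : s.heap.key x with
          | top => rw [hkx] at ha; simp at ha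
          | coe b =>
            rw [hkx, ← WithTop.coe_add, WithTop.coe_inj] at ha
            exact ⟨b, rfl, ha.symm⟩
        · rw [Function.update_of_ne hzy]
          rcases hI.parent z hz a ha with h4 | ⟨u, h4, h5, h6, h7⟩
          · exact Or.inl h4
          · refine Or.inr ⟨u, h4, h5, h6, ?_⟩
            rw [hkz u h5]
            exact h7
      · simp only
        omega
    · have e : Search.relax α x (s.heap.key x) s (y, len s(x, y)) = ⟨s, 5⟩ := by
        have hk' := hk
        rw [WithTop.coe_mul] at hk'
        apply Timed.eq_of <;> simp [Search.relax, hf, hk, hk']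
      rw [e]
      refine ⟨hdone (not_lt.1 hk), fun _ _ => rfl, ?_⟩
      simp only
      omega

theorem Search.relax_all_spec (hg : g.Encodes H len) {v : V → Option ℝ} {α : ℝ} (hα : 0 ≤ α)
    {S : Finset V} {x : V} (hxg : x ∈ g.verts) (hx : x ∉ S) {k : WithTop ℝ} :
    ∀ (rest : List (V × ℝ)) (s : Search V), (∀ e ∈ rest, e ∈ g.adj x) → s.heap.key x = k →
    (∀ y ∈ g.verts, y ∉ S → s.heap.key y ≤ k) →
    s.Inv g H len v α S (fun x' y => x' = x ∧ (y, len s(x, y)) ∈ rest) →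
    (forEach (Search.relax α x k) s rest).val.Inv g H len v α S (fun _ _ => False) ∧
      (forEach (Search.relax α x k) s rest).cost
          + (forEach (Search.relax α x k) s rest).val.heap.pot 26 S
        ≤ s.heap.pot 26 S + 87 * rest.length := by
  intro rest
  induction rest with
  | nil =>
    intro s _ _ _ hI
    refine ⟨{ hI with edge := fun x' y' hx' h' => ?_ }, by simp⟩
    rcases hI.edge x' y' hx' h' with ⟨-, h1⟩ | h1
    · simp at h1
    · exact Or.inr h1
  | cons e rest ih =>
    intro s hadj hk hmax hI
    subst hk
    obtain ⟨h1, h2, h3⟩ := Search.relax_spec hg hα hxg hx (hadj e (by simp)) hmax hI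
    obtain ⟨h4, h5⟩ := ih _ (fun e' he' => hadj e' (by simp [he'])) (h2 x hx)
      (fun y hy hyS => by rw [h2 y hyS]; exact hmax y hy hyS) h1
    rw [forEach_cons_val, forEach_cons_cost, List.length_cons]
    exact ⟨h4, by omega⟩

/-- The popped vertex has the least key in the heap and, by `mono`, the largest key among the
finished vertices. All its edges are put on the exception list, which the scan of its adjacency list
then clears. -/
theorem Search.visit_spec (hg : g.Encodes H len) {v : V → Option ℝ} {α : ℝ} (hα : 0 ≤ α)
    {s : Search V} {S : Finset V} (hS : S.Nonempty)
    (hI : s.Inv g H len v α S fun _ _ => False) :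
    ∃ z ∈ S, (Search.visit g α s).val.Inv g H len v α (S.erase z) (fun _ _ => False) ∧
      (Search.visit g α s).cost + (Search.visit g α s).val.heap.pot 26 (S.erase z)
        ≤ s.heap.pot 26 S + 40 * (FibHeap.rankBound S.card + 1) + 4 + 87 * (g.adj z).length := by
  obtain ⟨z, hz, h1, hmin, h2, h3, h4⟩ := FibHeap.popMin_spec hI.ok hS
  obtain ⟨t, ht⟩ : ∃ t, t = s.heap.popMin := ⟨_, rfl⟩
  rw [← ht] at h1 h2 h3 h4
  have hzg := hI.sub z hz
  obtain ⟨s', hs'⟩ : ∃ s' : Search V, s' = { s with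
      heap := t.val.2
      finished := Function.update s.finished z true
      value := Function.update s.value z (s.heap.key z) } := ⟨_, rfl⟩
  have hk' : ∀ x, s'.heap.key x = s.heap.key x := fun x => by rw [hs', ← h3]
  have hmem : ∀ x, x ∉ S.erase z → x = z ∨ x ∉ S := by
    intro x hx
    rw [Finset.mem_erase, not_and_or, not_not] at hx
    exact hx
  have hmax : ∀ y ∈ g.verts, y ∉ S.erase z → s.heap.key y ≤ s.heap.key z := by
    intro y hy hyS
    rcases hmem y hyS with rfl | h5
    · exact le_rfl
    · exact hI.mono y hy h5 z hz
  have hI' : s'.Inv g H len v α (S.erase z) fun x' y => x' = z ∧ (y, len s(z, y)) ∈ g.adj z := by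
    refine ⟨?_, fun x hx => hI.sub x (Finset.mem_of_mem_erase hx), ?_, ?_, ?_, ?_, ?_, ?_, ?_⟩
    · rw [hs']; exact h2
    · intro x hx
      rw [hs', Finset.mem_erase]
      simp only [Function.update_apply]
      split_ifs with h5
      · simp [h5]
      · rw [hI.finished x hx]
        simp [h5]
    · intro x hx hxS
      rw [hk', hs']
      simp only [Function.update_apply]
      split_ifs with h5
      · rw [h5]
      · exact hI.value x hx ((hmem x hxS).resolve_left h5)
    · intro x hx hxS y hy
      rw [hk', hk']
      exact (hmax x hx hxS).trans (hmin y (Finset.mem_of_mem_erase hy))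
    · intro x y hx hxy
      rcases hmem x hx with rfl | h5
      · exact Or.inl ⟨rfl, (hg.mem_adj x hzg y _).2 ⟨hxy, rfl⟩⟩
      · rcases hI.edge x y h5 hxy with h6 | h6
        · exact h6.elim
        · right
          rw [hk', hk']
          exact h6
    · intro x hx a ha
      rw [hk']
      exact hI.term x hx a ha
    · intro x hx a ha
      rw [hk'] at ha
      exact hI.walk x hx a ha
    · intro x hx a ha
      rw [hk'] at ha
      rcases hI.parent x hx a ha with h5 | ⟨u, h5, h6, h7, b, h8, h9⟩
      · left
        rw [hs']
        exact h5
      · refine Or.inr ⟨u, ?_, fun h => h6 (Finset.mem_of_mem_erase h), h7, b, ?_, h9⟩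
        · rw [hs']; exact h5
        · rw [hk']; exact h8
  obtain ⟨h5, h6⟩ := Search.relax_all_spec hg hα hzg (Finset.notMem_erase z S) (g.adj z) s'
    (fun _ h => h) rfl (fun y hy hyS => by rw [hk', hk']; exact hmax y hy hyS) hI'
  have e : Search.visit g α s = ⟨(forEach (Search.relax α z (s'.heap.key z)) s' (g.adj z)).val,
      t.cost + (4 + (forEach (Search.relax α z (s'.heap.key z)) s' (g.adj z)).cost)⟩ := by
    rw [ht] at h1
    rw [hk']
    apply Timed.eq_of
    · simp only [Search.visit, Timed.bind_val, h1, rd_val, wr_val, hs', ht, ← h3]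
    · simp only [Search.visit, Timed.bind_cost, h1, rd_val, wr_val, hs', ht, ← h3, rd_cost, wr_cost]
      omega
  refine ⟨z, hz, ?_⟩
  rw [e]
  refine ⟨h5, ?_⟩
  have h7 : s'.heap = t.val.2 := by rw [hs']
  rw [h7] at h6
  simp only
  rw [h7]
  omega

end Dijkstra

/-! ### Dijkstra's algorithm: setting up the heap and the complete run -/

section Dijkstra

variable {V : Type} [DecidableEq V] {g : GraphData V} {H : SimpleGraph V} {len : Sym2 V → ℝ}

/-- The starting key of a vertex. -/
noncomputable def seedKey (v : V → Option ℝ) (x : V) : WithTop ℝ :=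
  (v x).elim ⊤ fun a => (a : WithTop ℝ)

/-- The state while the heap is set up: all vertices of `S` are in the heap. -/
structure Search.Starting (s : Search V) (S : Finset V) (key : V → WithTop ℝ) : Prop where
  ok : s.heap.Ok S
  key : ∀ x ∈ S, s.heap.key x = key x
  finished : ∀ x ∈ S, s.finished x = false
  parent : ∀ x ∈ S, s.parent x = none

theorem Search.addVertex_spec {s : Search V} {S : Finset V} (hs : s.Starting S fun _ => ⊤) {x : V}
    (hx : x ∉ S) : (s.addVertex x).val.Starting (insert x S) (fun _ => ⊤) ∧
      (s.addVertex x).cost + (s.addVertex x).val.heap.pot 26 (insert x S)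
        ≤ s.heap.pot 26 S + 42 := by
  obtain ⟨h1, h2, h3⟩ := FibHeap.insert_spec hs.ok hx ⊤
  have hh : (s.addVertex x).val.heap = (s.heap.insert x ⊤).val := rfl
  have hf : (s.addVertex x).val.finished = Function.update s.finished x false := rfl
  have hp : (s.addVertex x).val.parent = Function.update s.parent x none := rfl
  have hc : (s.addVertex x).cost = (s.heap.insert x ⊤).cost + 2 := rfl
  have hins : ∀ y ∈ insert x S, y ≠ x → y ∈ S := fun y hy hyx =>
    Finset.mem_of_mem_insert_of_ne hy hyx
  refine ⟨⟨by rw [hh]; exact h1, fun y hy => ?_, fun y hy => ?_, fun y hy => ?_⟩, ?_⟩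
  · rw [hh, h2, Function.update_apply]
    split_ifs with h
    · rfl
    · exact hs.key y (hins y hy h)
  · rw [hf, Function.update_apply]
    split_ifs with h
    · rfl
    · exact hs.finished y (hins y hy h)
  · rw [hp, Function.update_apply]
    split_ifs with h
    · rfl
    · exact hs.parent y (hins y hy h)
  · rw [hc, hh]
    omega

theorem Search.addVertex_all_spec : ∀ (l : List V) (s : Search V) (S : Finset V),
    s.Starting S (fun _ => ⊤) → l.Nodup → (∀ x ∈ l, x ∉ S) →
    (forEach Search.addVertex s l).val.Starting (S ∪ l.toFinset) (fun _ => ⊤) ∧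
      (forEach Search.addVertex s l).cost
          + (forEach Search.addVertex s l).val.heap.pot 26 (S ∪ l.toFinset)
        ≤ s.heap.pot 26 S + 43 * l.length := by
  intro l
  induction l with
  | nil => intro s S hs _ _; simpa using hs
  | cons x l ih =>
    intro s S hs hnd hl
    obtain ⟨hx, hnd⟩ := List.nodup_cons.1 hnd
    obtain ⟨h1, h2⟩ := Search.addVertex_spec hs (hl x (by simp))
    obtain ⟨h3, h4⟩ := ih _ _ h1 hnd (fun y hy hyS => by
      rcases Finset.mem_insert.1 hyS with rfl | h
      · exact hx hy
      · exact hl y (by simp [hy]) h)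
    have e : insert x S ∪ l.toFinset = S ∪ (x :: l).toFinset := by
      ext y
      simp only [Finset.mem_union, Finset.mem_insert, List.toFinset_cons]
      tauto
    rw [e] at h3 h4
    rw [forEach_cons_val, forEach_cons_cost, List.length_cons]
    exact ⟨h3, by omega⟩

theorem Search.seed_spec {v : V → Option ℝ} {s : Search V} {S : Finset V} {k : V → WithTop ℝ}
    (hs : s.Starting S k) {x : V} (hx : x ∈ S) (hk : k x = ⊤) :
    (s.seed v x).val.Starting S (Function.update k x (seedKey v x)) ∧
      (s.seed v x).cost + (s.seed v x).val.heap.pot 26 S ≤ s.heap.pot 26 S + 81 := by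
  cases hv : v x with
  | none =>
    have e : s.seed v x = ⟨s, 1⟩ := by
      apply Timed.eq_of <;> simp [Search.seed, hv]
    rw [e]
    refine ⟨⟨hs.ok, fun y hy => ?_, hs.finished, hs.parent⟩, by simp only; omega⟩
    rw [Function.update_apply]
    split_ifs with h
    · rw [h, hs.key x hx, hk]
      simp [seedKey, hv]
    · exact hs.key y hy
  | some a =>
    obtain ⟨h1, h2, h3⟩ := FibHeap.decreaseKey_spec (k := (a : WithTop ℝ)) hs.ok hx
      (by rw [hs.key x hx, hk]; exact le_top)
    have e : s.seed v x = ⟨{ s with heap := (s.heap.decreaseKey x (a : WithTop ℝ)).val },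
        1 + (s.heap.decreaseKey x (a : WithTop ℝ)).cost⟩ := by
      apply Timed.eq_of <;> simp [Search.seed, hv]
    rw [e]
    refine ⟨⟨h1, fun y hy => ?_, hs.finished, hs.parent⟩, by simp only; omega⟩
    simp only
    rw [h2, Function.update_apply, Function.update_apply]
    split_ifs with h
    · simp [seedKey, hv]
    · exact hs.key y hy

theorem Search.seed_all_spec {v : V → Option ℝ} {S : Finset V} : ∀ (l : List V) (s : Search V)
    (k : V → WithTop ℝ), s.Starting S k → l.Nodup → (∀ x ∈ l, x ∈ S ∧ k x = ⊤) →
    (forEach (Search.seed v) s l).val.Starting S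
        (fun x => if x ∈ l then seedKey v x else k x) ∧
      (forEach (Search.seed v) s l).cost + (forEach (Search.seed v) s l).val.heap.pot 26 S
        ≤ s.heap.pot 26 S + 82 * l.length := by
  intro l
  induction l with
  | nil => intro s k hs _ _; simpa using hs
  | cons x l ih =>
    intro s k hs hnd hl
    obtain ⟨hx, hnd⟩ := List.nodup_cons.1 hnd
    obtain ⟨h1, h2⟩ := Search.seed_spec (v := v) hs (hl x (by simp)).1 (hl x (by simp)).2
    obtain ⟨h3, h4⟩ := ih _ _ h1 hnd (fun y hy => by
      rw [Function.update_of_ne (ne_of_mem_of_not_mem hy hx)]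
      exact hl y (by simp [hy]))
    rw [forEach_cons_val, forEach_cons_cost, List.length_cons]
    refine ⟨?_, by omega⟩
    convert h3 using 1
    ext y
    by_cases hyx : y = x
    · simp [hyx, hx]
    · simp [hyx]

theorem Search.Starting.inv {v : V → Option ℝ} {s : Search V} (α : ℝ)
    (hs : s.Starting g.verts.toFinset (seedKey v)) (hH : ∀ x y, H.Adj x y → x ∈ g.verts) :
    s.Inv g H len v α g.verts.toFinset fun _ _ => False := by
  have hv : ∀ x (a : ℝ), seedKey v x = (a : WithTop ℝ) → v x = some a := by
    intro x a h
    cases hv : v x with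
    | none => simp [seedKey, hv] at h
    | some b =>
      simp only [seedKey, hv, Option.elim_some, WithTop.coe_inj] at h
      rw [h]
  have hk : ∀ x ∈ g.verts, s.heap.key x = seedKey v x := fun x hx =>
    hs.key x (List.mem_toFinset.2 hx)
  refine ⟨hs.ok, fun x hx => List.mem_toFinset.1 hx, fun x hx => ?_, fun x hx h => ?_,
    fun x hx h => ?_, fun x y h hxy => ?_, fun x hx a ha => ?_, fun x hx a ha => ?_,
    fun x hx a ha => ?_⟩
  · simp [hs.finished x (List.mem_toFinset.2 hx), hx]
  · exact absurd (List.mem_toFinset.2 hx) h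
  · exact absurd (List.mem_toFinset.2 hx) h
  · exact absurd (List.mem_toFinset.2 (hH x y hxy)) h
  · rw [hk x hx, seedKey, ha]
    exact le_rfl
  · rw [hk x hx] at ha
    exact ⟨x, hx, a, hv x a ha, SimpleGraph.Walk.nil, by simp [pathLength]⟩
  · rw [hk x hx] at ha
    exact Or.inl ⟨hs.parent x (List.mem_toFinset.2 hx), hv x a ha⟩

/-- The rank bound of the full heap serves for all later rounds, and each adjacency list is scanned
once, when its vertex is popped. -/
theorem Search.visit_all_spec {β : Type} (hg : g.Encodes H len) {v : V → Option ℝ} {α : ℝ}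
    (hα : 0 ≤ α) : ∀ (l : List β) (s : Search V) (S : Finset V), S.card = l.length →
    s.Inv g H len v α S (fun _ _ => False) →
    (forEach (fun s _ => Search.visit g α s) s l).val.Inv g H len v α ∅ (fun _ _ => False) ∧
      (forEach (fun s _ => Search.visit g α s) s l).cost
        ≤ s.heap.pot 26 S + (40 * (FibHeap.rankBound S.card + 1) + 5) * l.length
          + 87 * ∑ x ∈ S, (g.adj x).length := by
  intro l
  induction l with
  | nil =>
    intro s S hS hI
    rw [List.length_nil, Finset.card_eq_zero] at hS
    subst hS
    exact ⟨hI, Nat.zero_le _⟩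
  | cons b l ih =>
    intro s S hS hI
    rw [List.length_cons] at hS
    obtain ⟨z, hz, h1, h2⟩ := Search.visit_spec hg hα (Finset.card_pos.1 (by omega)) hI
    have hc : (S.erase z).card = l.length := by
      rw [Finset.card_erase_of_mem hz]
      omega
    obtain ⟨h3, h4⟩ := ih _ _ hc h1
    have h5 := Finset.add_sum_erase S (fun x => (g.adj x).length) hz
    have h6 := FibHeap.rankBound_mono (Finset.card_le_card (Finset.erase_subset z S))
    have h7 : (40 * (FibHeap.rankBound (S.erase z).card + 1) + 5) * l.length
        ≤ (40 * (FibHeap.rankBound S.card + 1) + 5) * l.length := by gcongr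
    rw [forEach_cons_val, forEach_cons_cost, List.length_cons]
    refine ⟨h3, ?_⟩
    rw [mul_add, mul_one]
    omega

/-- What ModDijkstra computes. -/
structure DijkstraSpec (g : GraphData V) (H : SimpleGraph V) (len : Sym2 V → ℝ)
    (v : V → Option ℝ) (α : ℝ) (r : (V → WithTop ℝ) × (V → Option V)) : Prop where
  edge : ∀ x y, H.Adj x y → r.1 y ≤ r.1 x + ((α * len s(x, y) : ℝ) : WithTop ℝ)
  term : ∀ x ∈ g.verts, ∀ a, v x = some a → r.1 x ≤ (a : WithTop ℝ)
  walk : ∀ x ∈ g.verts, ∀ a : ℝ, r.1 x = (a : WithTop ℝ) →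
    ∃ t ∈ g.verts, ∃ b, v t = some b ∧ ∃ w : H.Walk t x, a = b + α * pathLength len w
  parent : ∀ x ∈ g.verts, ∀ a : ℝ, r.1 x = (a : WithTop ℝ) → (r.2 x = none ∧ v x = some a) ∨
    ∃ z, r.2 x = some z ∧ H.Adj z x ∧
      ∃ b : ℝ, r.1 z = (b : WithTop ℝ) ∧ a = b + α * len s(z, x)

/-- The cost of a single run of ModDijkstra, up to a constant. -/
def graphSize (N : ℕ) (g : GraphData V) : ℕ :=
  g.edges.length + g.verts.length * (Nat.log 2 N + 1)

/-- The logarithm is taken of a free bound `N` on the number of vertices, so that one logarithm can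
be used throughout the recursion. The factor `α = 0` is allowed, as only `0 ≤ α * len` matters here.
-/
theorem modDijkstra_spec (hg : g.Encodes H len) (v : V → Option ℝ) {α : ℝ} (hα : 0 ≤ α) {N : ℕ}
    (hN : g.verts.length ≤ N) :
    DijkstraSpec g H len v α (modDijkstra g v α).val ∧
      (modDijkstra g v α).cost ≤ 400 * graphSize N g := by
  obtain ⟨s₀, hs₀⟩ : ∃ s₀ : Search V, s₀ = { 
      heap := FibHeap.empty
      finished := fun _ => false
      value := fun _ => ⊤
      parent := fun _ => none } := ⟨_, rfl⟩
  have hp₀ : s₀.heap.pot 26 ∅ = 0 := by simp [FibHeap.pot, FibHeap.rootSet, FibHeap.markSet]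
  have h0 : s₀.Starting ∅ fun _ => ⊤ := by
    refine ⟨?_, by simp, by simp, by simp⟩
    rw [hs₀]
    exact FibHeap.ok_empty
  obtain ⟨h1, h2⟩ := Search.addVertex_all_spec g.verts s₀ ∅ h0 hg.verts_nodup (by simp)
  rw [Finset.empty_union] at h1 h2
  obtain ⟨s₁, hs₁⟩ : ∃ s₁, s₁ = forEach Search.addVertex s₀ g.verts := ⟨_, rfl⟩
  rw [← hs₁] at h1 h2
  obtain ⟨h3, h4⟩ := Search.seed_all_spec (v := v) g.verts s₁.val _ h1 hg.verts_nodup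
    (fun x hx => ⟨List.mem_toFinset.2 hx, rfl⟩)
  obtain ⟨s₂, hs₂⟩ : ∃ s₂, s₂ = forEach (Search.seed v) s₁.val g.verts := ⟨_, rfl⟩
  rw [← hs₂] at h3 h4
  have h3' : s₂.val.Starting g.verts.toFinset (seedKey v) :=
    { h3 with key := fun x hx => by rw [h3.key x hx, if_pos (List.mem_toFinset.1 hx)] }
  have hcard : g.verts.toFinset.card = g.verts.length :=
    List.toFinset_card_of_nodup hg.verts_nodup
  obtain ⟨h5, h6⟩ := Search.visit_all_spec hg hα g.verts s₂.val _ hcard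
    (h3'.inv (len := len) α hg.left_mem)
  obtain ⟨s₃, hs₃⟩ : ∃ s₃, s₃ = forEach (fun s _ => Search.visit g α s) s₂.val g.verts :=
    ⟨_, rfl⟩
  rw [← hs₃] at h5 h6
  have e : modDijkstra g v α = ⟨(s₃.val.value, s₃.val.parent), s₁.cost + (s₂.cost + s₃.cost)⟩ := by
    apply Timed.eq_of
    · simp only [modDijkstra, Timed.bind_val, Timed.pure_val, hs₃, hs₂, hs₁, hs₀]
    · simp only [modDijkstra, Timed.bind_cost, Timed.pure_cost, hs₃, hs₂, hs₁, hs₀, add_zero]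
  have hval : ∀ x ∈ g.verts, s₃.val.value x = s₃.val.heap.key x := fun x hx =>
    h5.value x hx (Finset.notMem_empty x)
  rw [e]
  refine ⟨⟨fun x y hxy => ?_, fun x hx a ha => ?_, fun x hx a ha => ?_, fun x hx a ha => ?_⟩, ?_⟩
  · simp only
    rw [hval x (hg.left_mem x y hxy), hval y (hg.right_mem hxy)]
    exact (h5.edge x y (Finset.notMem_empty x) hxy).resolve_left id
  · simp only
    rw [hval x hx]
    exact h5.term x hx a ha
  · simp only at ha
    rw [hval x hx] at ha
    exact h5.walk x hx a ha
  · simp only at ha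
    rw [hval x hx] at ha
    rcases h5.parent x hx a ha with h7 | ⟨z, h7, -, h8, b, h9, h10⟩
    · exact Or.inl h7
    · refine Or.inr ⟨z, h7, h8, b, ?_, h10⟩
      simp only
      rw [hval z (hg.left_mem z x h8)]
      exact h9
  · have h7 := hg.sum_length_adj_le
    have h8 := FibHeap.rankBound_mono hN
    have h9 : (40 * (FibHeap.rankBound g.verts.toFinset.card + 1) + 5) * g.verts.length
        ≤ 125 * (g.verts.length * (Nat.log 2 N + 1)) := by
      rw [hcard, mul_comm g.verts.length, ← mul_assoc]
      refine Nat.mul_le_mul_right _ ?_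
      unfold FibHeap.rankBound at h8 ⊢
      omega
    have h10 : g.verts.length ≤ g.verts.length * (Nat.log 2 N + 1) :=
      Nat.le_mul_of_pos_right _ (by omega)
    unfold graphSize
    simp only
    omega

end Dijkstra

/-! ### Steepest pairs of terminals in a star -/

section Star

/-- A comparison by thresholds is asymmetric. -/
theorem threshold_asymm {β : Type} {P : β → ℝ → Prop}
    (hP : ∀ x α α', 0 ≤ α → α ≤ α' → P x α → P x α') {x y : β}
    (h : ∃ α, 0 ≤ α ∧ P x α ∧ ¬ P y α) : ¬ ∃ α, 0 ≤ α ∧ P y α ∧ ¬ P x α := by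
  rintro ⟨α', h4, h5, h6⟩
  obtain ⟨α, h1, h2, h3⟩ := h
  rcases le_total α α' with h | h
  · exact h6 (hP x α α' h1 h h2)
  · exact h3 (hP y α' α h4 h h5)

/-- The mean of a quantity that is linear in the number of the elements related to a random
one. -/
theorem mean_countP_le {α : Type} (R : α → α → Bool) (hR : ∀ a b, R a b = true → R b a = false)
    {l : List α} (hl : l ≠ []) (c k : ENNReal) :
    (l.map fun a => c + 2 * k * (l.countP (R a) : ℕ)).sum / (l.length : ℕ)
      ≤ c + k * (l.length : ℕ) := by
  have h0 : ((l.length : ℕ) : ENNReal) ≠ 0 := by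
    rw [Nat.cast_ne_zero]
    exact fun h => hl (List.length_eq_zero_iff.1 h)
  have h1 : ∀ l' : List α, (l'.map fun a => c + 2 * k * (l.countP (R a) : ℕ)).sum
      = (l'.length : ℕ) * c + k * ((2 * (l'.map fun a => l.countP (R a)).sum : ℕ) : ENNReal) := by
    intro l'
    induction l' with
    | nil => simp
    | cons a l' ih =>
      rw [List.map_cons, List.sum_cons, ih, List.map_cons, List.sum_cons, List.length_cons]
      push_cast
      ring
  refine ENNReal.div_le_of_le_mul ?_
  rw [h1]
  have h2 : ((2 * (l.map fun a => l.countP (R a)).sum : ℕ) : ENNReal)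
      ≤ ((l.length ^ 2 : ℕ) : ENNReal) := Nat.cast_le.2 (two_mul_sum_countP_le R hR l)
  calc _ ≤ (l.length : ℕ) * c + k * ((l.length ^ 2 : ℕ) : ENNReal) := by gcongr
    _ = _ := by push_cast; ring

theorem sum_map_le_sum_map {α : Type} (l : List α) {f f' : α → ENNReal}
    (h : ∀ a ∈ l, f a ≤ f' a) : (l.map f).sum ≤ (l.map f').sum :=
  List.sum_le_sum h

variable {V : Type}

/-- The gradients from `s` to the terminals in `T` are at most `α`, in both directions. -/
def StarTerminal.Bounded (T : List (StarTerminal V)) (s : StarTerminal V) (α : ℝ) : Prop :=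
  ∀ t ∈ T, |s.volt - t.volt| ≤ α * (s.dist + t.dist)

theorem starGradient_val (s t : StarTerminal V) :
    (starGradient s t).val = |s.volt - t.volt| / (s.dist + t.dist) := rfl

theorem starLow_val (α : ℝ) (t : StarTerminal V) : (starLow α t).val = t.volt + α * t.dist := rfl

theorem starHigh_val (α : ℝ) (t : StarTerminal V) : (starHigh α t).val = t.volt - α * t.dist := rfl

theorem starTest_val (α low high : ℝ) (t : StarTerminal V) :
    (starTest α low high t).val = true ↔
      low < t.volt - α * t.dist ∨ t.volt + α * t.dist < high := by
  by_cases h : low < t.volt - α * t.dist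
  · simp [starTest, starHigh_val, h]
  · simp only [starTest, Timed.bind_val, starHigh_val, starLow_val, op_val, h, decide_false,
      Bool.false_eq_true, if_false, false_or]
    exact decide_eq_true_iff

theorem starTest_cost_le (α low high : ℝ) (t : StarTerminal V) :
    (starTest α low high t).cost ≤ 6 := by
  have h1 : (starHigh α t).cost = 2 := rfl
  have h2 : (starLow α t).cost = 2 := rfl
  by_cases h : low < t.volt - α * t.dist <;> simp [starTest, starHigh_val, h, h1, h2]

/-- The deterministic part of a round of `starSteepestPath`. -/
structure StarRound (T : List (StarTerminal V)) (t₁ t₂ : StarTerminal V) (α : ℝ)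
    (T' : List (StarTerminal V)) : Prop where
  mem : t₂ ∈ T
  nonneg : 0 ≤ α
  eq : |t₁.volt - t₂.volt| = α * (t₁.dist + t₂.dist)
  bounded : t₁.Bounded T α
  mem_rest : ∀ t, t ∈ T' ↔ t ∈ T ∧ ¬ t.Bounded T α
  rest : ∃ p : StarTerminal V → Bool, T' = T.filter p

/-- The test is exact: `v(t) - α d(t) ≤ v_low` says that `v(t) - v(s) ≤ α (d(t) + d(s))` for all
`s`, and the condition with `v_high` is the opposite inequality. So precisely the terminals with a
gradient above `α` to some other terminal stay. -/
theorem star_round {T : List (StarTerminal V)} (hT : ∀ t ∈ T, 0 < t.dist) {t₁ : StarTerminal V}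
    (ht₁ : t₁ ∈ T) : ∃ t₂ α T', StarRound T t₁ t₂ α T' ∧
      (argBest larger (starGradient t₁) T).val = some (t₂, α) ∧
      ∃ tl low th high, (argBest smaller (starLow α) T).val = some (tl, low) ∧
        (argBest larger (starHigh α) T).val = some (th, high) ∧
        (filterT (starTest α low high) T).val = T' := by
  have hne : T ≠ [] := List.ne_nil_of_mem ht₁
  rcases argBest_larger (starGradient t₁) T with ⟨h, -⟩ | ⟨t₂, ht₂, hv, hmax⟩
  · exact absurd h hne
  obtain ⟨α, hα⟩ : ∃ α, α = (starGradient t₁ t₂).val := ⟨_, rfl⟩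
  rw [← hα] at hv hmax
  rcases argBest_smaller (starLow α) T with ⟨h, -⟩ | ⟨tl, htl, hvl, hmin⟩
  · exact absurd h hne
  rcases argBest_larger (starHigh α) T with ⟨h, -⟩ | ⟨th, hth, hvh, hmaxh⟩
  · exact absurd h hne
  have hpos : ∀ t ∈ T, 0 < t₁.dist + t.dist := fun t ht => add_pos (hT t₁ ht₁) (hT t ht)
  rw [starGradient_val] at hα
  refine ⟨t₂, α, _, ⟨ht₂, ?_, ?_, ?_, ?_, ⟨_, filterT_val _ T⟩⟩, hv, tl, _, th, _, hvl, hvh, rfl⟩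
  · rw [hα]
    exact div_nonneg (abs_nonneg _) (hpos t₂ ht₂).le
  · rw [hα, div_mul_cancel₀ _ (hpos t₂ ht₂).ne']
  · intro t ht
    have := hmax t ht
    rwa [starGradient_val, div_le_iff₀ (hpos t ht)] at this
  · intro t
    rw [filterT_val, List.mem_filter, starTest_val, starLow_val, starHigh_val]
    refine and_congr_right fun ht => ?_
    constructor
    · intro h hb
      rcases h with h | h
      · have := (abs_le.1 (hb tl htl)).2
        linarith
      · have := (abs_le.1 (hb th hth)).1
        linarith
    · intro h
      by_contra! h'
      refine h fun s hs => abs_le.2 ⟨?_, ?_⟩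
      · have := hmaxh s hs
        rw [starHigh_val, starHigh_val] at this
        linarith
      · have := hmin s hs
        rw [starLow_val, starLow_val] at this
        linarith

theorem starTerminal_bounded_mono {T : List (StarTerminal V)} (hT : ∀ t ∈ T, 0 < t.dist)
    {s : StarTerminal V} (hs : s ∈ T) {α α' : ℝ} (h : α ≤ α') (hb : s.Bounded T α) :
    s.Bounded T α' := fun t ht =>
  (hb t ht).trans (mul_le_mul_of_nonneg_right h (add_pos (hT s hs) (hT t ht)).le)

/-- The result of `starSteepestPath` is a steepest pair of terminals. -/
theorem starSteepestPath_always : ∀ (n : ℕ) (T : List (StarTerminal V)), T ≠ [] → T.length ≤ n →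
    (∀ t ∈ T, 0 < t.dist) → (starSteepestPath n T).Always fun o =>
      ∃ t₁ ∈ T, ∃ t₂ ∈ T, ∃ α, o = some (t₁, t₂, α) ∧ 0 ≤ α ∧
        t₁.volt - t₂.volt = α * (t₁.dist + t₂.dist) ∧ ∀ s ∈ T, s.Bounded T α := by
  intro n
  induction n with
  | zero =>
    intro T hne hn _
    exact absurd (List.length_eq_zero_iff.1 (Nat.le_zero.1 hn)) hne
  | succ n ih =>
    intro T hne hn hT
    refine Rand.always_bind ((Rand.always_pick hne).mono ?_)
    rintro _ ⟨t₁, ht₁, rfl⟩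
    obtain ⟨t₂, α, T', hR, h1, tl, low, th, high, h2, h3, h4⟩ := star_round hT ht₁
    refine Rand.always_bind (Rand.always_det ?_)
    rw [h1]
    refine Rand.always_bind (Rand.always_det (Rand.always_bind (Rand.always_det ?_)))
    rw [h2, h3]
    refine Rand.always_bind (Rand.always_det ?_)
    rw [h4]
    cases T' with
    | nil =>
      have hb : ∀ s ∈ T, s.Bounded T α := by
        intro s hs
        by_contra h
        have := (hR.mem_rest s).2 ⟨hs, h⟩
        simp at this
      refine Rand.always_bind (Rand.always_det ?_)
      by_cases h5 : t₂.volt ≤ t₁.volt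
      · simp only [op_val, h5, decide_true, if_true]
        refine Rand.always_pure ⟨t₁, ht₁, t₂, hR.mem, α, rfl, hR.nonneg, ?_, hb⟩
        rw [← hR.eq, abs_of_nonneg (by linarith)]
      · simp only [op_val, h5, decide_false, Bool.false_eq_true, if_false]
        refine Rand.always_pure ⟨t₂, hR.mem, t₁, ht₁, α, rfl, hR.nonneg, ?_, hb⟩
        rw [add_comm, ← hR.eq, abs_of_nonpos (by linarith)]
        ring
    | cons u T'' =>
      obtain ⟨p, hp⟩ := hR.rest
      have hsub : ∀ t ∈ u :: T'', t ∈ T := fun t ht => ((hR.mem_rest t).1 ht).1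
      -- The drawn terminal `t₁` is bounded by `α`, the maximum of its own gradients, and therefore
      -- drops out.
      have hlen : (u :: T'').length ≤ n := by
        have h5 : (u :: T'').length < T.length := by
          rw [hp]
          refine List.length_filter_lt_length_iff_exists.2 ⟨t₁, ht₁, fun h5 => ?_⟩
          have h6 : t₁ ∈ u :: T'' := by rw [hp]; exact List.mem_filter.2 ⟨ht₁, h5⟩
          exact ((hR.mem_rest t₁).1 h6).2 hR.bounded
        omega
      refine (ih (u :: T'') (by simp) hlen fun t ht => hT t (hsub t ht)).mono ?_
      rintro o ⟨s₁, hs₁, s₂, hs₂, β, rfl, hβ, heq, hb⟩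
      refine ⟨s₁, hsub s₁ hs₁, s₂, hsub s₂ hs₂, β, rfl, hβ, heq, ?_⟩
      -- a pair of terminals of gradient more than `α` survives
      have hpair : ∀ s ∈ T, ∀ t ∈ T, ¬ |s.volt - t.volt| ≤ α * (s.dist + t.dist) →
          |s.volt - t.volt| ≤ β * (s.dist + t.dist) := by
        intro s hs t ht h5
        refine hb s ((hR.mem_rest s).2 ⟨hs, fun h6 => h5 (h6 t ht)⟩) t
          ((hR.mem_rest t).2 ⟨ht, fun h6 => h5 ?_⟩)
        rw [abs_sub_comm, add_comm]
        exact h6 s hs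
      -- The survivor `u` has a partner with gradient above `α`; by `hpair` that gradient is at most
      -- `β`.
      have hαβ : α ≤ β := by
        obtain ⟨hu, hub⟩ := (hR.mem_rest u).1 (by simp)
        unfold StarTerminal.Bounded at hub
        push Not at hub
        obtain ⟨t, ht, hut⟩ := hub
        have h5 := hpair u hu t ht (not_le.2 hut)
        by_contra! h6
        have h7 := mul_lt_mul_of_pos_right h6 (add_pos (hT u hu) (hT t ht))
        linarith
      intro s hs t ht
      by_cases h5 : |s.volt - t.volt| ≤ α * (s.dist + t.dist)
      · exact h5.trans (mul_le_mul_of_nonneg_right hαβ (add_pos (hT s hs) (hT t ht)).le)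
      · exact hpair s hs t ht h5

-- A survivor has a larger maximal gradient than the drawn terminal, so at most half of the
-- terminals survive on average. The four passes take at most 24 steps per terminal (`7 + 5 + 5 +
-- 7`), and one more unit covers the final comparison. The constant 26 comes from `1 + 25 n + 26 n ≤
-- 52 n` for `n ≥ 1`.
open Classical in
theorem starSteepestPath_expectedCost_le : ∀ (n : ℕ) (T : List (StarTerminal V)), T ≠ [] →
    (∀ t ∈ T, 0 < t.dist) →
    (starSteepestPath n T).expectedCost ≤ 2 * 26 * ((T.length : ℕ) : ENNReal) := by
  intro n
  induction n with
  | zero =>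
    intro T _ _
    rw [Rand.expectedCost_eq_wp]
    exact (Rand.wp_pure _ _).le.trans zero_le
  | succ n ih =>
    intro T hne hT
    obtain ⟨R, hRdef⟩ : ∃ R : StarTerminal V → StarTerminal V → Bool, ∀ s t, R s t = true ↔
        s ∈ T ∧ t ∈ T ∧ ∃ α, 0 ≤ α ∧ s.Bounded T α ∧ ¬ t.Bounded T α :=
      ⟨fun s t => decide (s ∈ T ∧ t ∈ T ∧ ∃ α, 0 ≤ α ∧ s.Bounded T α ∧ ¬ t.Bounded T α),
        fun s t => decide_eq_true_iff⟩
    have hRasymm : ∀ s t, R s t = true → R t s = false := by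
      intro s t h
      rw [hRdef] at h
      rw [← Bool.not_eq_true, hRdef]
      rintro ⟨-, -, h'⟩
      -- Monotonicity in `α` uses positive distances, which are known only for members of `T`; hence
      -- the subtype.
      exact threshold_asymm (P := fun (s : {s // s ∈ T}) α => s.1.Bounded T α)
        (fun s α α' _ h hb => starTerminal_bounded_mono hT s.2 h hb)
        (x := ⟨s, h.1⟩) (y := ⟨t, h.2.1⟩) h.2.2 h'
    have hlen : 1 ≤ T.length := List.length_pos_iff.2 hne
    rw [Rand.expectedCost_eq_wp, starSteepestPath, Rand.wp_bind, Rand.wp_pick hne]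
    refine (add_le_add_right (ENNReal.div_le_div_right (sum_map_le_sum_map T
      (f' := fun t₁ => ((25 * T.length : ℕ) : ENNReal) + 2 * 26 * (T.countP (R t₁) : ℕ)) ?_) _) _).trans
      ((add_le_add_right (mean_countP_le R hRasymm hne _ _) _).trans ?_)
    · intro t₁ ht₁
      obtain ⟨t₂, α, T', hR, h1, tl, low, th, high, h2, h3, h4⟩ := star_round hT ht₁
      have hc1 : (argBest larger (starGradient t₁) T).cost ≤ 7 * T.length :=
        argBest_cost_le (c := 4) _ _ fun _ _ => le_rfl
      have hc2 : (argBest smaller (starLow α) T).cost ≤ 5 * T.length :=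
        argBest_cost_le (c := 2) _ _ fun _ _ => le_rfl
      have hc3 : (argBest larger (starHigh α) T).cost ≤ 5 * T.length :=
        argBest_cost_le (c := 2) _ _ fun _ _ => le_rfl
      have hc4 : (filterT (starTest α low high) T).cost ≤ 7 * T.length :=
        filterT_cost_le (c := 6) _ fun t _ => starTest_cost_le α low high t
      have hT' : T'.length ≤ T.countP (R t₁) := by
        obtain ⟨p, hp⟩ := hR.rest
        rw [hp, ← List.countP_eq_length_filter]
        refine List.countP_mono_left fun t ht hpt => ?_
        have h5 : t ∈ T' := by rw [hp]; exact List.mem_filter.2 ⟨ht, hpt⟩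
        exact (hRdef _ _).2 ⟨ht₁, ht, α, hR.nonneg, hR.bounded, ((hR.mem_rest t).1 h5).2⟩
      simp only [Rand.wp_bind, Rand.wp_det, h1, h2, h3, h4]
      have hmain : ∀ x : ENNReal, x ≤ 1 + 2 * 26 * (T'.length : ℕ) →
          ((argBest larger (starGradient t₁) T).cost : ENNReal) +
            (((argBest smaller (starLow α) T).cost : ENNReal) +
            (((argBest larger (starHigh α) T).cost : ENNReal) +
            (((filterT (starTest α low high) T).cost : ENNReal) + x)))
          ≤ ((25 * T.length : ℕ) : ENNReal) + 2 * 26 * (T.countP (R t₁) : ℕ) := by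
        intro x hx
        have h5 : ((argBest larger (starGradient t₁) T).cost +
            ((argBest smaller (starLow α) T).cost + ((argBest larger (starHigh α) T).cost +
            ((filterT (starTest α low high) T).cost + (1 + 2 * 26 * T'.length))))) ≤
            25 * T.length + 2 * 26 * T.countP (R t₁) := by omega
        refine le_trans ?_ (le_trans (Nat.cast_le.2 h5) (le_of_eq (by push_cast; ring)))
        have hx' : x ≤ 1 + 52 * (T'.length : ℕ) := hx.trans (le_of_eq (by norm_num))
        push_cast
        gcongr
      apply hmain
      cases T' with
      | nil =>
        refine le_trans ?_ (le_add_of_nonneg_right zero_le)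
        simp only [Rand.wp_bind, Rand.wp_det]
        by_cases h5 : t₂.volt ≤ t₁.volt <;> simp [h5, Rand.wp_pure]
      | cons u T'' =>
        have hsub : ∀ t ∈ u :: T'', t ∈ T := fun t ht => ((hR.mem_rest t).1 ht).1
        have := ih (u :: T'') (by simp) fun t ht => hT t (hsub t ht)
        rw [Rand.expectedCost_eq_wp] at this
        exact this.trans (le_add_of_nonneg_left zero_le)
    · have h5 : 1 + (25 * T.length + 26 * T.length) ≤ 2 * 26 * T.length := by omega
      refine le_trans (le_of_eq ?_) (le_trans (Nat.cast_le.2 h5) (le_of_eq ?_)) <;> push_cast <;> ring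

end Star

/-! ### Lengths of walks -/

section Walks

variable {V : Type} {H : SimpleGraph V} {len : Sym2 V → ℝ}

theorem pathLength_nil (s : V) : pathLength len (SimpleGraph.Walk.nil : H.Walk s s) = 0 := by
  simp [pathLength]

theorem pathLength_cons {s t u : V} (h : H.Adj s t) (w : H.Walk t u) :
    pathLength len (SimpleGraph.Walk.cons h w) = len s(s, t) + pathLength len w := by
  simp [pathLength]

theorem pathLength_append {s t u : V} (p : H.Walk s t) (q : H.Walk t u) :
    pathLength len (p.append q) = pathLength len p + pathLength len q := by
  simp [pathLength]

theorem pathLength_reverse {s t : V} (p : H.Walk s t) :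
    pathLength len p.reverse = pathLength len p := by
  simp [pathLength, List.sum_reverse]

theorem pathLength_nonneg (hlen : ∀ x y, H.Adj x y → 0 < len s(x, y)) {s t : V}
    (p : H.Walk s t) : 0 ≤ pathLength len p := by
  induction p with
  | nil => exact (pathLength_nil _).ge
  | cons h p ih =>
    rw [pathLength_cons]
    exact add_nonneg (hlen _ _ h).le ih

theorem pathLength_pos (hlen : ∀ x y, H.Adj x y → 0 < len s(x, y)) {s t : V}
    (p : H.Walk s t) (hp : ¬ p.Nil) : 0 < pathLength len p := by
  cases p with
  | nil => simp at hp
  | cons h p =>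
    rw [pathLength_cons]
    exact add_pos_of_pos_of_nonneg (hlen _ _ h) (pathLength_nonneg hlen p)

theorem not_nil_of_pathLength_pos {s t : V} (p : H.Walk s t) (hp : 0 < pathLength len p) :
    ¬ p.Nil := by
  cases p with
  | nil => rw [pathLength_nil] at hp; exact absurd hp (lt_irrefl _)
  | cons h p => simp

end Walks

/-! ### Shortest paths from a vertex and the steepest terminal path through it -/

section VertexPath

variable {V : Type} [DecidableEq V] {g : GraphData V} {H : SimpleGraph V} {len : Sym2 V → ℝ}

theorem GraphData.Encodes.walk_left_mem (hg : g.Encodes H len) {s t : V} (w : H.Walk s t)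
    (ht : t ∈ g.verts) : s ∈ g.verts := by
  cases w with
  | nil => exact ht
  | cons h w => exact hg.left_mem _ _ h

theorem GraphData.Encodes.walk_right_mem (hg : g.Encodes H len) {s t : V} (w : H.Walk s t)
    (hs : s ∈ g.verts) : t ∈ g.verts := hg.walk_left_mem w.reverse hs

/-- A well-posed instance without edges between terminals, in memory. -/
structure GraphData.Inst (g : GraphData V) (H : SimpleGraph V) (len : Sym2 V → ℝ) : Prop where
  enc : g.Encodes H len
  noTT : ∀ x y, H.Adj x y → ¬ (IsTerminal g.volt x ∧ IsTerminal g.volt y)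
  reach : ∀ x ∈ g.verts, ∃ t, IsTerminal g.volt t ∧ H.Reachable t x

/-- The gradients of the terminal paths through `x` are at most `α`. -/
def GraphData.Bounded (g : GraphData V) (H : SimpleGraph V) (len : Sym2 V → ℝ) (x : V) (α : ℝ) :
    Prop :=
  ∀ s t a b, g.volt s = some a → g.volt t = some b → ∀ (p : H.Walk s x) (q : H.Walk x t),
    a - b ≤ α * (pathLength len p + pathLength len q)

theorem GraphData.Bounded.mono (hg : g.Encodes H len) {x : V} {α α' : ℝ} (h : α ≤ α')
    (hb : g.Bounded H len x α) : g.Bounded H len x α' := fun s t a b ha hb' p q =>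
  (hb s t a b ha hb' p q).trans (mul_le_mul_of_nonneg_right h
    (add_nonneg (pathLength_nonneg hg.len_pos p) (pathLength_nonneg hg.len_pos q)))

/-- `P` lists the vertices of a terminal path of gradient `α`. -/
def IsPathOfGradient (g : GraphData V) (H : SimpleGraph V) (len : Sym2 V → ℝ) (P : List V)
    (α : ℝ) : Prop :=
  ∃ s t a b, g.volt s = some a ∧ g.volt t = some b ∧ ∃ w : H.Walk s t,
    ¬ w.Nil ∧ P = w.support ∧ a - b = α * pathLength len w

theorem DijkstraSpec.le_walk {v : V → Option ℝ} {α : ℝ} {r : (V → WithTop ℝ) × (V → Option V)}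
    (hr : DijkstraSpec g H len v α r) {s t : V} (w : H.Walk s t) :
    r.1 t ≤ r.1 s + ((α * pathLength len w : ℝ) : WithTop ℝ) := by
  induction w with
  | nil => simp [pathLength_nil]
  | @cons s u t h w ih =>
    refine ih.trans ?_
    rw [pathLength_cons, mul_add, WithTop.coe_add, ← add_assoc]
    gcongr
    exact hr.edge s u h

/-- A loop that fills an array. -/
theorem forEach_update_val {β : Type} {body : (V → β) → V → Timed (V → β)} (f : V → β)
    (hbody : ∀ A x, (body A x).val = Function.update A x (f x)) : ∀ (l : List V) (A : V → β),
    (forEach body A l).val = fun y => if y ∈ l then f y else A y := by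
  intro l
  induction l with
  | nil => intro A; simp
  | cons x l ih =>
    intro A
    rw [forEach_cons_val, hbody, ih]
    ext y
    by_cases h : y = x
    · subst h; by_cases h' : y ∈ l <;> simp [h']
    · simp [h]

/-- The voltages of a run of Dijkstra's algorithm from `x`. -/
def source (x : V) : V → Option ℝ := Function.update (fun _ => none) x (some 0)

theorem source_eq_some {x y : V} {a : ℝ} : source x y = some a ↔ y = x ∧ a = 0 := by
  rw [source, Function.update_apply]
  split_ifs with h
  · simp [h, eq_comm]
  · simp [h]

/-- Distances from `x` and a tree of shortest paths. -/
structure DistSpec (g : GraphData V) (H : SimpleGraph V) (len : Sym2 V → ℝ) (x : V)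
    (r : (V → WithTop ℝ) × (V → Option V)) : Prop where
  le_walk : ∀ y (w : H.Walk x y), r.1 y ≤ ((pathLength len w : ℝ) : WithTop ℝ)
  climb : ∀ y (d : ℝ), y ∈ g.verts → r.1 y = (d : WithTop ℝ) → ∃ w : H.Walk x y,
    pathLength len w = d ∧ (climb r.2 g.verts.length y []).val = w.support

theorem climb_cost_le (parent : V → Option V) : ∀ (n : ℕ) (y : V) (acc : List V),
    (climb parent n y acc).cost ≤ 2 * n := by
  intro n
  induction n with
  | zero => intro y acc; exact le_rfl
  | succ n ih =>
    intro y acc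
    cases hp : parent y with
    | none => simp [climb, hp]
    | some z =>
      have := ih z (y :: acc)
      simp [climb, hp]
      omega

theorem climb_length_le (parent : V → Option V) : ∀ (n : ℕ) (y : V) (acc : List V),
    (climb parent n y acc).val.length ≤ n + acc.length := by
  intro n
  induction n with
  | zero => intro y acc; exact (Nat.zero_add _).ge
  | succ n ih =>
    intro y acc
    cases hp : parent y with
    | none => simp [climb, hp]
    | some z =>
      have := ih z (y :: acc)
      rw [List.length_cons] at this
      simp [climb, hp]
      omega

/-- With `α = 1` and positive lengths, a parent is strictly closer to `x` than its child. The number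
of vertices closer than `y` therefore falls with each step of the climb and bounds the rounds
needed. Only `x` carries a voltage, so the climb can end only there. -/
theorem DijkstraSpec.dist (hg : g.Encodes H len) {x : V} (hx : x ∈ g.verts)
    {r : (V → WithTop ℝ) × (V → Option V)} (hr : DijkstraSpec g H len (source x) 1 r) :
    DistSpec g H len x r := by
  have hx0 : r.1 x ≤ ((0 : ℝ) : WithTop ℝ) := hr.term x hx 0 (source_eq_some.2 ⟨rfl, rfl⟩)
  have key : ∀ (n : ℕ) (y : V) (acc : List V) (d : ℝ), y ∈ g.verts → r.1 y = (d : WithTop ℝ) →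
      (g.verts.toFinset.filter fun z => r.1 z < r.1 y).card < n → ∃ w : H.Walk x y,
        pathLength len w = d ∧ (LexLearn.climb r.2 n y acc).val = w.support ++ acc := by
    intro n
    induction n with
    | zero => intro y acc d _ _ h; omega
    | succ n ih =>
      intro y acc d hy hd hn
      rcases hr.parent y hy d hd with ⟨h1, h2⟩ | ⟨z, h1, h2, b, h3, h4⟩
      · obtain ⟨rfl, rfl⟩ := source_eq_some.1 h2
        exact ⟨SimpleGraph.Walk.nil, pathLength_nil _, by simp [LexLearn.climb, h1]⟩
      · have hz := hg.left_mem z y h2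
        have hlen := hg.len_pos z y h2
        have hzy : r.1 z < r.1 y := by
          rw [h3, hd, WithTop.coe_lt_coe]
          linarith
        have hcard : (g.verts.toFinset.filter fun u => r.1 u < r.1 z).card
            < (g.verts.toFinset.filter fun u => r.1 u < r.1 y).card := by
          refine Finset.card_lt_card (Finset.ssubset_iff_of_subset ?_ |>.2
            ⟨z, Finset.mem_filter.2 ⟨List.mem_toFinset.2 hz, hzy⟩, by simp⟩)
          intro u hu
          rw [Finset.mem_filter] at hu ⊢
          exact ⟨hu.1, hu.2.trans hzy⟩
        obtain ⟨w, hw, hval⟩ := ih z (y :: acc) b hz h3 (by omega)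
        refine ⟨w.concat h2, ?_, ?_⟩
        · rw [pathLength_concat, hw, h4, one_mul]
        · simp [LexLearn.climb, h1, hval, SimpleGraph.Walk.support_concat]
  refine ⟨fun y w => ?_, fun y d hy hd => ?_⟩
  · refine (hr.le_walk w).trans ?_
    rw [one_mul]
    calc r.1 x + ((pathLength len w : ℝ) : WithTop ℝ)
        ≤ ((0 : ℝ) : WithTop ℝ) + ((pathLength len w : ℝ) : WithTop ℝ) := by gcongr
      _ = _ := by simp
  · obtain ⟨w, hw, hval⟩ := key g.verts.length y [] d hy hd (by
      rw [← List.toFinset_card_of_nodup hg.verts_nodup]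
      refine Finset.card_lt_card (Finset.ssubset_iff_of_subset (Finset.filter_subset _ _) |>.2
        ⟨y, List.mem_toFinset.2 hy, by simp⟩))
    exact ⟨w, hw, by simpa using hval⟩

theorem reachedTerminals_spec (g : GraphData V) (D : V → WithTop ℝ) :
    (∀ e : StarTerminal V, e ∈ (reachedTerminals g D).val ↔
      e.name ∈ g.verts ∧ g.volt e.name = some e.volt ∧ D e.name = (e.dist : WithTop ℝ)) ∧
    (reachedTerminals g D).val.length ≤ g.verts.length ∧
    (reachedTerminals g D).cost ≤ 4 * g.verts.length := by
  have hstep : ∀ (acc : List (StarTerminal V)) (t : V), ∃ T : Timed (List (StarTerminal V)),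
      T = (do
        let a ← rd g.volt t
        let d ← rd D t
        match a, d with
        | some a, some d => op ({ name := t, volt := a, dist := d } :: acc)
        | _, _ => pure acc) ∧ T.cost ≤ 3 ∧ T.val.length ≤ acc.length + 1 ∧
      ∀ e : StarTerminal V, e ∈ T.val ↔ e ∈ acc ∨
        (e.name = t ∧ g.volt t = some e.volt ∧ D t = (e.dist : WithTop ℝ)) := by
    intro acc t
    refine ⟨_, rfl, ?_⟩
    rcases hv : g.volt t with _ | a
    · simp [hv]
    · cases hd : D t with
      | top =>
        -- The program matches on `D t` as an `Option`, so the case is restated with the constructor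
        -- `none`.
        have hd' : D t = none := hd
        simp [hv, hd']
      | coe d =>
        have hd' : D t = some d := hd
        simp [hv, hd']
        rintro ⟨n, b, c⟩
        simp only [StarTerminal.mk.injEq]
        rw [eq_comm (a := b), eq_comm (a := c)]
        tauto
  have key := forEach_induct (body := fun (acc : List (StarTerminal V)) t => do
        let a ← rd g.volt t
        let d ← rd D t
        match a, d with
        | some a, some d => op ({ name := t, volt := a, dist := d } :: acc)
        | _, _ => pure acc)
    (P := fun rest acc k => ∃ front, g.verts = front ++ rest ∧ (∀ e : StarTerminal V, e ∈ acc ↔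
      e.name ∈ front ∧ g.volt e.name = some e.volt ∧ D e.name = (e.dist : WithTop ℝ)) ∧
      acc.length ≤ front.length ∧ k ≤ 4 * front.length)
    (by
      rintro t rest acc k ⟨front, h1, h2, h3, h4⟩
      obtain ⟨T, hT, h5, h6, h7⟩ := hstep acc t
      rw [← hT]
      refine ⟨front ++ [t], by simp [h1], fun e => ?_, ?_, ?_⟩
      · rw [h7, h2, List.mem_append, List.mem_singleton]
        constructor
        · rintro (⟨h8, h9⟩ | ⟨rfl, h9⟩)
          · exact ⟨Or.inl h8, h9⟩
          · exact ⟨Or.inr rfl, h9⟩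
        · rintro ⟨h8 | rfl, h9⟩
          · exact Or.inl ⟨h8, h9⟩
          · exact Or.inr ⟨rfl, h9⟩
      · rw [List.length_append, List.length_singleton]; omega
      · rw [List.length_append, List.length_singleton]; omega)
    g.verts [] 0 ⟨[], rfl, by simp, by simp, by simp⟩
  obtain ⟨front, h1, h2, h3, h4⟩ := key
  rw [List.append_nil] at h1
  subst h1
  rw [Nat.zero_add] at h4
  exact ⟨h2, h3, h4⟩

/-- What `vertexSteepestPath` returns. -/
structure VertexSpec (g : GraphData V) (H : SimpleGraph V) (len : Sym2 V → ℝ) (x : V)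
    (o : Option (List V × ℝ)) : Prop where
  none : o = none → IsTerminal g.volt x ∧ ∀ α, 0 ≤ α → g.Bounded H len x α
  some : ∀ P α, o = some (P, α) → 0 ≤ α ∧ g.Bounded H len x α ∧ IsPathOfGradient g H len P α

/-- The initial part of `vertexSteepestPath`. -/
theorem dijkstra_from_spec (hg : g.Encodes H len) {x : V} (hx : x ∈ g.verts) :
    (wr (forEach (fun A y => wr A y (none : Option ℝ)) (fun _ => none) g.verts).val x
      (some 0)).val = source x ∧ DistSpec g H len x (modDijkstra g (source x) 1).val := by
  refine ⟨?_, (modDijkstra_spec hg _ zero_le_one le_rfl).1.dist hg hx⟩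
  rw [forEach_update_val (fun _ => none) fun _ _ => rfl, wr_val, source]
  congr 1
  ext y
  simp

/-- For a terminal `x`, a walk through `x` splits into two terminal walks at `x`, and bounds for
both halves add up. Without another reachable terminal all these walks run from `x` to `x`, with
voltage drop `0`. For a nonterminal `x`, the two halves are compared with shortest paths to the same
terminals, which is the situation of the star. -/
theorem vertexSteepestPath_always (hg : g.Inst H len) {x : V} (hx : x ∈ g.verts) :
    (vertexSteepestPath g x).Always (VertexSpec g H len x) := by
  have hE := hg.enc
  obtain ⟨hsrc, hD⟩ := dijkstra_from_spec hE hx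
  obtain ⟨r, hr⟩ : ∃ r, r = (modDijkstra g (source x) 1).val := ⟨_, rfl⟩
  obtain ⟨hTmem, -, -⟩ := reachedTerminals_spec g r.1
  obtain ⟨T, hT⟩ : ∃ T, T = (reachedTerminals g r.1).val := ⟨_, rfl⟩
  rw [← hr] at hD
  rw [← hT] at hTmem
  have hreached : ∀ t b, g.volt t = some b → ∀ w : H.Walk x t, ∃ e ∈ T, e.name = t ∧ e.volt = b ∧
      e.dist ≤ pathLength len w := by
    intro t b hb w
    have h1 := hD.le_walk t w
    cases hd : r.1 t with
    | top => rw [hd] at h1; simp at h1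
    | coe d =>
      rw [hd, WithTop.coe_le_coe] at h1
      exact ⟨⟨t, b, d⟩, (hTmem _).2 ⟨hE.walk_right_mem w hx, hb, hd⟩, rfl, rfl, h1⟩
  have hdist : ∀ e ∈ T, e.name ≠ x → 0 < e.dist := by
    intro e he hne
    obtain ⟨h1, -, h2⟩ := (hTmem e).1 he
    obtain ⟨w, hw, -⟩ := hD.climb _ _ h1 h2
    rw [← hw]
    refine pathLength_pos hE.len_pos w fun h3 => hne h3.eq.symm
  unfold vertexSteepestPath
  refine Rand.always_bind (Rand.always_det (Rand.always_bind (Rand.always_det ?_)))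
  rw [hsrc]
  refine Rand.always_bind (Rand.always_det ?_)
  rw [← hr]
  refine Rand.always_bind (Rand.always_det ?_)
  rw [← hT]
  refine Rand.always_bind (Rand.always_det ?_)
  rw [rd_val]
  cases hv : g.volt x with
  | some a =>
    simp only
    obtain ⟨T', hT'⟩ : ∃ T', T' = (filterT (fun t => op (decide (t.name ≠ x))) T).val := ⟨_, rfl⟩
    have hT'mem : ∀ e, e ∈ T' ↔ e ∈ T ∧ e.name ≠ x := by
      intro e
      rw [hT', filterT_val, List.mem_filter]
      simp
    refine Rand.always_bind (Rand.always_det ?_)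
    rw [← hT']
    refine Rand.always_bind (Rand.always_det ?_)
    -- gradients of paths through `x` are bounded by those of the paths that end there
    have hbound : ∀ α, 0 ≤ α → (∀ e ∈ T', |a - e.volt| ≤ α * e.dist) → g.Bounded H len x α := by
      intro α hα h s t b c hb hc p q
      have hside : ∀ u d, g.volt u = some d → ∀ w : H.Walk x u,
          |a - d| ≤ α * pathLength len w := by
        intro u d hd w
        by_cases hux : u = x
        · subst hux
          rw [hv] at hd
          cases hd
          rw [sub_self, abs_zero]
          exact mul_nonneg hα (pathLength_nonneg hE.len_pos w)
        · obtain ⟨e, he, he1, rfl, he3⟩ := hreached u d hd w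
          exact (h e ((hT'mem e).2 ⟨he, by rw [he1]; exact hux⟩)).trans
            (mul_le_mul_of_nonneg_left he3 hα)
      have h1 := (abs_le.1 (hside s b hb p.reverse)).1
      have h2 := (abs_le.1 (hside t c hc q)).2
      rw [pathLength_reverse] at h1
      linarith
    rcases argBest_larger (terminalGradient a) T' with ⟨h1, h2⟩ | ⟨y, hy, h2, hmax⟩
    · rw [h2]
      refine Rand.always_pure ⟨fun _ => ⟨by simp [IsTerminal, hv], fun α hα => ?_⟩, by simp⟩
      exact hbound α hα (by simp [h1])
    · rw [h2]
      obtain ⟨hyT, hyx⟩ := (hT'mem y).1 hy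
      obtain ⟨h3, h4, h5⟩ := (hTmem y).1 hyT
      obtain ⟨w, hw, hclimb⟩ := hD.climb _ _ h3 h5
      have hval : ∀ e : StarTerminal V, (terminalGradient a e).val = |a - e.volt| / e.dist := fun _ => rfl
      have hpos : ∀ e ∈ T', 0 < e.dist := fun e he =>
        hdist e ((hT'mem e).1 he).1 ((hT'mem e).1 he).2
      obtain ⟨α, hα⟩ : ∃ α, α = (terminalGradient a y).val := ⟨_, rfl⟩
      rw [← hα] at hmax ⊢
      rw [hval] at hα
      have hα0 : 0 ≤ α := by rw [hα]; exact div_nonneg (abs_nonneg _) (hpos y hy).le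
      have heq : |a - y.volt| = α * y.dist := by rw [hα, div_mul_cancel₀ _ (hpos y hy).ne']
      have hb := hbound α hα0 fun e he => by
        have := hmax e he
        rwa [hval, div_le_iff₀ (hpos e he)] at this
      have hnil : ¬ w.Nil := not_nil_of_pathLength_pos w (by rw [hw]; exact hpos y hy)
      simp only
      refine Rand.always_bind (Rand.always_det ?_)
      rw [hclimb]
      refine Rand.always_bind (Rand.always_det ?_)
      by_cases hle : y.volt ≤ a
      · simp only [op_val, hle, decide_true, if_true]
        refine Rand.always_pure ⟨by simp, ?_⟩
        rintro P β h
        simp only [Option.some.injEq, Prod.mk.injEq] at h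
        obtain ⟨rfl, rfl⟩ := h
        refine ⟨hα0, hb, x, y.name, a, y.volt, hv, h4, w, hnil, rfl, ?_⟩
        rw [hw, ← heq, abs_of_nonneg (by linarith)]
      · simp only [op_val, hle, decide_false, Bool.false_eq_true, if_false]
        refine Rand.always_bind (Rand.always_det (Rand.always_pure ⟨by simp, ?_⟩))
        rintro P β h
        simp only [Option.some.injEq, Prod.mk.injEq] at h
        obtain ⟨rfl, rfl⟩ := h
        refine ⟨hα0, hb, y.name, x, y.volt, a, h4, hv, w.reverse, ?_, ?_, ?_⟩
        · exact not_nil_of_pathLength_pos (len := len) _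
            (by rw [pathLength_reverse, hw]; exact hpos y hy)
        · rw [pushAll_val, List.append_nil, SimpleGraph.Walk.support_reverse]
        · rw [pathLength_reverse, hw, ← heq, abs_of_nonpos (by linarith)]
          ring
  | none =>
    simp only
    have hpos : ∀ e ∈ T, 0 < e.dist := fun e he => hdist e he fun h => by
      have := ((hTmem e).1 he).2.1
      rw [h, hv] at this
      cases this
    -- Well-posedness enters here: some terminal is at finite distance from `x`.
    have hTne : T ≠ [] := by
      obtain ⟨t, ht, hreach⟩ := hg.reach x hx
      obtain ⟨b, hb⟩ := Option.ne_none_iff_exists'.1 ht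
      obtain ⟨w⟩ := hreach.symm
      obtain ⟨e, he, -⟩ := hreached t b hb w
      exact List.ne_nil_of_mem he
    refine Rand.always_bind ((starSteepestPath_always _ T hTne le_rfl hpos).mono ?_)
    rintro _ ⟨t₁, ht₁, t₂, ht₂, α, rfl, hα, heq, hmax⟩
    obtain ⟨h1, h2, h3⟩ := (hTmem t₁).1 ht₁
    obtain ⟨h4, h5, h6⟩ := (hTmem t₂).1 ht₂
    obtain ⟨w₁, hw₁, hc₁⟩ := hD.climb _ _ h1 h3
    obtain ⟨w₂, hw₂, hc₂⟩ := hD.climb _ _ h4 h6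
    simp only
    refine Rand.always_bind (Rand.always_det ?_)
    rw [hc₁]
    refine Rand.always_bind (Rand.always_det ?_)
    rw [hc₂]
    refine Rand.always_bind (Rand.always_det (Rand.always_pure ⟨by simp, ?_⟩))
    rintro P β h
    simp only [Option.some.injEq, Prod.mk.injEq] at h
    obtain ⟨rfl, rfl⟩ := h
    have hl : pathLength len (w₁.reverse.append w₂) = t₁.dist + t₂.dist := by
      rw [pathLength_append, pathLength_reverse, hw₁, hw₂]
    refine ⟨hα, fun s t b c hb hc p q => ?_, t₁.name, t₂.name, t₁.volt, t₂.volt, h2, h5,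
      w₁.reverse.append w₂, ?_, ?_, ?_⟩
    · obtain ⟨e, he, -, rfl, he3⟩ := hreached s b hb p.reverse
      obtain ⟨f, hf, -, rfl, hf3⟩ := hreached t c hc q
      rw [pathLength_reverse] at he3
      refine (le_abs_self _).trans ((hmax e he f hf).trans ?_)
      exact mul_le_mul_of_nonneg_left (add_le_add he3 hf3) hα
    · exact not_nil_of_pathLength_pos (len := len) _
        (by rw [hl]; exact add_pos (hpos t₁ ht₁) (hpos t₂ ht₂))
    · rw [pushAll_val, SimpleGraph.Walk.support_append, SimpleGraph.Walk.support_reverse]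
      -- Both climbs list `x` first. The program drops it from the first list before reversing, so
      -- `x` occurs once at the junction.
      have h7 : w₁.support.reverse = w₁.support.tail.reverse ++ [x] := by
        conv_lhs => rw [← SimpleGraph.Walk.cons_tail_support w₁]
        rw [List.reverse_cons]
      have h8 : [x] ++ w₂.support.tail = w₂.support := SimpleGraph.Walk.cons_tail_support w₂
      rw [h7, List.append_assoc, h8]
    · rw [hl, heq]

/-- One run of Dijkstra's algorithm costs 400 times the size. The rest is linear in the number of
vertices, including the expected `52` steps per terminal in the star. -/
theorem vertexSteepestPath_expectedCost_le (hg : g.Inst H len) {x : V} (hx : x ∈ g.verts) {N : ℕ}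
    (hN : g.verts.length ≤ N) :
    (vertexSteepestPath g x).expectedCost ≤ ((500 * graphSize N g : ℕ) : ENNReal) := by
  have hE := hg.enc
  obtain ⟨hsrc, hD⟩ := dijkstra_from_spec hE hx
  have hdc := (modDijkstra_spec hE (source x) zero_le_one hN).2
  obtain ⟨r, hr⟩ : ∃ r, r = modDijkstra g (source x) 1 := ⟨_, rfl⟩
  rw [← hr] at hD hdc
  obtain ⟨hTmem, hTlen, hTcost⟩ := reachedTerminals_spec g r.val.1
  obtain ⟨T, hT⟩ : ∃ T, T = reachedTerminals g r.val.1 := ⟨_, rfl⟩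
  rw [← hT] at hTmem hTlen hTcost
  have hdist : ∀ e ∈ T.val, e.name ≠ x → 0 < e.dist := by
    intro e he hne
    obtain ⟨h1, -, h2⟩ := (hTmem e).1 he
    obtain ⟨w, hw, -⟩ := hD.climb _ _ h1 h2
    rw [← hw]
    refine pathLength_pos hE.len_pos w fun h3 => hne h3.eq.symm
  have hinit : (forEach (fun A y => wr A y (none : Option ℝ)) (fun _ => none) g.verts).cost
      ≤ 2 * g.verts.length := forEach_cost_le (c := 1) _ _ fun _ _ _ => le_rfl
  have hn1 : 1 ≤ g.verts.length := List.length_pos_iff.2 (List.ne_nil_of_mem hx)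
  have hsize : g.verts.length ≤ graphSize N g :=
    (Nat.le_mul_of_pos_right _ (by omega)).trans (Nat.le_add_left _ _)
  have hmain : ∀ y : ENNReal, y ≤ ((80 * g.verts.length : ℕ) : ENNReal) →
      ((forEach (fun A y => wr A y (none : Option ℝ)) (fun _ => none) g.verts).cost : ENNReal) +
        (((1 : ℕ) : ENNReal) + ((r.cost : ENNReal) + ((T.cost : ENNReal) + (((1 : ℕ) : ENNReal) + y))))
      ≤ ((500 * graphSize N g : ℕ) : ENNReal) := by
    intro y hy
    have h1 : (forEach (fun A y => wr A y (none : Option ℝ)) (fun _ => none) g.verts).cost +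
        (1 + (r.cost + (T.cost + (1 + 80 * g.verts.length)))) ≤ 500 * graphSize N g := by omega
    refine le_trans ?_ (Nat.cast_le.2 h1)
    rw [Nat.cast_add, Nat.cast_add, Nat.cast_add, Nat.cast_add, Nat.cast_add]
    gcongr
  rw [Rand.expectedCost_eq_wp]
  simp only [vertexSteepestPath, Rand.wp_bind, Rand.wp_det, wr_cost, rd_cost, hsrc, ← hr, ← hT,
    rd_val]
  apply hmain
  have hcl : ∀ (p : V → Option V) (y : V), (climb p g.verts.length y []).cost
      ≤ 2 * g.verts.length := fun p y => climb_cost_le p _ y []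
  have hcllen : ∀ (p : V → Option V) (y : V), (climb p g.verts.length y []).val.length
      ≤ g.verts.length := fun p y => climb_length_le p _ y []
  cases hv : g.volt x with
  | some a =>
    have hf : (filterT (fun t => op (decide (t.name ≠ x))) T.val).cost ≤ 2 * T.val.length :=
      filterT_cost_le (c := 1) _ fun _ _ => le_rfl
    have hfl : (filterT (fun t => op (decide (t.name ≠ x))) T.val).val.length ≤ T.val.length := by
      rw [filterT_val]
      exact List.length_filter_le _ _
    obtain ⟨T', hT'⟩ : ∃ T', T' = filterT (fun t => op (decide (t.name ≠ x))) T.val := ⟨_, rfl⟩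
    rw [← hT'] at hf hfl
    have ha : (argBest larger (terminalGradient a) T'.val).cost ≤ 6 * T'.val.length :=
      argBest_cost_le (c := 3) _ _ fun _ _ => le_rfl
    have hsum : ∀ y : ENNReal, y ≤ ((5 * g.verts.length : ℕ) : ENNReal) →
        (T'.cost : ENNReal) + (((argBest larger (terminalGradient a) T'.val).cost : ENNReal) + y)
          ≤ ((80 * g.verts.length : ℕ) : ENNReal) := by
      intro y hy
      have h1 : T'.cost + ((argBest larger (terminalGradient a) T'.val).cost
          + 5 * g.verts.length) ≤ 80 * g.verts.length := by omega
      refine le_trans ?_ (Nat.cast_le.2 h1)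
      rw [Nat.cast_add, Nat.cast_add]
      gcongr
    simp only [Rand.wp_bind, Rand.wp_det, ← hT']
    apply hsum
    cases (argBest larger (terminalGradient a) T'.val).val with
    | none => exact (Rand.wp_pure _ _).le.trans zero_le
    | some p =>
      obtain ⟨y, α⟩ := p
      have h1 := hcl r.val.2 y.name
      have h2 := pushAll_cost_le [] (climb r.val.2 g.verts.length y.name []).val
      have h3 := hcllen r.val.2 y.name
      simp only [Rand.wp_bind, Rand.wp_det, op_val, op_cost]
      by_cases hle : y.volt ≤ a
      · simp only [hle, decide_true, if_true, Rand.wp_pure, add_zero]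
        exact_mod_cast show _ + 1 ≤ 5 * g.verts.length by omega
      · simp only [hle, decide_false, Bool.false_eq_true, if_false, Rand.wp_bind, Rand.wp_det,
          Rand.wp_pure, add_zero]
        exact_mod_cast show _ + (1 + _) ≤ 5 * g.verts.length by omega
  | none =>
    have hpos : ∀ e ∈ T.val, 0 < e.dist := fun e he => hdist e he fun h => by
      have := ((hTmem e).1 he).2.1
      rw [h, hv] at this
      cases this
    have hTne : T.val ≠ [] := by
      obtain ⟨t, ht, hreach⟩ := hg.reach x hx
      obtain ⟨b, hb⟩ := Option.ne_none_iff_exists'.1 ht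
      obtain ⟨w⟩ := hreach.symm
      have h1 := hD.le_walk t w
      cases hd : r.val.1 t with
      | top => rw [hd] at h1; simp at h1
      | coe d => exact List.ne_nil_of_mem ((hTmem ⟨t, b, d⟩).2 ⟨hE.walk_right_mem w hx, hb, hd⟩)
    simp only [Rand.wp_bind]
    refine (Rand.wp_le (P := fun _ => True) (fun _ _ => trivial)
      (starSteepestPath_expectedCost_le T.val.length T.val hTne hpos)
      (B := ((6 * g.verts.length : ℕ) : ENNReal)) ?_).trans ?_
    · rintro (_ | ⟨t₁, t₂, α⟩) -
      · exact (Rand.wp_pure _ _).le.trans zero_le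
      · have h1 := hcl r.val.2 t₁.name
        have h2 := hcl r.val.2 t₂.name
        have h3 := pushAll_cost_le (climb r.val.2 g.verts.length t₂.name []).val
          (climb r.val.2 g.verts.length t₁.name []).val.tail
        have h4 := hcllen r.val.2 t₁.name
        rw [List.length_tail] at h3
        simp only [Rand.wp_bind, Rand.wp_det, Rand.wp_pure, add_zero]
        exact_mod_cast show _ + (_ + _) ≤ 6 * g.verts.length by omega
    · have h1 : 52 * T.val.length + 6 * g.verts.length ≤ 80 * g.verts.length := by omega
      refine le_trans (le_of_eq ?_) (Nat.cast_le.2 h1)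
      push_cast
      norm_num

end VertexPath

/-! ### The subgraph of high pressure -/

section Press

variable {V : Type} [DecidableEq V] {g : GraphData V} {H : SimpleGraph V} {len : Sym2 V → ℝ}

/-- The edges of `H` between vertices that satisfy `p`. -/
def pressGraph (H : SimpleGraph V) (p : V → Bool) : SimpleGraph V where
  Adj x y := H.Adj x y ∧ p x = true ∧ p y = true
  symm := ⟨fun _ _ h => ⟨h.1.symm, h.2.2, h.2.1⟩⟩
  loopless := ⟨fun _ h => H.irrefl h.1⟩

theorem exists_walk_pressGraph {p : V → Bool} {s t : V} (w : H.Walk s t)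
    (h : ∀ z ∈ w.support, p z = true) : ∃ w' : (pressGraph H p).Walk s t,
      w'.support = w.support ∧ pathLength len w' = pathLength len w := by
  induction w with
  | nil => exact ⟨SimpleGraph.Walk.nil, rfl, rfl⟩
  | @cons s u t hsu w ih =>
    obtain ⟨w', h1, h2⟩ := ih fun z hz => h z (by simp [hz])
    have hs : p s = true := h s (SimpleGraph.Walk.start_mem_support _)
    have hu : p u = true := h u (by simp)
    have hadj : (pressGraph H p).Adj s u := ⟨hsu, hs, hu⟩
    refine ⟨SimpleGraph.Walk.cons hadj w', ?_, ?_⟩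
    · simp [h1]
    · rw [pathLength_cons, pathLength_cons, h2]

theorem exists_walk_of_pressGraph {p : V → Bool} {s t : V} (w : (pressGraph H p).Walk s t) :
    ∃ w' : H.Walk s t, w'.support = w.support ∧ pathLength len w' = pathLength len w := by
  induction w with
  | nil => exact ⟨SimpleGraph.Walk.nil, rfl, rfl⟩
  | cons h w ih =>
    obtain ⟨w', h1, h2⟩ := ih
    refine ⟨SimpleGraph.Walk.cons h.1 w', ?_, ?_⟩
    · simp [h1]
    · rw [pathLength_cons, pathLength_cons, h2]

/-- The vertices on terminal paths of gradient larger than `α`. -/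
noncomputable def GraphData.high (g : GraphData V) (H : SimpleGraph V) (len : Sym2 V → ℝ) (α : ℝ)
    (x : V) : Bool := @decide (¬ g.Bounded H len x α) (Classical.propDecidable _)

theorem high_eq_true {α : ℝ} {x : V} : g.high H len α x = true ↔ ¬ g.Bounded H len x α :=
  @decide_eq_true_iff _ (Classical.propDecidable _)

/-- Cutting the walk at `z` exhibits it as a terminal walk through `z`. So no vertex of a walk
steeper than `α` is discarded. -/
theorem high_of_steep {α : ℝ} {s t : V} {a b : ℝ} (ha : g.volt s = some a)
    (hb : g.volt t = some b) (w : H.Walk s t) (hw : α * pathLength len w < a - b) {z : V}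
    (hz : z ∈ w.support) : g.high H len α z = true := by
  rw [high_eq_true]
  intro h
  have h1 := h s t a b ha hb (w.takeUntil z hz) (w.dropUntil z hz)
  rw [← pathLength_append, SimpleGraph.Walk.take_spec] at h1
  exact absurd hw (not_lt.2 h1)

/-- Terminals and walks that attain `vLow` and `vHigh` at `x` join to a walk through `x`, and a
strict gap between the two values says that its gradient exceeds `α`. Conversely, each half of a
steep walk bounds one of the values. If one value is `⊤`, the sum is `⊤` and the test fails. -/
theorem low_add_negHigh_lt_iff (hg : g.Encodes H len) {α : ℝ} {v₁ : V → Option ℝ}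
    (hv : ∀ y, v₁ y = if y ∈ g.verts then (g.volt y).map fun a => -a else none)
    {r r' : (V → WithTop ℝ) × (V → Option V)} (hr : DijkstraSpec g H len g.volt α r)
    (hr' : DijkstraSpec g H len v₁ α r') {x : V} (hx : x ∈ g.verts) :
    r.1 x + r'.1 x < 0 ↔ ¬ g.Bounded H len x α := by
  constructor
  · intro h hb
    cases h1 : r.1 x with
    | top => rw [h1, WithTop.top_add] at h; simp at h
    | coe c =>
      cases h2 : r'.1 x with
      | top => rw [h2, WithTop.add_top] at h; simp at h
      | coe d =>
        obtain ⟨t, -, b, ht, q, hq⟩ := hr.walk x hx c h1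
        obtain ⟨s, hs', a, hs, p, hp⟩ := hr'.walk x hx d h2
        rw [hv, if_pos hs', Option.map_eq_some_iff] at hs
        obtain ⟨a', ha', rfl⟩ := hs
        have h3 := hb s t a' b ha' ht p q.reverse
        rw [h1, h2, ← WithTop.coe_add, ← WithTop.coe_zero, WithTop.coe_lt_coe] at h
        rw [pathLength_reverse] at h3
        linarith
  · intro h
    simp only [GraphData.Bounded] at h
    push Not at h
    obtain ⟨s, t, a, b, ha, hb, p, q, h⟩ := h
    have hs := hg.walk_left_mem p hx
    have ht := hg.walk_right_mem q hx
    have h1 : r.1 x ≤ ((b + α * pathLength len q : ℝ) : WithTop ℝ) := by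
      have := hr.le_walk q.reverse
      rw [pathLength_reverse] at this
      refine this.trans ?_
      rw [WithTop.coe_add]
      gcongr
      exact hr.term t ht b hb
    have h2 : r'.1 x ≤ ((-a + α * pathLength len p : ℝ) : WithTop ℝ) := by
      refine (hr'.le_walk p).trans ?_
      rw [WithTop.coe_add]
      gcongr
      exact hr'.term s hs (-a) (by rw [hv, if_pos hs, ha]; rfl)
    refine (add_le_add h1 h2).trans_lt ?_
    rw [← WithTop.coe_add, ← WithTop.coe_zero, WithTop.coe_lt_coe]
    linarith

theorem forEach_cost_le_sum {σ β : Type} {body : σ → β → Timed σ} {c : β → ℕ} (l : List β) (s : σ)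
    (h : ∀ s, ∀ a ∈ l, (body s a).cost ≤ c a) :
    (forEach body s l).cost ≤ (l.map fun a => c a + 1).sum := by
  induction l generalizing s with
  | nil => simp
  | cons a l ih =>
    have h1 := h s a (by simp)
    have h2 := ih (body s a).val fun s b hb => h s b (by simp [hb])
    rw [forEach_cons_cost, List.map_cons, List.sum_cons]
    omega

/-- The voltages used in `compNegVHigh`. -/
theorem negate_loop_spec (g : GraphData V) {body : (V → Option ℝ) → V → Timed (V → Option ℝ)}
    (hbody : body = fun A x => do
      let q ← rd g.volt x
      match q with
      | none => wr A x (none : Option ℝ)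
      | some a => do
        let b ← op (-a)
        wr A x (some b)) :
    (∀ y, (forEach body (fun _ => none) g.verts).val y
      = if y ∈ g.verts then (g.volt y).map fun a => -a else none) ∧
    (forEach body (fun _ => none) g.verts).cost ≤ 4 * g.verts.length := by
  constructor
  · intro y
    rw [forEach_update_val fun x => (g.volt x).map fun a => -a]
    intro A x
    subst hbody
    cases h : g.volt x <;> simp [h]
  · refine forEach_cost_le (c := 3) _ _ fun A x _ => ?_
    subst hbody
    cases h : g.volt x <;> simp [h]

/-- Two runs of Dijkstra's algorithm cost 800 times the size; the loops over vertices, edges and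
adjacency lists fit into the remaining 30. The adjacency array is written only at surviving
vertices, so it is described only there. -/
theorem compHighPressGraph_spec (hg : g.Encodes H len) {α : ℝ} (hα : 0 ≤ α) {N : ℕ}
    (hN : g.verts.length ≤ N) :
    (compHighPressGraph g α).val.verts = g.verts.filter (g.high H len α) ∧
    (compHighPressGraph g α).val.edges
      = g.edges.filter (fun e => g.high H len α e.1 && g.high H len α e.2) ∧
    (∀ x ∈ g.verts, g.high H len α x = true →
      (compHighPressGraph g α).val.adj x = (g.adj x).filter fun e => g.high H len α e.1) ∧
    (compHighPressGraph g α).val.volt = g.volt ∧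
    (compHighPressGraph g α).cost ≤ 830 * graphSize N g := by
  obtain ⟨hr, hrc⟩ := modDijkstra_spec hg g.volt hα hN
  obtain ⟨body₁, hbody₁⟩ : ∃ body : (V → Option ℝ) → V → Timed (V → Option ℝ),
    body = (fun A x => do
      let q ← rd g.volt x
      match q with
      | none => wr A x (none : Option ℝ)
      | some a => do
        let b ← op (-a)
        wr A x (some b)) := ⟨_, rfl⟩
  obtain ⟨hv, hvc⟩ := negate_loop_spec g hbody₁
  obtain ⟨hr', hrc'⟩ := modDijkstra_spec hg (forEach body₁ (fun _ => none) g.verts).val hα hN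
  obtain ⟨r, hrdef⟩ : ∃ r, r = (modDijkstra g g.volt α).val := ⟨_, rfl⟩
  obtain ⟨r', hrdef'⟩ : ∃ r', r' =
    (modDijkstra g (forEach body₁ (fun _ => none) g.verts).val α).val := ⟨_, rfl⟩
  have hneg : (compNegVHigh g α).val = r'.1 ∧ (compNegVHigh g α).cost
      ≤ 4 * g.verts.length + 400 * graphSize N g := by
    have : compNegVHigh g α = (do
        let v₁ ← forEach body₁ (fun _ => none) g.verts
        let r ← modDijkstra g v₁ α
        pure r.1) := by rw [hbody₁]; rfl
    rw [this, hrdef']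
    refine ⟨rfl, ?_⟩
    simp only [Timed.bind_cost, Timed.pure_cost]
    omega
  rw [← hrdef] at hr
  rw [← hrdef'] at hr'
  obtain ⟨body₂, hbody₂⟩ : ∃ body : (V → Bool) → V → Timed (V → Bool), body = (fun A x => do
    let a ← rd r.1 x
    let b ← rd r'.1 x
    let c ← op (a + b)
    let d ← op (decide (c < 0))
    wr A x d) := ⟨_, rfl⟩
  have hinside : ∀ x ∈ g.verts, (forEach body₂ (fun _ => false) g.verts).val x
      = g.high H len α x := by
    intro x hx
    rw [forEach_update_val fun x => decide (r.1 x + r'.1 x < 0)]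
    · simp only [hx, if_true]
      rw [Bool.eq_iff_iff, high_eq_true, ← low_add_negHigh_lt_iff hg hv hr hr' hx]
      exact decide_eq_true_iff
    · intro A x
      rw [hbody₂]
      rfl
  have hinsidec : (forEach body₂ (fun _ => false) g.verts).cost ≤ 6 * g.verts.length :=
    forEach_cost_le (c := 5) _ _ fun A x _ => by rw [hbody₂]; rfl
  obtain ⟨I, hI⟩ : ∃ I, I = (forEach body₂ (fun _ => false) g.verts).val := ⟨_, rfl⟩
  rw [← hI] at hinside
  have hfv : (filterT (fun x => rd I x) g.verts).val = g.verts.filter (g.high H len α) := by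
    rw [filterT_val]
    exact List.filter_congr hinside
  have hfvc : (filterT (fun x => rd I x) g.verts).cost ≤ 2 * g.verts.length :=
    filterT_cost_le (c := 1) _ fun _ _ => le_rfl
  obtain ⟨te, hte⟩ : ∃ te : V × V → Timed Bool, te = (fun e => do
      let a ← rd I e.1
      let b ← rd I e.2
      op (a && b)) := ⟨_, rfl⟩
  have hfe : (filterT te g.edges).val
      = g.edges.filter (fun e => g.high H len α e.1 && g.high H len α e.2) := by
    rw [filterT_val, hte]
    refine List.filter_congr fun e he => ?_
    have hadj : H.Adj e.1 e.2 := (hg.mem_edges _ _).2 (Or.inl he)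
    rw [← hinside e.1 (hg.left_mem _ _ hadj), ← hinside e.2 (hg.right_mem hadj)]
    rfl
  have hfec : (filterT te g.edges).cost ≤ 4 * g.edges.length :=
    filterT_cost_le (c := 3) _ fun _ _ => by rw [hte]; rfl
  obtain ⟨body₃, hbody₃⟩ : ∃ body : (V → List (V × ℝ)) → V → Timed (V → List (V × ℝ)),
    body = (fun A x => do
      let l ← rd g.adj x
      let l' ← filterT (fun e => rd I e.1) l
      wr A x l') := ⟨_, rfl⟩
  have hadj : ∀ x ∈ g.verts, g.high H len α x = true →
      (forEach body₃ (fun _ => []) (g.verts.filter (g.high H len α))).val x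
        = (g.adj x).filter fun e => g.high H len α e.1 := by
    intro x hx hp
    rw [forEach_update_val fun x => (g.adj x).filter fun e => I e.1]
    · refine (if_pos (List.mem_filter.2 ⟨hx, hp⟩)).trans ?_
      refine List.filter_congr fun e he => hinside _ ?_
      exact hg.right_mem ((hg.mem_adj x hx e.1 e.2).1 he).1
    · intro A x
      rw [hbody₃]
      simp only [Timed.bind_val, rd_val, wr_val, filterT_val]
  have hadjc : (forEach body₃ (fun _ => []) (g.verts.filter (g.high H len α))).cost
      ≤ 3 * g.verts.length + 4 * g.edges.length := by
    refine (forEach_cost_le_sum (c := fun x => 2 * (g.adj x).length + 2) _ _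
      fun A x _ => ?_).trans ?_
    · have : (filterT (fun e => rd I e.1) (g.adj x)).cost ≤ 2 * (g.adj x).length :=
        filterT_cost_le (c := 1) _ fun _ _ => le_rfl
      rw [hbody₃]
      simp only [Timed.bind_cost, rd_cost, wr_cost, rd_val]
      omega
    · refine (List.Sublist.sum_le_sum (List.filter_sublist.map _) fun _ _ => Nat.zero_le _).trans ?_
      rw [← List.sum_toFinset _ hg.verts_nodup]
      have h1 := hg.sum_length_adj_le
      have h2 : g.verts.toFinset.card = g.verts.length := List.toFinset_card_of_nodup hg.verts_nodup
      rw [Finset.sum_add_distrib, Finset.sum_add_distrib, ← Finset.mul_sum, Finset.sum_const,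
        Finset.sum_const, h2]
      simp only [smul_eq_mul]
      omega
  have hval : (compHighPressGraph g α).val =
      { verts := g.verts.filter (g.high H len α)
        edges := g.edges.filter (fun e => g.high H len α e.1 && g.high H len α e.2)
        adj := (forEach body₃ (fun _ => []) (g.verts.filter (g.high H len α))).val
        volt := g.volt } := by
    rw [← hfe, ← hfv, hbody₃, hte, hI, hbody₂, ← hneg.1, hrdef]
    rfl
  have hn : g.verts.length ≤ graphSize N g :=
    (Nat.le_mul_of_pos_right _ (by omega)).trans (Nat.le_add_left _ _)
  have hm : g.verts.length + g.edges.length ≤ graphSize N g := by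
    have : g.verts.length ≤ g.verts.length * (Nat.log 2 N + 1) :=
      Nat.le_mul_of_pos_right _ (by omega)
    unfold graphSize
    omega
  have hcost : (compHighPressGraph g α).cost = (modDijkstra g g.volt α).cost +
      ((compNegVHigh g α).cost + ((forEach body₂ (fun _ => false) g.verts).cost +
      ((filterT (fun x => rd I x) g.verts).cost + ((filterT te g.edges).cost +
      (forEach body₃ (fun _ => []) (g.verts.filter (g.high H len α))).cost)))) := by
    rw [← hfv, hbody₃, hte, hI, hbody₂, ← hneg.1, hrdef]
    rfl
  refine ⟨by rw [hval], by rw [hval], fun x hx hp => ?_, by rw [hval], ?_⟩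
  · rw [hval]
    exact hadj x hx hp
  · rw [hcost]
    have := hneg.2
    omega

/-- Well-posedness is the point: a surviving vertex lies on a terminal walk steeper than `α`, which
survives entirely and connects it to a terminal. -/
theorem GraphData.Inst.compHighPressGraph (hg : g.Inst H len) {α : ℝ} (hα : 0 ≤ α) :
    (compHighPressGraph g α).val.Inst (pressGraph H (g.high H len α)) len := by
  obtain ⟨h1, h2, h3, h4, -⟩ := compHighPressGraph_spec hg.enc hα le_rfl
  have hE := hg.enc
  refine ⟨⟨?_, ?_, ?_, ?_, ?_, ?_⟩, ?_, ?_⟩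
  · rw [h1]
    exact hE.verts_nodup.filter _
  · intro x y h
    rw [h1]
    exact List.mem_filter.2 ⟨hE.left_mem x y h.1, h.2.1⟩
  · intro x hx
    rw [h1, List.mem_filter] at hx
    rw [h3 x hx.1 hx.2]
    exact (hE.adj_nodup x hx.1).filter _
  · intro x hx y a
    rw [h1, List.mem_filter] at hx
    rw [h3 x hx.1 hx.2, List.mem_filter, hE.mem_adj x hx.1]
    constructor
    · rintro ⟨⟨h5, h6⟩, h7⟩
      exact ⟨⟨h5, hx.2, h7⟩, h6⟩
    · rintro ⟨⟨h5, -, h7⟩, h6⟩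
      exact ⟨⟨h5, h6⟩, h7⟩
  · intro x y
    rw [h2, List.mem_filter, List.mem_filter, Bool.and_eq_true, Bool.and_eq_true]
    change H.Adj x y ∧ _ ∧ _ ↔ _
    rw [hE.mem_edges]
    tauto
  · intro x y h
    exact hE.len_pos x y h.1
  · intro x y h
    rw [h4]
    exact hg.noTT x y h.1
  · intro x hx
    rw [h1, List.mem_filter, high_eq_true, GraphData.Bounded] at hx
    obtain ⟨-, hx⟩ := hx
    push Not at hx
    obtain ⟨s, t, a, b, ha, hb, p, q, h⟩ := hx
    rw [← pathLength_append] at h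
    obtain ⟨w, hw, -⟩ := exists_walk_pressGraph (len := len) (p.append q)
      fun z hz => high_of_steep ha hb (p.append q) h hz
    have hxw : x ∈ w.support := by
      rw [hw, SimpleGraph.Walk.mem_support_append_iff]
      exact Or.inl p.end_mem_support
    exact ⟨s, by rw [h4, IsTerminal, ha]; simp, ⟨w.takeUntil x hxw⟩⟩

end Press

/-! ### Correctness and expected cost of the recursion -/

section Steepest

variable {V : Type} [DecidableEq V] {g : GraphData V} {H : SimpleGraph V} {len : Sym2 V → ℝ}

/-- The best result of runs of `vertexSteepestPath` from the vertices in `X`. -/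
structure BestSpec (g : GraphData V) (H : SimpleGraph V) (len : Sym2 V → ℝ) (X : Set V)
    (o : Option (List V × ℝ)) : Prop where
  none : o = none → ∀ x ∈ X, IsTerminal g.volt x ∧ ∀ α, 0 ≤ α → g.Bounded H len x α
  some : ∀ P α, o = some (P, α) →
    0 ≤ α ∧ (∀ x ∈ X, g.Bounded H len x α) ∧ IsPathOfGradient g H len P α

theorem VertexSpec.bestSpec {x : V} {o : Option (List V × ℝ)} (h : VertexSpec g H len x o) :
    BestSpec g H len {x} o := by
  refine ⟨fun ho y hy => ?_, fun P α ho => ?_⟩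
  · rw [Set.mem_singleton_iff.1 hy]
    exact h.none ho
  · obtain ⟨h1, h2, h3⟩ := h.some P α ho
    exact ⟨h1, fun y hy => by rwa [Set.mem_singleton_iff.1 hy], h3⟩

theorem steeper_cost_le (p q : Option (List V × ℝ)) : (steeper p q).cost ≤ 2 := by
  cases p with
  | none => simp [steeper]
  | some p =>
    cases q with
    | none => simp [steeper]
    | some q => by_cases h : p.2 < q.2 <;> simp [steeper, h]

/-- The larger gradient bounds both sides by monotonicity, and a missing candidate means that every
nonnegative `α` is a bound there. -/
theorem BestSpec.steeper (hg : g.Encodes H len) {X Y : Set V} {p q : Option (List V × ℝ)}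
    (hp : BestSpec g H len X p) (hq : BestSpec g H len Y q) :
    BestSpec g H len (X ∪ Y) (steeper p q).val := by
  cases p with
  | none =>
    refine ⟨fun ho x hx => ?_, fun P α ho => ?_⟩
    · rcases hx with hx | hx
      · exact hp.none rfl x hx
      · exact hq.none ho x hx
    · obtain ⟨h1, h2, h3⟩ := hq.some P α ho
      refine ⟨h1, fun x hx => ?_, h3⟩
      rcases hx with hx | hx
      · exact (hp.none rfl x hx).2 α h1
      · exact h2 x hx
  | some p =>
    cases q with
    | none =>
      refine ⟨fun ho => by simp [LexLearn.steeper] at ho, fun P α ho => ?_⟩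
      obtain ⟨h1, h2, h3⟩ := hp.some P α ho
      refine ⟨h1, fun x hx => ?_, h3⟩
      rcases hx with hx | hx
      · exact h2 x hx
      · exact (hq.none rfl x hx).2 α h1
    | some q =>
      obtain ⟨P, α⟩ := p
      obtain ⟨Q, β⟩ := q
      obtain ⟨h1, h2, h3⟩ := hp.some P α rfl
      obtain ⟨h4, h5, h6⟩ := hq.some Q β rfl
      by_cases h : α < β
      · have hval : (LexLearn.steeper (Option.some (P, α)) (Option.some (Q, β))).val = Option.some (Q, β) := by
          simp [LexLearn.steeper, h]
        rw [hval]
        refine ⟨by simp, fun P' α' ho => ?_⟩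
        simp only [Option.some.injEq, Prod.mk.injEq] at ho
        obtain ⟨rfl, rfl⟩ := ho
        refine ⟨h4, fun x hx => ?_, h6⟩
        rcases hx with hx | hx
        · exact (h2 x hx).mono hg h.le
        · exact h5 x hx
      · have hval : (LexLearn.steeper (Option.some (P, α)) (Option.some (Q, β))).val = Option.some (P, α) := by
          simp [LexLearn.steeper, h]
        rw [hval]
        refine ⟨by simp, fun P' α' ho => ?_⟩
        simp only [Option.some.injEq, Prod.mk.injEq] at ho
        obtain ⟨rfl, rfl⟩ := ho
        refine ⟨h1, fun x hx => ?_, h3⟩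
        rcases hx with hx | hx
        · exact h2 x hx
        · exact (h5 x hx).mono hg (not_lt.1 h)

/-- The path found in a round of `steepestPathAux`. -/
theorem round_best (hg : g.Inst H len) {e : V × V} (he : e ∈ g.edges) {x : V}
    {o₁ o₂ o₃ : Option (List V × ℝ)} (h₁ : VertexSpec g H len e.1 o₁)
    (h₂ : VertexSpec g H len e.2 o₂) (h₃ : VertexSpec g H len x o₃) :
    ∃ P α, (steeper (steeper o₁ o₂).val o₃).val = some (P, α) ∧ 0 ≤ α ∧
      g.Bounded H len e.1 α ∧ g.Bounded H len e.2 α ∧ g.Bounded H len x α ∧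
      IsPathOfGradient g H len P α := by
  have hb := (h₁.bestSpec.steeper hg.enc h₂.bestSpec).steeper hg.enc h₃.bestSpec
  obtain ⟨o, ho⟩ : ∃ o, o = (steeper (steeper o₁ o₂).val o₃).val := ⟨_, rfl⟩
  rw [← ho] at hb ⊢
  cases o with
  | none =>
    have h := hb.none rfl
    -- If no run returned a path, both ends of the drawn edge would be terminals, which is excluded.
    exact absurd ⟨(h e.1 (by simp)).1, (h e.2 (by simp)).1⟩
      (hg.noTT _ _ ((hg.enc.mem_edges _ _).2 (Or.inl he)))
  | some p =>
    obtain ⟨P, α⟩ := p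
    obtain ⟨h4, h5, h6⟩ := hb.some P α rfl
    exact ⟨P, α, rfl, h4, h5 _ (by simp), h5 _ (by simp), h5 _ (by simp), h6⟩

/-- `o` is the list of the vertices of a steepest terminal path. -/
def IsSteepest (g : GraphData V) (H : SimpleGraph V) (len : Sym2 V → ℝ) (o : Option (List V)) :
    Prop :=
  ∃ P β, o = some P ∧ 0 ≤ β ∧ IsPathOfGradient g H len P β ∧
    ∀ s t a b, g.volt s = some a → g.volt t = some b → ∀ w : H.Walk s t,
      a - b ≤ β * pathLength len w

theorem IsPathOfGradient.of_pressGraph (hg : g.Encodes H len) {g' : GraphData V}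
    (hvolt : g'.volt = g.volt) {p : V → Bool} {P : List V} {β : ℝ}
    (h : IsPathOfGradient g' (pressGraph H p) len P β) : IsPathOfGradient g H len P β := by
  obtain ⟨s, t, a, b, ha, hb, w, hw, rfl, hl⟩ := h
  rw [hvolt] at ha hb
  obtain ⟨w', h1, h2⟩ := exists_walk_of_pressGraph (len := len) w
  refine ⟨s, t, a, b, ha, hb, w', not_nil_of_pathLength_pos (len := len) w' ?_, h1.symm, by rw [h2, hl]⟩
  rw [h2]
  exact pathLength_pos (fun x y (h : (pressGraph H p).Adj x y) => hg.len_pos x y h.1) w hw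

/-- A walk steeper than `α ≥ 0` would survive in the subgraph. It is not trivial, since a trivial
walk has voltage drop `0`, so the subgraph would have an edge. -/
theorem isSteepest_of_high_edges_nil (hg : g.Inst H len) {P : List V} {α : ℝ} (hα : 0 ≤ α)
    (hP : IsPathOfGradient g H len P α) (h : (compHighPressGraph g α).val.edges = []) :
    IsSteepest g H len (some P) := by
  refine ⟨P, α, rfl, hα, hP, fun s t a b ha hb w => ?_⟩
  by_contra! hlt
  obtain ⟨w', -, -⟩ := exists_walk_pressGraph (len := len) w fun z hz => high_of_steep ha hb w hlt hz
  have hE := (hg.compHighPressGraph hα).enc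
  cases w' with
  | nil =>
    rw [ha] at hb
    cases hb
    rw [sub_self] at hlt
    exact absurd hlt (not_lt.2 (mul_nonneg hα (pathLength_nonneg hg.enc.len_pos w)))
  | cons hadj _ =>
    rcases (hE.mem_edges _ _).1 hadj with h1 | h1 <;> rw [h] at h1 <;> cases h1

/-- An end of a surviving edge lies on a walk steeper than `α`, and this walk survives, so `α ≤ β`.
Walks of gradient at most `α` are then harmless, and steeper ones were compared in the subgraph. -/
theorem IsSteepest.of_high (hg : g.Inst H len) {α : ℝ} (hα : 0 ≤ α)
    (hne : (compHighPressGraph g α).val.edges ≠ []) {o : Option (List V)}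
    (h : IsSteepest (compHighPressGraph g α).val (pressGraph H (g.high H len α)) len o) :
    IsSteepest g H len o := by
  obtain ⟨hverts, -, -, hvolt, -⟩ := compHighPressGraph_spec hg.enc hα le_rfl
  have hI := hg.compHighPressGraph hα
  obtain ⟨P, β, rfl, hβ, hP, hmax⟩ := h
  have hlift : ∀ s t a b, g.volt s = some a → g.volt t = some b → ∀ w : H.Walk s t,
      α * pathLength len w < a - b → a - b ≤ β * pathLength len w := by
    intro s t a b ha hb w hw
    obtain ⟨w', -, h2⟩ := exists_walk_pressGraph (len := len) w
      fun z hz => high_of_steep ha hb w hw hz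
    rw [← h2]
    exact hmax s t a b (by rw [hvolt, ha]) (by rw [hvolt, hb]) w'
  have hαβ : α ≤ β := by
    obtain ⟨e, he⟩ := List.exists_mem_of_ne_nil _ hne
    have hadj := (hI.enc.mem_edges e.1 e.2).2 (Or.inl he)
    have h1 := high_eq_true.1 hadj.2.1
    rw [GraphData.Bounded] at h1
    push Not at h1
    obtain ⟨s, t, a, b, ha, hb, p, q, h1⟩ := h1
    rw [← pathLength_append] at h1
    have h2 := hlift s t a b ha hb _ h1
    by_contra! h3
    have := mul_le_mul_of_nonneg_right h3.le (pathLength_nonneg hg.enc.len_pos (p.append q))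
    linarith
  refine ⟨P, β, rfl, hβ, hP.of_pressGraph hg.enc hvolt, fun s t a b ha hb w => ?_⟩
  by_cases hw : α * pathLength len w < a - b
  · exact hlift s t a b ha hb w hw
  · exact (not_lt.1 hw).trans
      (mul_le_mul_of_nonneg_right hαβ (pathLength_nonneg hg.enc.len_pos w))

theorem GraphData.Encodes.verts_ne_nil (hg : g.Encodes H len) (h : g.edges ≠ []) :
    g.verts ≠ [] := by
  obtain ⟨e, he⟩ := List.exists_mem_of_ne_nil _ h
  exact List.ne_nil_of_mem (hg.left_mem e.1 e.2 ((hg.mem_edges _ _).2 (Or.inl he)))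

theorem GraphData.Encodes.edge_mem (hg : g.Encodes H len) {e : V × V} (he : e ∈ g.edges) :
    e.1 ∈ g.verts ∧ e.2 ∈ g.verts := by
  have h := (hg.mem_edges e.1 e.2).2 (Or.inl he)
  exact ⟨hg.left_mem _ _ h, hg.right_mem h⟩

/-- Applied to the drawn vertex, this bounds the depth of the recursion for every outcome of the
draws. -/
theorem high_verts_length_lt (hg : g.Inst H len) {α : ℝ} (hα : 0 ≤ α) {x : V} (hx : x ∈ g.verts)
    (hb : g.Bounded H len x α) :
    (LexLearn.compHighPressGraph g α).val.verts.length < g.verts.length := by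
  obtain ⟨hverts, -⟩ := compHighPressGraph_spec hg.enc hα le_rfl
  rw [hverts, List.length_filter_lt_length_iff_exists]
  refine ⟨x, hx, ?_⟩
  rw [high_eq_true]
  exact fun h => h hb

theorem steepestPathAux_always : ∀ (n : ℕ) (g : GraphData V) (H : SimpleGraph V), g.Inst H len →
    g.edges ≠ [] → g.verts.length ≤ n →
    (steepestPathAux n g).Always (IsSteepest g H len) := by
  intro n
  induction n with
  | zero =>
    intro g H hg hne hn
    exact absurd (List.length_eq_zero_iff.1 (Nat.le_zero.1 hn)) (hg.enc.verts_ne_nil hne)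
  | succ n ih =>
    intro g H hg hne hn
    refine Rand.always_bind ((Rand.always_pick hne).mono ?_)
    rintro _ ⟨e, he, rfl⟩
    refine Rand.always_bind ((Rand.always_pick (hg.enc.verts_ne_nil hne)).mono ?_)
    rintro _ ⟨x, hx, rfl⟩
    obtain ⟨he1, he2⟩ := hg.enc.edge_mem he
    refine Rand.always_bind ((vertexSteepestPath_always hg he1).mono fun o₁ h₁ => ?_)
    refine Rand.always_bind ((vertexSteepestPath_always hg he2).mono fun o₂ h₂ => ?_)
    refine Rand.always_bind ((vertexSteepestPath_always hg hx).mono fun o₃ h₃ => ?_)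
    refine Rand.always_bind (Rand.always_det (Rand.always_bind (Rand.always_det ?_)))
    obtain ⟨P, α, hval, hα, -, -, hb, hP⟩ := round_best hg he h₁ h₂ h₃
    rw [hval]
    refine Rand.always_bind (Rand.always_det ?_)
    cases hedges : (compHighPressGraph g α).val.edges with
    | nil => exact Rand.always_pure (isSteepest_of_high_edges_nil hg hα hP hedges)
    | cons _ _ =>
      have hne' : (compHighPressGraph g α).val.edges ≠ [] := by rw [hedges]; simp
      have := high_verts_length_lt hg hα hx hb
      exact (ih _ _ (hg.compHighPressGraph hα) hne' (by omega)).mono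
        fun o ho => ho.of_high hg hα hne'

/-- The size with fixed `N` is linear in the numbers of edges and vertices, so its expected value
halves. The constant 2400 comes from `2 + 2334 S + 2400 S ≤ 4800 S`, where 2 pays for the draws and
`2334 S` for the rest of the round. -/
theorem steepestPathAux_expectedCost_le {N : ℕ} : ∀ (n : ℕ) (g : GraphData V) (H : SimpleGraph V),
    g.Inst H len → g.edges ≠ [] → g.verts.length ≤ N →
    (steepestPathAux n g).expectedCost ≤ 2 * 2400 * ((graphSize N g : ℕ) : ENNReal) := by
  intro n
  induction n with
  | zero =>
    intro g H _ _ _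
    rw [Rand.expectedCost_eq_wp]
    exact (Rand.wp_pure _ _).le.trans zero_le
  | succ n ih =>
    intro g H hg hne hN
    obtain ⟨L, hL⟩ : ∃ L, L = Nat.log 2 N + 1 := ⟨_, rfl⟩
    obtain ⟨S, hS⟩ : ∃ S, S = graphSize N g := ⟨_, rfl⟩
    have hSmn : S = g.edges.length + g.verts.length * L := by rw [hS, hL]; rfl
    obtain ⟨R, hRdef⟩ : ∃ R : V → V → Bool, ∀ x y, R x y = true ↔
        ∃ α, 0 ≤ α ∧ g.Bounded H len x α ∧ ¬ g.Bounded H len y α :=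
      ⟨fun x y => @decide _ (Classical.propDecidable _),
        fun x y => @decide_eq_true_iff _ (Classical.propDecidable _)⟩
    -- Edges are compared by the larger steepness of their two ends. This is why both ends of the
    -- drawn edge are searched.
    obtain ⟨Q, hQdef⟩ : ∃ Q : V × V → V × V → Bool, ∀ e f, Q e f = true ↔
        ∃ α, 0 ≤ α ∧ (g.Bounded H len e.1 α ∧ g.Bounded H len e.2 α) ∧
          ¬ (g.Bounded H len f.1 α ∧ g.Bounded H len f.2 α) :=
      ⟨fun x y => @decide _ (Classical.propDecidable _),
        fun x y => @decide_eq_true_iff _ (Classical.propDecidable _)⟩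
    have hR : ∀ x y, R x y = true → R y x = false := by
      intro x y h
      rw [hRdef] at h
      rw [← Bool.not_eq_true, hRdef]
      exact threshold_asymm (fun x α α' _ h hb => hb.mono hg.enc h) h
    have hQ : ∀ e f, Q e f = true → Q f e = false := by
      intro e f h
      rw [hQdef] at h
      rw [← Bool.not_eq_true, hQdef]
      exact threshold_asymm
        (P := fun (e : V × V) α => g.Bounded H len e.1 α ∧ g.Bounded H len e.2 α)
        (fun e α α' _ h hb => ⟨hb.1.mono hg.enc h, hb.2.mono hg.enc h⟩) h
    have hround : ∀ e ∈ g.edges, ∀ x ∈ g.verts,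
        ((do
          let P₁ ← vertexSteepestPath g e.1
          let P₂ ← vertexSteepestPath g e.2
          let P₃ ← vertexSteepestPath g x
          let P₁₂ ← det (steeper P₁ P₂)
          let best ← det (steeper P₁₂ P₃)
          match best with
          | none => pure none
          | some (P, α) => do
            let g' ← det (compHighPressGraph g α)
            match g'.edges with
            | [] => pure (some P)
            | _ :: _ => steepestPathAux n g') : Rand (Option (List V))).wp (fun _ => 0)
        ≤ (((2334 * S : ℕ) : ENNReal) + 2 * 2400 * (g.edges.countP (Q e) : ℕ)) +
          2 * (2400 * (L : ℕ)) * (g.verts.countP (R x) : ℕ) := by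
      intro e he x hx
      obtain ⟨he1, he2⟩ := hg.enc.edge_mem he
      have hbound : ∀ y ∈ g.verts, (vertexSteepestPath g y).expectedCost
          ≤ ((500 * S : ℕ) : ENNReal) := fun y hy => by
        rw [hS]
        exact vertexSteepestPath_expectedCost_le hg hy hN
      simp only [Rand.wp_bind]
      have hS1 : 1 ≤ S := by
        have := List.length_pos_iff.2 hne
        omega
      -- Three searches, two comparisons of at most 2 steps and the subgraph: `1500 S + 4 + 830 S ≤
      -- 2334 S`, as `S ≥ 1`.
      have hnat : 500 * S + (500 * S + (500 * S + (2 + (2 + (830 * S +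
          2 * 2400 * (g.edges.countP (Q e) + g.verts.countP (R x) * L))))))
          ≤ 2334 * S + 2 * 2400 * g.edges.countP (Q e) + 2 * (2400 * L) * g.verts.countP (R x) := by
        have : 2 * (2400 * L) * g.verts.countP (R x)
            = 2 * 2400 * (g.verts.countP (R x) * L) := by ring
        omega
      refine le_trans ?_ ((Nat.cast_le (α := ENNReal).2 hnat).trans
        (le_of_eq (by push_cast; ring)))
      rw [Nat.cast_add]
      refine Rand.wp_le (vertexSteepestPath_always hg he1) (hbound _ he1) fun o₁ h₁ => ?_
      rw [Nat.cast_add]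
      refine Rand.wp_le (vertexSteepestPath_always hg he2) (hbound _ he2) fun o₂ h₂ => ?_
      rw [Nat.cast_add]
      refine Rand.wp_le (vertexSteepestPath_always hg hx) (hbound _ hx) fun o₃ h₃ => ?_
      obtain ⟨P, α, hval, hα, hb1, hb2, hb3, hP⟩ := round_best hg he h₁ h₂ h₃
      obtain ⟨hverts, hedges, -, -, hcost⟩ := compHighPressGraph_spec hg.enc hα hN
      have hvl : (compHighPressGraph g α).val.verts.length ≤ g.verts.countP (R x) := by
        rw [hverts, ← List.countP_eq_length_filter]
        refine List.countP_mono_left fun y _ hy => ?_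
        exact (hRdef _ _).2 ⟨α, hα, hb3, high_eq_true.1 hy⟩
      have hel : (compHighPressGraph g α).val.edges.length ≤ g.edges.countP (Q e) := by
        rw [hedges, ← List.countP_eq_length_filter]
        refine List.countP_mono_left fun f _ hf => ?_
        rw [Bool.and_eq_true] at hf
        -- Both ends of a surviving edge are high; one of them is enough to violate the common bound
        -- of the drawn edge.
        exact (hQdef _ _).2 ⟨α, hα, ⟨hb1, hb2⟩, fun h => high_eq_true.1 hf.1 h.1⟩
      have hvN : (compHighPressGraph g α).val.verts.length ≤ N := by
        rw [hverts]
        exact (List.length_filter_le _ _).trans hN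
      have hsize : graphSize N (compHighPressGraph g α).val
          ≤ g.edges.countP (Q e) + g.verts.countP (R x) * L := by
        rw [graphSize, ← hL]
        gcongr
      rw [← hS] at hcost
      simp only [Rand.wp_det, hval, Rand.wp_bind]
      rw [Nat.cast_add, Nat.cast_add, Nat.cast_add]
      gcongr
      · exact steeper_cost_le _ _
      · exact steeper_cost_le _ _
      · cases hnil : (compHighPressGraph g α).val.edges with
        | nil => exact (Rand.wp_pure _ _).le.trans zero_le
        | cons _ _ =>
          have := ih _ _ (hg.compHighPressGraph hα) (by rw [hnil]; simp) hvN
          rw [Rand.expectedCost_eq_wp] at this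
          refine this.trans ?_
          rw [Nat.cast_mul]
          gcongr
          norm_num
    have hvne := hg.enc.verts_ne_nil hne
    rw [Rand.expectedCost_eq_wp, steepestPathAux, Rand.wp_bind, Rand.wp_pick hne, ← hS]
    -- For a given edge the mean is taken over the vertex first. This turns the vertex count into
    -- `2400 * L * n` and leaves an expression linear in the edge count for the outer mean.
    refine (add_le_add_right (ENNReal.div_le_div_right (sum_map_le_sum_map g.edges
      (f' := fun e => (1 + ((2334 * S : ℕ) : ENNReal) + 2400 * (L : ℕ) * (g.verts.length : ℕ)) +
        2 * 2400 * (g.edges.countP (Q e) : ℕ)) fun e he => ?_) _) _).trans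
      ((add_le_add_right (mean_countP_le Q hQ hne _ _) _).trans ?_)
    · rw [Rand.wp_bind, Rand.wp_pick hvne]
      refine (add_le_add_right (ENNReal.div_le_div_right (sum_map_le_sum_map g.verts
        fun x hx => hround e he x hx) _) _).trans
        ((add_le_add_right (mean_countP_le R hR hvne _ _) _).trans (le_of_eq ?_))
      ring
    · have hS1 : 1 ≤ S := by
        have := List.length_pos_iff.2 hne
        omega
      have hnat : 1 + ((1 + 2334 * S + 2400 * L * g.verts.length) + 2400 * g.edges.length)
          ≤ 2 * 2400 * S := by
        have : 2400 * L * g.verts.length = 2400 * (g.verts.length * L) := by ring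
        omega
      refine le_trans (le_of_eq ?_) ((Nat.cast_le (α := ENNReal).2 hnat).trans (le_of_eq ?_)) <;>
        push_cast <;> ring

end Steepest

/-! ### From encoded instances to the theorem -/

section Main

variable {V : Type} {G : SimpleGraph V} {len : Sym2 V → ℝ} {v₀ : V → Option ℝ}

theorem GraphData.Represents.inst [DecidableEq V] {g : GraphData V} (hg : g.Represents G len v₀)
    (hlen : ∀ e ∈ G.edgeSet, 0 < len e) (hwp : WellPosed G v₀)
    (hTT : ∀ x y : V, G.Adj x y → ¬ (IsTerminal v₀ x ∧ IsTerminal v₀ y)) : g.Inst G len := by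
  refine ⟨⟨hg.verts_nodup, fun x _ _ => hg.mem_verts x, fun x _ => hg.adj_nodup x,
    fun x _ => hg.mem_adj x, hg.mem_edges, fun x y h => hlen _ h⟩, ?_, fun x _ => ?_⟩
  · rw [hg.volt_eq]
    exact hTT
  · rw [hg.volt_eq]
    obtain ⟨t, h1, h2⟩ := hwp (G.connectedComponentMk x)
    exact ⟨t, h2, SimpleGraph.ConnectedComponent.eq.1 h1⟩

theorem GraphData.Represents.edges_length {g : GraphData V} (hg : g.Represents G len v₀) :
    g.edges.length = G.edgeSet.ncard := by
  have h : G.edgeSet = {e | e ∈ g.edges.map fun e => s(e.1, e.2)} := by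
    ext e
    induction e using Sym2.ind with
    | _ x y =>
      rw [SimpleGraph.mem_edgeSet, hg.mem_edges, Set.mem_ofPred_eq, List.mem_map]
      constructor
      · rintro (h | h)
        · exact ⟨_, h, rfl⟩
        · exact ⟨_, h, Sym2.eq_swap⟩
      · rintro ⟨⟨a, b⟩, h, he⟩
        rcases Sym2.eq_iff.1 he with ⟨rfl, rfl⟩ | ⟨rfl, rfl⟩
        · exact Or.inl h
        · exact Or.inr h
  classical
  rw [h, ← List.coe_toFinset, Set.ncard_coe_finset, List.toFinset_card_of_nodup hg.edges_nodup,
    List.length_map]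

theorem GraphData.Represents.verts_length [Fintype V] [DecidableEq V] {g : GraphData V}
    (hg : g.Represents G len v₀) : g.verts.length = Fintype.card V := by
  rw [← List.toFinset_card_of_nodup hg.verts_nodup, ← Finset.card_univ]
  congr 1
  ext x
  simp [hg.mem_verts x]

/-- The walk from `x` to a terminal of its component is not trivial. -/
theorem exists_adj_of_not_isTerminal (hwp : WellPosed G v₀) {x : V} (hx : ¬ IsTerminal v₀ x) :
    ∃ y, G.Adj x y := by
  obtain ⟨t, h1, h2⟩ := hwp (G.connectedComponentMk x)
  obtain ⟨w⟩ := (SimpleGraph.ConnectedComponent.eq.1 h1).symm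
  cases w with
  | nil => exact absurd h2 hx
  | cons h _ => exact ⟨_, h⟩

/-- As `n ≥ 2`, both `1` and `Nat.log 2 n` are at most `log n / log 2`, and `2 / log 2 < 3`. -/
theorem natLog_add_one_le {n : ℕ} (hn : 2 ≤ n) : ((Nat.log 2 n + 1 : ℕ) : ℝ) ≤ 3 * Real.log n := by
  have hn0 : (0 : ℝ) < n := by positivity
  have h2 : Real.log 2 ≤ Real.log n := Real.log_le_log (by norm_num) (by exact_mod_cast hn)
  have h3 : ((Nat.log 2 n : ℕ) : ℝ) * Real.log 2 ≤ Real.log n := by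
    rw [← Real.log_pow]
    refine Real.log_le_log (by positivity) ?_
    exact_mod_cast Nat.pow_log_le_self 2 (by omega)
  have h4 := Real.log_two_gt_d9
  have h5 : ((Nat.log 2 n : ℕ) : ℝ) ≥ 0 := Nat.cast_nonneg _
  push_cast
  nlinarith

/-- Since no edge joins two terminals, every nontrivial terminal walk is free; multiplying by
positive lengths relates the two forms of the gradient bound. -/
theorem IsSteepest.exists_isSteepestFixablePath {g : GraphData V} (hvolt : g.volt = v₀)
    (hlen : ∀ e ∈ G.edgeSet, 0 < len e)
    (hTT : ∀ x y : V, G.Adj x y → ¬ (IsTerminal v₀ x ∧ IsTerminal v₀ y)) {o : Option (List V)}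
    (h : IsSteepest g G len o) : ∃ (s t : V) (w : G.Walk s t),
      o = some w.support ∧ IsSteepestFixablePath len v₀ w := by
  obtain ⟨P, β, rfl, -, ⟨s, t, a, b, ha, hb, w, hw, rfl, hl⟩, hmax⟩ := h
  have hpos : ∀ x y, G.Adj x y → 0 < len s(x, y) := fun x y h => hlen _ h
  rw [hvolt] at ha hb hmax
  have hgrad : pathGradient len v₀ w = β := by
    rw [pathGradient, ha, hb, Option.getD_some, Option.getD_some, hl]
    exact mul_div_cancel_right₀ _ (pathLength_pos hpos w hw).ne'
  refine ⟨s, t, w, rfl, ⟨by simp [IsTerminal, ha], by simp [IsTerminal, hb], hw,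
    fun d _ => hTT _ _ d.adj⟩, fun s' t' w' hw' => ?_⟩
  obtain ⟨a', ha'⟩ := Option.ne_none_iff_exists'.1 hw'.source
  obtain ⟨b', hb'⟩ := Option.ne_none_iff_exists'.1 hw'.target
  rw [hgrad, pathGradient, ha', hb', Option.getD_some, Option.getD_some,
    div_le_iff₀ (pathLength_pos hpos w' hw'.nontrivial)]
  exact hmax s' t' a' b' ha' hb' w'

end Main

end LexLearn

theorem mainTheorem5 :
    ∃ C : ℝ, 0 < C ∧
      ∀ (V : Type) [Fintype V] [DecidableEq V] (G : SimpleGraph V) (len : Sym2 V → ℝ)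
        (v₀ : V → Option ℝ),
        (∀ e ∈ G.edgeSet, 0 < len e) →
        LexLearn.WellPosed G v₀ →
        (∃ x : V, ¬ LexLearn.IsTerminal v₀ x) →
        (∀ x y : V, G.Adj x y → ¬ (LexLearn.IsTerminal v₀ x ∧ LexLearn.IsTerminal v₀ y)) →
        ∀ g : LexLearn.GraphData V, g.Represents G len v₀ →
          (∀ o : Option (List V), (LexLearn.steepestPath g).CanReturn o →
            ∃ (s t : V) (w : G.Walk s t),
              o = some w.support ∧ LexLearn.IsSteepestFixablePath len v₀ w) ∧
          (LexLearn.steepestPath g).expectedCost ≤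
            ENNReal.ofReal
              (C * ((G.edgeSet.ncard : ℝ) +
                (Fintype.card V : ℝ) * Real.log (Fintype.card V))) := by
  -- The constant is `3 * 4800`: the recursion costs 4800 times the size, and passing from `Nat.log
  -- 2 n + 1` to the natural logarithm costs a factor 3.
  refine ⟨14400, by norm_num, ?_⟩
  intro V _ _ G len v₀ hlen hwp ⟨x, hx⟩ hTT g hg
  have hI := hg.inst hlen hwp hTT
  -- A nonterminal vertex provides an edge. Hence the first draw is not from an empty array, and
  -- there are at least two vertices, as the bound on the logarithm requires.
  obtain ⟨y, hxy⟩ := LexLearn.exists_adj_of_not_isTerminal hwp hx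
  have hne : g.edges ≠ [] := by
    rcases (hg.mem_edges x y).1 hxy with h | h <;> exact List.ne_nil_of_mem h
  refine ⟨fun o ho => ?_, ?_⟩
  · exact (LexLearn.steepestPathAux_always _ g G hI hne le_rfl o ho).exists_isSteepestFixablePath
      hg.volt_eq hlen hTT
  · refine (LexLearn.steepestPathAux_expectedCost_le _ g G hI hne le_rfl).trans ?_
    rw [LexLearn.graphSize, hg.edges_length, hg.verts_length]
    have hcard : 2 ≤ Fintype.card V := Fintype.one_lt_card_iff.2 ⟨x, y, hxy.ne⟩
    have hlog := LexLearn.natLog_add_one_le hcard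
    have h0 : (2 * 2400 : ENNReal) * ((G.edgeSet.ncard + Fintype.card V *
        (Nat.log 2 (Fintype.card V) + 1) : ℕ) : ENNReal) = ENNReal.ofReal (4800 *
        ((G.edgeSet.ncard : ℝ) + (Fintype.card V : ℝ) *
          ((Nat.log 2 (Fintype.card V) + 1 : ℕ) : ℝ))) := by
      rw [ENNReal.ofReal_mul (by norm_num), ← Nat.cast_mul, ← Nat.cast_add,
        ENNReal.ofReal_natCast]
      norm_num
    rw [h0]
    refine ENNReal.ofReal_le_ofReal ?_
    have h1 := mul_le_mul_of_nonneg_left hlog (Nat.cast_nonneg (α := ℝ) (Fintype.card V))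
    have h2 : (0 : ℝ) ≤ (G.edgeSet.ncard : ℝ) := Nat.cast_nonneg _
    linarith
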